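/- A function $\psi:\mathbb{R}^+\to\mathbb{R}^+$ that is decreasing (not necessarily strictly) is called an approximating function. It has order $\lambda(\psi)\in\mathbb{R}$ if the limit $$\lambda(\psi):=\lim_{h\to\infty}\frac{-\log\psi(h)}{\log h}$$ exists. For $x\in\mathbb{R}$ let $\|x\|=\min\{|x-m|:m\in\mathbb{Z}\}$, and let $\mathcal{S}^*_2(\psi)$ be the set of points $(y_1,y_2)\in\mathbb{R}^2$ such that $\|qy_1\|\,\|qy_2\|<\psi(q)$ for infinitely many $q\in\mathbb{N}$. Below, $\dim$ denotes Hausdorff dimension. **Theorem.** Let $I_0\subseteq\mathbb{R}$ be an interval with more than one point, let $f\in C^{(3)}(I_0)$ be real-valued (with one-sided derivatives at any endpoint of $I_0$ that belongs to $I_0$), and let $\mathcal{C}_f:=\{(x,f(x)):x\in I_0\}$. Let $\psi$ be an approximating function of order $\lambda(\psi)>1$, and assume that $$\dim\{x\in I_0: f''(x)=0\}\le \frac{2}{1+\lambda(\psi)}.$$ Then $$\dim\bigl(\mathcal{C}_f\cap\mathcal{S}^*_2(\psi)\bigr)=\frac{2}{1+\lambda(\psi)}.$$ -/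

import Mathlib

open Filter Topology

/-- An approximating function: a positive, decreasing (in the weak sense) function `ℝ⁺ → ℝ⁺`.
It is represented by a function on `ℝ` of which only the values on `(0, ∞)` matter. -/
structure IsApproximatingFunction (ψ : ℝ → ℝ) : Prop where
  pos : ∀ h : ℝ, 0 < h → 0 < ψ h
  antitoneOn : AntitoneOn ψ (Set.Ioi 0)

/-- `l` is the order `λ(ψ)`, that is, the limit of `-log ψ(h) / log h` as `h → ∞` exists (in `ℝ`)
and equals `l`. -/
def HasOrder (ψ : ℝ → ℝ) (l : ℝ) : Prop :=
  Tendsto (fun h : ℝ => -Real.log (ψ h) / Real.log h) atTop (𝓝 l)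

/-- The distance `‖x‖ = min {|x - m| : m ∈ ℤ}` from `x` to the nearest integer. -/
noncomputable def distInt (x : ℝ) : ℝ := |x - round x|

theorem distInt_isLeast (x : ℝ) :
    IsLeast (Set.range fun m : ℤ => |x - (m : ℝ)|) (distInt x) := by
  refine ⟨⟨round x, rfl⟩, ?_⟩
  rintro _ ⟨m, rfl⟩
  exact round_le x m

/-- The set `S*_n(ψ)` of multiplicatively `ψ`-approximable points of `ℝⁿ`: those `y` for which
`∏ ‖q yᵢ‖ < ψ(q)` holds for infinitely many positive integers `q`. -/
def multApproximable (n : ℕ) (ψ : ℝ → ℝ) : Set (EuclideanSpace ℝ (Fin n)) :=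
  {y | {q : ℕ | 0 < q ∧ ∏ i : Fin n, distInt ((q : ℝ) * y i) < ψ (q : ℝ)}.Infinite}

/-- The planar curve `C_f = {(x, f x) : x ∈ I}`. -/
def graphCurve (f : ℝ → ℝ) (I : Set ℝ) : Set (EuclideanSpace ℝ (Fin 2)) :=
  (fun x : ℝ => !₂[x, f x]) '' I

/-! Lower bound. It is enough that the abscissa be well approximable. If `τ > l` and `|y - r| < q ^
(-1 - τ)` for rationals `r` with arbitrarily large denominators `q`, then `‖qy‖ ‖q f(y)‖ ≤ ‖qy‖ ≤ q
^ (-τ) < ψ q` for large `q`. Projection to the first coordinate is Lipschitz, so the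
Jarník–Besicovitch bound `le_dimH_wellApproximable` transfers to the curve, and `τ ↓ l`. That bound
is proved without a mass distribution. Were the dimension too small, balls of tiny total `s`-weight
would cover the set; averaging over the roughly `Q²` rationals of denominator about `Q`
(`exists_child`) produces nested intervals whose common point escapes every ball.

Upper bound. Endpoints are negligible and the zeros of `f''` are handled by hypothesis. Near any
other point `f` or `-f` agrees with a uniformly convex function on the line. Let `P = 2 ^ k ≤ q ≤
2P` and `‖qx‖ ‖q f(x)‖ < q ^ (-τ)`, and sort by a dyadic bound `2 ^ (-i)` for the larger factor. The
associated rational point lies within `O(2 ^ (-i) / P)` of the curve, while the smaller factor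
confines `x` to a set of diameter `O(2 ^ i * P ^ (-τ - 1))`. Huxley's bound
`ConvexPair.card_ratPoints_le` allows at most `P ^ η * (P² / 2 ^ i + P)` such points up to a
constant, and the Hausdorff–Cantelli sum converges once `s (1 + τ) > 2`.

Huxley's bound rests on duality (`ConvexPair.exists_dual_bound`). In a window of length `Δ = max √ε
(1 / Q)` the determinants of triples of points are `O((QΔ)³)`, so an overfull window is collinear.
Its line, unless vertical, is nearly tangent to the curve, hence is a rational point near the graph
of the Legendre transform. Counting points near a curve thus reduces to a weighted count near its
dual. For `ε` below `Q ^ (-2 - σ)` each dualization multiplies the exponent of `Q` by `1 - σ / 2`,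
until it falls to any prescribed value above 1; one more dualization gives the bound for all `ε`. -/

/-! ### Counting integer points by determinants and by separation -/

/-- The determinant of three integer vectors in dimension three. -/
def det3 (x y z : ℤ × ℤ × ℤ) : ℤ :=
  x.1 * (y.2.1 * z.2.2 - y.2.2 * z.2.1) - x.2.1 * (y.1 * z.2.2 - y.2.2 * z.1)
    + x.2.2 * (y.1 * z.2.1 - y.2.1 * z.1)

/-- A finite set of integer points in which every determinant is at most `D` is either coplanar
with the origin or has at most `27 D` elements. -/
theorem card_le_of_det3_le (S : Finset (ℤ × ℤ × ℤ)) (D : ℝ)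
    (hD : ∀ x ∈ S, ∀ y ∈ S, ∀ z ∈ S, (|det3 x y z| : ℝ) ≤ D) :
    (∀ x ∈ S, ∀ y ∈ S, ∀ z ∈ S, det3 x y z = 0) ∨ (S.card : ℝ) ≤ 27 * D := by
  classical
  by_cases hne : S.Nonempty
  swap
  · left
    intro x hx
    exact absurd ⟨x, hx⟩ hne
  obtain ⟨P, hP, hmax⟩ := Finset.exists_max_image (S ×ˢ S ×ˢ S) (fun t => |det3 t.1 t.2.1 t.2.2|)
    (hne.product (hne.product hne))
  obtain ⟨A, B, C⟩ := P
  simp only [Finset.mem_product] at hP hmax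
  obtain ⟨hA, hB, hC⟩ := hP
  have hmax' : ∀ x ∈ S, ∀ y ∈ S, ∀ z ∈ S, |det3 x y z| ≤ |det3 A B C| :=
    fun x hx y hy z hz => hmax (x, y, z) ⟨hx, hy, hz⟩
  set d := det3 A B C with hd
  by_cases h0 : d = 0
  · left
    intro x hx y hy z hz
    have := hmax' x hx y hy z hz
    rw [h0, abs_zero] at this
    exact abs_eq_zero.1 (le_antisymm this (abs_nonneg _))
  right
  let M : Matrix (Fin 3) (Fin 3) ℤ :=
    !![A.1, B.1, C.1; A.2.1, B.2.1, C.2.1; A.2.2, B.2.2, C.2.2]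
  have hM : M.det = d := by
    simp only [M, Matrix.det_fin_three, hd, det3]
    simp
    ring
  let F : (Fin 3 → ℤ) →ₗ[ℤ] (Fin 3 → ℤ) := Matrix.toLin' M
  have hF : LinearMap.det F = d := by rw [LinearMap.det_toLin', hM]
  have hinj : Function.Injective F := by
    rw [← LinearMap.ker_eq_bot, LinearMap.ker_eq_bot']
    intro m hm
    exact Matrix.eq_zero_of_mulVec_eq_zero (by rw [hM]; exact h0) (by simpa [F] using hm)
  let N : Submodule ℤ (Fin 3 → ℤ) := LinearMap.range F
  have hcard : Nat.card ((Fin 3 → ℤ) ⧸ N) = d.natAbs := by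
    rw [← Submodule.natAbs_det_equiv N (LinearEquiv.ofInjective F hinj), ← hF]
    rfl
  have : Finite ((Fin 3 → ℤ) ⧸ N) := Nat.finite_of_card_ne_zero (by
    rw [hcard]; simpa using h0)
  have : Fintype ((Fin 3 → ℤ) ⧸ N) := Fintype.ofFinite _
  let v : ℤ × ℤ × ℤ → (Fin 3 → ℤ) := fun z => ![z.1, z.2.1, z.2.2]
  -- The lattice `N` spanned by the extremal triple has index `|d|`. By maximality the Cramer
  -- coordinates of `z` lie in `[-1, 1]`, so each integer quotient takes three values, whence the
  -- factor 27. Equal classes mean coordinates that differ by integers; equal quotients then make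
  -- them equal.
  let Φ : ℤ × ℤ × ℤ → ((Fin 3 → ℤ) ⧸ N) × ℤ × ℤ × ℤ := fun z =>
    (Submodule.Quotient.mk (v z), det3 z B C / d, det3 A z C / d, det3 A B z / d)
  have hrange : ∀ t : ℤ, |t| ≤ |d| → t / d ∈ Finset.Icc (-1 : ℤ) 1 := by
    intro t ht
    rw [Finset.mem_Icc]
    rcases lt_or_gt_of_ne h0 with h | h
    · rw [abs_of_neg h] at ht
      have := abs_le.1 ht
      have e : t / d = -(t / (-d)) := by rw [Int.ediv_neg]; simp
      constructor
      · rw [e]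
        have : t / (-d) ≤ 1 := Int.ediv_le_of_le_mul (by omega) (by omega)
        omega
      · rw [e]
        have : -1 ≤ t / (-d) := by rw [Int.le_ediv_iff_mul_le (by omega)]; omega
        omega
    · rw [abs_of_pos h] at ht
      have := abs_le.1 ht
      constructor
      · rw [Int.le_ediv_iff_mul_le h]; omega
      · exact Int.ediv_le_of_le_mul h (by omega)
  have key : ∀ t t' n : ℤ, t = t' + d * n → t / d = t' / d → t = t' := by
    intro t t' n h1 h2
    rw [h1, Int.add_mul_ediv_left _ _ h0] at h2
    have : n = 0 := by omega
    rw [h1, this]; simp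
  have hle : S.card ≤ ((Finset.univ : Finset ((Fin 3 → ℤ) ⧸ N)) ×ˢ (Finset.Icc (-1 : ℤ) 1) ×ˢ
      (Finset.Icc (-1 : ℤ) 1) ×ˢ (Finset.Icc (-1 : ℤ) 1)).card := by
    refine Finset.card_le_card_of_injOn Φ ?_ ?_
    · intro z hz
      simp only [Finset.coe_product, Set.mem_prod, Finset.mem_coe, Φ]
      exact ⟨Finset.mem_univ _, hrange _ (hmax' _ hz _ hB _ hC), hrange _ (hmax' _ hA _ hz _ hC),
        hrange _ (hmax' _ hA _ hB _ hz)⟩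
    · intro z _ z' _ h
      simp only [Φ, Prod.mk.injEq] at h
      obtain ⟨h1, h2, h3, h4⟩ := h
      rw [Submodule.Quotient.eq] at h1
      obtain ⟨n, hn⟩ := h1
      have e0 := congrFun hn 0
      have e1 := congrFun hn 1
      have e2 := congrFun hn 2
      simp [F, M, v, Matrix.mulVec, dotProduct, Fin.sum_univ_three] at e0 e1 e2
      have f1 : det3 z B C = det3 z' B C := by
        refine key _ _ (n 0) ?_ h2
        rw [hd]; simp only [det3]
        linear_combination (-(B.2.1 * C.2.2 - B.2.2 * C.2.1)) * e0
          + (B.1 * C.2.2 - B.2.2 * C.1) * e1 - (B.1 * C.2.1 - B.2.1 * C.1) * e2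
      have f2 : det3 A z C = det3 A z' C := by
        refine key _ _ (n 1) ?_ h3
        rw [hd]; simp only [det3]
        linear_combination (A.2.1 * C.2.2 - A.2.2 * C.2.1) * e0
          - (A.1 * C.2.2 - A.2.2 * C.1) * e1 + (A.1 * C.2.1 - A.2.1 * C.1) * e2
      have f3 : det3 A B z = det3 A B z' := by
        refine key _ _ (n 2) ?_ h4
        rw [hd]; simp only [det3]
        linear_combination (-(A.2.1 * B.2.2 - A.2.2 * B.2.1)) * e0
          + (A.1 * B.2.2 - A.2.2 * B.1) * e1 - (A.1 * B.2.1 - A.2.1 * B.1) * e2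
      have cr : ∀ w : ℤ × ℤ × ℤ,
          d * w.1 = det3 w B C * A.1 + det3 A w C * B.1 + det3 A B w * C.1 ∧
          d * w.2.1 = det3 w B C * A.2.1 + det3 A w C * B.2.1 + det3 A B w * C.2.1 ∧
          d * w.2.2 = det3 w B C * A.2.2 + det3 A w C * B.2.2 + det3 A B w * C.2.2 := by
        intro w
        rw [hd]
        simp only [det3]
        refine ⟨?_, ?_, ?_⟩ <;> ring
      have c1 := cr z
      have c2 := cr z'
      rw [f1, f2, f3] at c1
      refine Prod.ext ?_ (Prod.ext ?_ ?_)
      · exact mul_left_cancel₀ h0 (c1.1.trans c2.1.symm)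
      · exact mul_left_cancel₀ h0 (c1.2.1.trans c2.2.1.symm)
      · exact mul_left_cancel₀ h0 (c1.2.2.trans c2.2.2.symm)
  have hcc : S.card ≤ d.natAbs * 27 := by
    refine hle.trans (le_of_eq ?_)
    simp only [Finset.card_product, Finset.card_univ, ← hcard, Nat.card_eq_fintype_card]
    rfl
  have hdD := hD A hA B hB C hC
  have : ((d.natAbs : ℕ) : ℝ) = |(d : ℝ)| := by
    rw [Nat.cast_natAbs, Int.cast_abs]
  calc (S.card : ℝ) ≤ ((d.natAbs * 27 : ℕ) : ℝ) := by exact_mod_cast hcc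
    _ = 27 * |(d : ℝ)| := by push_cast [this]; ring
    _ ≤ 27 * D := by
      have : |(d : ℝ)| ≤ D := by simpa using hdD
      linarith

/-- A finite set that a function maps `s`-separatedly to an interval of length `X` has at most
`X / s + 1` elements. -/
theorem card_le_of_separated {ι : Type*} (S : Finset ι) (φ : ι → ℝ) (s X : ℝ) (hs : 0 < s)
    (hX : 0 ≤ X)
    (hsep : ∀ x ∈ S, ∀ y ∈ S, x ≠ y → s ≤ |φ x - φ y|)
    (hdiam : ∀ x ∈ S, ∀ y ∈ S, φ x - φ y ≤ X) : (S.card : ℝ) ≤ X / s + 1 := by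
  classical
  by_cases hne : S.Nonempty
  swap
  · rw [Finset.not_nonempty_iff_eq_empty.1 hne]
    simp only [Finset.card_empty, Nat.cast_zero]
    positivity
  obtain ⟨a, ha, hmin⟩ := Finset.exists_min_image S φ hne
  have hle : S.card ≤ (Finset.range (⌊X / s⌋₊ + 1)).card := by
    refine Finset.card_le_card_of_injOn (fun x => ⌊(φ x - φ a) / s⌋₊) ?_ ?_
    · intro x hx
      simp only [Finset.coe_range, Set.mem_Iio]
      refine Nat.lt_succ_of_le (Nat.floor_le_floor ?_)
      gcongr
      exact hdiam x hx a ha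
    · intro x hx y hy h
      by_contra hne
      have h1 := hsep x hx y hy hne
      have hx0 : 0 ≤ (φ x - φ a) / s := div_nonneg (by linarith [hmin x hx]) hs.le
      have hy0 : 0 ≤ (φ y - φ a) / s := div_nonneg (by linarith [hmin y hy]) hs.le
      simp only at h
      have a1 := Nat.floor_le hx0
      have a2 := Nat.lt_floor_add_one ((φ x - φ a) / s)
      have a3 := Nat.floor_le hy0
      have a4 := Nat.lt_floor_add_one ((φ y - φ a) / s)
      rw [h] at a1 a2
      have hlt : |(φ x - φ a) / s - (φ y - φ a) / s| < 1 := by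
        rw [abs_lt]; constructor <;> linarith
      rw [← sub_div, abs_div, abs_of_pos hs, div_lt_one hs] at hlt
      have : φ x - φ a - (φ y - φ a) = φ x - φ y := by ring
      rw [this] at hlt
      linarith
  rw [Finset.card_range] at hle
  calc (S.card : ℝ) ≤ ((⌊X / s⌋₊ + 1 : ℕ) : ℝ) := by exact_mod_cast hle
    _ ≤ X / s + 1 := by
      push_cast
      gcongr
      exact Nat.floor_le (by positivity)

/-! ### Uniformly convex functions and Legendre duality -/

/-- A uniformly convex function `f : ℝ → ℝ` with derivative `g`: the remainder of the first-order
Taylor expansion lies between `m (y - x)²` and `M (y - x)²`. -/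
structure ConvexPair (f g : ℝ → ℝ) (m M : ℝ) : Prop where
  pos : 0 < m
  lower : ∀ x y, m * (y - x) ^ 2 ≤ f y - f x - g x * (y - x)
  upper : ∀ x y, f y - f x - g x * (y - x) ≤ M * (y - x) ^ 2
  surj : Function.Surjective g

/-- The Legendre transform of a convex function `f` with derivative `g`. -/
noncomputable def legendre (f g : ℝ → ℝ) (u : ℝ) : ℝ :=
  u * Function.invFun g u - f (Function.invFun g u)

namespace ConvexPair

variable {f g : ℝ → ℝ} {m M : ℝ}

theorem le (h : ConvexPair f g m M) : m ≤ M := by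
  have h1 := h.lower 0 1
  have h2 := h.upper 0 1
  norm_num at h1 h2
  linarith

theorem pos' (h : ConvexPair f g m M) : 0 < M := h.pos.trans_le h.le

theorem mul_sub_lower (h : ConvexPair f g m M) (x y : ℝ) :
    2 * m * (y - x) ^ 2 ≤ (g y - g x) * (y - x) := by
  have h1 := h.lower x y
  have h2 := h.lower y x
  nlinarith

theorem mul_sub_upper (h : ConvexPair f g m M) (x y : ℝ) :
    (g y - g x) * (y - x) ≤ 2 * M * (y - x) ^ 2 := by
  have h1 := h.upper x y
  have h2 := h.upper y x
  nlinarith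

theorem abs_lower (h : ConvexPair f g m M) (x y : ℝ) : 2 * m * |y - x| ≤ |g y - g x| := by
  rcases eq_or_ne x y with rfl | hne
  · simp
  have hp : 0 < |y - x| := abs_pos.2 (sub_ne_zero.2 hne.symm)
  have h1 := h.mul_sub_lower x y
  have h2 : (g y - g x) * (y - x) ≤ |g y - g x| * |y - x| := by
    rw [← abs_mul]; exact le_abs_self _
  rw [← sq_abs] at h1
  refine le_of_mul_le_mul_right ?_ hp
  nlinarith

theorem injective (h : ConvexPair f g m M) : Function.Injective g := by
  intro x y hxy
  have := h.abs_lower x y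
  rw [hxy, sub_self, abs_zero] at this
  have h0 : |y - x| = 0 := le_antisymm (by
    have := h.pos
    by_contra hc
    push Not at hc
    nlinarith) (abs_nonneg _)
  linarith [abs_eq_zero.1 h0]

theorem abs_upper (h : ConvexPair f g m M) (x y : ℝ) : |g y - g x| ≤ 2 * M * |y - x| := by
  rcases eq_or_ne x y with rfl | hne
  · simp
  have hp : 0 < |y - x| := abs_pos.2 (sub_ne_zero.2 hne.symm)
  have h1 := h.mul_sub_upper x y
  have h2 : |g y - g x| * |y - x| = (g y - g x) * (y - x) := by
    rw [← abs_mul, abs_of_nonneg]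
    exact le_trans (by have := h.pos; positivity) (h.mul_sub_lower x y)
  rw [← sq_abs] at h1
  refine le_of_mul_le_mul_right ?_ hp
  nlinarith

theorem invFun_apply (h : ConvexPair f g m M) (x : ℝ) : Function.invFun g (g x) = x :=
  Function.leftInverse_invFun h.injective x

theorem apply_invFun (h : ConvexPair f g m M) (u : ℝ) : g (Function.invFun g u) = u :=
  Function.invFun_eq (h.surj u)

/-- Legendre duality preserves uniform convexity. -/
theorem dual (h : ConvexPair f g m M) :
    ConvexPair (legendre f g) (Function.invFun g) (m / (4 * M ^ 2)) (M / (4 * m ^ 2)) := by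
  have hm := h.pos
  have hM := h.pos'
  -- The Taylor remainder of the dual is the Taylor remainder of `f` with the two base points
  -- interchanged.
  have key : ∀ u v, legendre f g v - legendre f g u - Function.invFun g u * (v - u) =
      f (Function.invFun g u) - f (Function.invFun g v)
        - g (Function.invFun g v) * (Function.invFun g u - Function.invFun g v) := by
    intro u v
    rw [h.apply_invFun]
    simp only [legendre]
    ring
  refine ⟨by positivity, ?_, ?_, fun x => ⟨g x, h.invFun_apply x⟩⟩
  · intro u v
    rw [key]
    refine le_trans ?_ (h.lower _ _)
    have := h.abs_upper (Function.invFun g v) (Function.invFun g u)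
    rw [h.apply_invFun, h.apply_invFun] at this
    have h2 : (v - u) ^ 2 ≤ 4 * M ^ 2 * (Function.invFun g u - Function.invFun g v) ^ 2 := by
      rw [← sq_abs (Function.invFun g u - _), ← sq_abs (v - u), abs_sub_comm v u]
      calc |u - v| ^ 2 ≤ (2 * M * |Function.invFun g u - Function.invFun g v|) ^ 2 := by gcongr
        _ = _ := by ring
    rw [div_mul_eq_mul_div, div_le_iff₀ (by positivity)]
    nlinarith
  · intro u v
    rw [key]
    refine le_trans (h.upper _ _) ?_
    have := h.abs_lower (Function.invFun g v) (Function.invFun g u)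
    rw [h.apply_invFun, h.apply_invFun] at this
    have h2 : 4 * m ^ 2 * (Function.invFun g u - Function.invFun g v) ^ 2 ≤ (v - u) ^ 2 := by
      rw [← sq_abs (Function.invFun g u - _), ← sq_abs (v - u), abs_sub_comm v u]
      calc _ = (2 * m * |Function.invFun g u - Function.invFun g v|) ^ 2 := by ring
        _ ≤ |u - v| ^ 2 := by gcongr
    rw [div_mul_eq_mul_div, le_div_iff₀ (by positivity)]
    nlinarith

theorem g_bounded (h : ConvexPair f g m M) {x R : ℝ} (hx : |x| ≤ R) :
    |g x| ≤ |g 0| + 2 * M * R := by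
  have h1 := h.abs_upper 0 x
  rw [sub_zero] at h1
  have h2 : |g x| ≤ |g 0| + |g x - g 0| := by
    calc |g x| = |g 0 + (g x - g 0)| := by congr 1; ring
      _ ≤ _ := abs_add_le _ _
  have := h.pos'
  nlinarith

/-- Two points on the same side of the minimum of `f - ℓ`, at which `f - ℓ` is small in absolute
value, are close to each other. Here `v` is the value of the minimum, attained at `x₀`. -/
theorem sub_sq_mul_le (h : ConvexPair f g m M) {x₀ x x' v ε w : ℝ}
    (hside : 0 ≤ (x - x₀) * (x' - x))
    (hx : |f x - f x₀ - g x₀ * (x - x₀) + v| ≤ ε)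
    (hx' : |f x' - f x₀ - g x₀ * (x' - x₀) + v| ≤ ε)
    (hw : w ≤ max |v| ε) :
    (x' - x) ^ 2 * w ≤ (8 * M / m ^ 2 + 4 / m) * ε ^ 2 := by
  have hm := h.pos
  have hM := h.pos'
  have hε : 0 ≤ ε := (abs_nonneg _).trans hx
  rw [abs_le] at hx hx'
  have u1 := h.lower x x'
  have u2 := h.mul_sub_lower x₀ x
  have u3 := h.upper x₀ x'
  have u4 := h.lower x₀ x'
  have u2' : 2 * m * ((x - x₀) * (x' - x)) ≤ (g x - g x₀) * (x' - x) := by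
    rcases eq_or_ne x x₀ with rfl | hne
    · simp
    have hp : 0 < (x - x₀) ^ 2 := by have := sub_ne_zero.2 hne; positivity
    refine le_of_mul_le_mul_right ?_ hp
    calc 2 * m * ((x - x₀) * (x' - x)) * (x - x₀) ^ 2
        = (2 * m * (x - x₀) ^ 2) * ((x - x₀) * (x' - x)) := by ring
      _ ≤ ((g x - g x₀) * (x - x₀)) * ((x - x₀) * (x' - x)) := by gcongr
      _ = _ := by ring
  have key : m * ((x' - x) ^ 2 + 2 * ((x - x₀) * (x' - x))) ≤ 2 * ε := by nlinarith
  have key2 : m * (x' - x) ^ 2 ≤ 2 * ε := by nlinarith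
  have e : (8 * M / m ^ 2 + 4 / m) * ε ^ 2 = 8 * M / m ^ 2 * ε ^ 2 + 4 / m * ε ^ 2 := by ring
  have sm : (x' - x) ^ 2 ≤ 2 * ε / m := by rw [le_div_iff₀ hm]; linarith
  have p1 : 0 ≤ 8 * M / m ^ 2 * ε ^ 2 := by positivity
  have p2 : 0 ≤ 4 / m * ε ^ 2 := by positivity
  -- If `|v| ≤ 2ε`, then `key2` alone suffices. Otherwise `v` is negative, since `f` lies above its
  -- tangent, and `x'` must be at distance at least `√(|v| / (2M))` from the minimum. The function
  -- is steep there, and `key` bounds the product `(x' - x) (x' - x₀)`.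
  by_cases hv : |v| ≤ 2 * ε
  · have : w ≤ 2 * ε := hw.trans (max_le hv (by linarith))
    have : (x' - x) ^ 2 * w ≤ (2 * ε / m) * (2 * ε) := by
      calc (x' - x) ^ 2 * w ≤ (x' - x) ^ 2 * (2 * ε) := by gcongr
        _ ≤ _ := by gcongr
    have e2 : (2 * ε / m) * (2 * ε) = 4 / m * ε ^ 2 := by field_simp; ring
    linarith
  · push Not at hv
    have hw' : w ≤ |v| := hw.trans (max_le le_rfl (by linarith))
    have hvb : |v| ≤ 2 * M * (x' - x₀) ^ 2 := by
      rcases abs_cases v with ⟨hv1, hv2⟩ | ⟨hv1, hv2⟩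
      · have : 0 ≤ m * (x' - x₀) ^ 2 := by positivity
        linarith
      · nlinarith
    have sq : ((x' - x) * (x' - x₀)) ^ 2 ≤ (2 * ε / m) ^ 2 := by
      have n0 : (x' - x) * (x' - x₀) = (x' - x) ^ 2 + (x - x₀) * (x' - x) := by ring
      have n1 : 0 ≤ (x' - x) * (x' - x₀) := by rw [n0]; positivity
      have n2 : (x' - x) * (x' - x₀) ≤ 2 * ε / m := by
        rw [n0, le_div_iff₀ hm]; nlinarith
      gcongr
    have : (x' - x) ^ 2 * w ≤ 2 * M * (2 * ε / m) ^ 2 := by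
      calc (x' - x) ^ 2 * w ≤ (x' - x) ^ 2 * (2 * M * (x' - x₀) ^ 2) := by gcongr; linarith
        _ = 2 * M * ((x' - x) * (x' - x₀)) ^ 2 := by ring
        _ ≤ _ := by gcongr
    have e2 : 2 * M * (2 * ε / m) ^ 2 = 8 * M / m ^ 2 * ε ^ 2 := by field_simp; ring
    linarith

end ConvexPair

/-! ### Rational points near the graph and the rational lines through them -/

/-- Integer vectors with coprime entries. -/
def Primitive (z : ℤ × ℤ × ℤ) : Prop := Int.gcd z.1 (Int.gcd z.2.1 z.2.2) = 1

/-- Primitive representatives `(q, p, r)` of the rational points `(p / q, r / q)` with denominator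
at most `Q`, abscissa in `[-R, R]`, and vertical distance at most `ε` from the graph of `f`. -/
def ratPoints (f : ℝ → ℝ) (R Q ε : ℝ) : Set (ℤ × ℤ × ℤ) :=
  {z | Primitive z ∧ 1 ≤ z.1 ∧ (z.1 : ℝ) ≤ Q ∧ |(z.2.1 : ℝ) / z.1| ≤ R ∧
    |f ((z.2.1 : ℝ) / z.1) - (z.2.2 : ℝ) / z.1| ≤ ε}

/-- Incidence between the point `(q, p, r)` and the line `c y = b x - a`, given as `(c, b, a)`. -/
def OnLine (ℓ z : ℤ × ℤ × ℤ) : Prop := ℓ.1 * z.2.2 = ℓ.2.1 * z.2.1 - ℓ.2.2 * z.1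

theorem Primitive.dvd_of_dvd_mul {ℓ : ℤ × ℤ × ℤ} (h : Primitive ℓ) {k n : ℤ}
    (h1 : k ∣ ℓ.1 * n) (h2 : k ∣ ℓ.2.1 * n) (h3 : k ∣ ℓ.2.2 * n) : k ∣ n := by
  have e2 : k ∣ (Int.gcd ℓ.2.1 ℓ.2.2 : ℤ) * n := by
    rw [Int.gcd_eq_gcd_ab]
    have : (ℓ.2.1 * Int.gcdA ℓ.2.1 ℓ.2.2 + ℓ.2.2 * Int.gcdB ℓ.2.1 ℓ.2.2) * n
      = Int.gcdA ℓ.2.1 ℓ.2.2 * (ℓ.2.1 * n) + Int.gcdB ℓ.2.1 ℓ.2.2 * (ℓ.2.2 * n) := by ring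
    rw [this]
    exact dvd_add (Dvd.dvd.mul_left h2 _) (Dvd.dvd.mul_left h3 _)
  have e1 : k ∣ (Int.gcd ℓ.1 (Int.gcd ℓ.2.1 ℓ.2.2) : ℤ) * n := by
    rw [Int.gcd_eq_gcd_ab]
    have : (ℓ.1 * Int.gcdA ℓ.1 (Int.gcd ℓ.2.1 ℓ.2.2)
        + (Int.gcd ℓ.2.1 ℓ.2.2 : ℤ) * Int.gcdB ℓ.1 (Int.gcd ℓ.2.1 ℓ.2.2)) * n
      = Int.gcdA ℓ.1 (Int.gcd ℓ.2.1 ℓ.2.2) * (ℓ.1 * n)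
        + Int.gcdB ℓ.1 (Int.gcd ℓ.2.1 ℓ.2.2) * ((Int.gcd ℓ.2.1 ℓ.2.2 : ℤ) * n) := by ring
    rw [this]
    exact dvd_add (Dvd.dvd.mul_left h1 _) (Dvd.dvd.mul_left e2 _)
  rw [h] at e1
  simpa using e1

/-- With `n` the cross-difference and `ℓ = (c, b, a)`, eliminating one coordinate at a time shows
that `c` divides `b n` and `a n` as well as `c n`; coprimality leaves `c ∣ n`. Hence abscissae on
one line are `c / Q²`-separated, which is what makes lines of large `c` carry few points. -/
theorem OnLine.dvd {ℓ z z' : ℤ × ℤ × ℤ} (hℓ : Primitive ℓ) (h : OnLine ℓ z) (h' : OnLine ℓ z') :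
    ℓ.1 ∣ z.2.1 * z'.1 - z'.2.1 * z.1 := by
  unfold OnLine at h h'
  refine hℓ.dvd_of_dvd_mul (Dvd.intro _ rfl) ?_ ?_
  · exact ⟨z.2.2 * z'.1 - z'.2.2 * z.1, by linear_combination z.1 * h' - z'.1 * h⟩
  · exact ⟨z.2.2 * z'.2.1 - z'.2.2 * z.2.1, by linear_combination z.2.1 * h' - z'.2.1 * h⟩

/-- Two primitive vectors with positive first entry that represent the same point are equal. -/
theorem Primitive.ext_of_proportional {z z' : ℤ × ℤ × ℤ} (hz : Primitive z) (hz' : Primitive z')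
    (h1 : 1 ≤ z.1) (h1' : 1 ≤ z'.1) (h2 : z.2.1 * z'.1 = z'.2.1 * z.1)
    (h3 : z.2.2 * z'.1 = z'.2.2 * z.1) : z = z' := by
  have d1 : z.1 ∣ z'.1 := hz.dvd_of_dvd_mul (Dvd.intro _ rfl) ⟨z'.2.1, by rw [h2]; ring⟩
    ⟨z'.2.2, by rw [h3]; ring⟩
  have d2 : z'.1 ∣ z.1 := hz'.dvd_of_dvd_mul (Dvd.intro _ rfl) ⟨z.2.1, by rw [← h2]; ring⟩
    ⟨z.2.2, by rw [← h3]; ring⟩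
  have e : z.1 = z'.1 := Int.dvd_antisymm (by omega) (by omega) d1 d2
  have hne : z'.1 ≠ 0 := by omega
  rw [e] at h2 h3
  exact Prod.ext e (Prod.ext (mul_right_cancel₀ hne h2) (mul_right_cancel₀ hne h3))

theorem le_abs_div_sub_div {a b c d k : ℤ} {Q : ℝ} (hb : 1 ≤ b) (hd : 1 ≤ d) (hbQ : (b : ℝ) ≤ Q)
    (hdQ : (d : ℝ) ≤ Q) (hk : k ∣ a * d - c * b) (hne : a * d ≠ c * b) (hk0 : 0 ≤ k) :
    (k : ℝ) / Q ^ 2 ≤ |(a : ℝ) / b - (c : ℝ) / d| := by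
  have hb' : (0 : ℝ) < b := by exact_mod_cast (by omega : 0 < b)
  have hd' : (0 : ℝ) < d := by exact_mod_cast (by omega : 0 < d)
  have h1 : k ≤ |a * d - c * b| :=
    Int.le_of_dvd (abs_pos.2 (sub_ne_zero.2 hne)) ((dvd_abs _ _).2 hk)
  have h2 : (k : ℝ) ≤ |(a : ℝ) * d - c * b| := by exact_mod_cast h1
  have e : (a : ℝ) / b - (c : ℝ) / d = ((a : ℝ) * d - c * b) / (b * d) := by
    field_simp
  rw [e, abs_div, abs_of_pos (mul_pos hb' hd')]
  have hk0' : (0 : ℝ) ≤ k := by exact_mod_cast hk0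
  have hQ : 0 ≤ Q := hb'.le.trans hbQ
  have : (b : ℝ) * d ≤ Q ^ 2 := by rw [sq]; gcongr
  exact div_le_div₀ (abs_nonneg _) h2 (by positivity) this

namespace ConvexPair

variable {f g : ℝ → ℝ} {m M : ℝ}

/-- The signed vertical displacement of the line `c y = b x - a` below the parallel tangent. -/
noncomputable def offset (f g : ℝ → ℝ) (ℓ : ℤ × ℤ × ℤ) : ℝ :=
  (ℓ.2.2 : ℝ) / ℓ.1 - legendre f g ((ℓ.2.1 : ℝ) / ℓ.1)

/-- The tangent of slope `u` is `y = u x - legendre f g u`, so the height of the graph over the line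
is the tangent remainder plus a constant. The absolute value of that constant is also the vertical
distance from `(b / c, a / c)` to the dual curve; this double reading drives the duality. -/
theorem sub_line_eq (h : ConvexPair f g m M) {ℓ z : ℤ × ℤ × ℤ} (hℓ : 1 ≤ ℓ.1) (hz : 1 ≤ z.1)
    (hon : OnLine ℓ z) (x₀ : ℝ) (hx₀ : x₀ = Function.invFun g ((ℓ.2.1 : ℝ) / ℓ.1)) :
    f ((z.2.1 : ℝ) / z.1) - (z.2.2 : ℝ) / z.1 =
      f ((z.2.1 : ℝ) / z.1) - f x₀ - g x₀ * ((z.2.1 : ℝ) / z.1 - x₀) + offset f g ℓ := by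
  have hc : (ℓ.1 : ℝ) ≠ 0 := by exact_mod_cast (by omega : ℓ.1 ≠ 0)
  have hq : (z.1 : ℝ) ≠ 0 := by exact_mod_cast (by omega : z.1 ≠ 0)
  have e : (z.2.2 : ℝ) / z.1 = (ℓ.2.1 : ℝ) / ℓ.1 * ((z.2.1 : ℝ) / z.1) - (ℓ.2.2 : ℝ) / ℓ.1 := by
    unfold OnLine at hon
    have hon' : (ℓ.1 : ℝ) * z.2.2 = ℓ.2.1 * z.2.1 - ℓ.2.2 * z.1 := by exact_mod_cast hon
    field_simp
    linarith
  rw [e, hx₀, h.apply_invFun, offset, legendre]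
  ring

/-- On either side of the point of parallel tangency, the abscissae lie within `O(ε / √(max |offset|
ε))` of each other by `sub_sq_mul_le`, and they are `c / Q²`-separated. The two sides account for
the factors 2. -/
theorem card_le_of_onLine (h : ConvexPair f g m M) {R Q ε : ℝ} (hQ : 1 ≤ Q) (hε : 0 < ε)
    {ℓ : ℤ × ℤ × ℤ} (hℓ : Primitive ℓ) (hℓ1 : 1 ≤ ℓ.1) (S : Finset (ℤ × ℤ × ℤ))
    (hS : ↑S ⊆ ratPoints f R Q ε) (hon : ∀ z ∈ S, OnLine ℓ z) :
    (S.card : ℝ) ≤ 2 + 2 * √(8 * M / m ^ 2 + 4 / m) *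
      (ε * Q ^ 2 / (ℓ.1 * √(max |offset f g ℓ| ε))) := by
  classical
  have hm := h.pos
  have hM := h.pos'
  set A := 8 * M / m ^ 2 + 4 / m with hA
  have hA0 : 0 < A := by positivity
  set w := max |offset f g ℓ| ε with hw
  have hw0 : 0 < w := lt_of_lt_of_le hε (le_max_right _ _)
  set x₀ := Function.invFun g ((ℓ.2.1 : ℝ) / ℓ.1) with hx₀
  have hc : (0 : ℝ) < ℓ.1 := by exact_mod_cast (by omega : 0 < ℓ.1)
  set X := √A * ε / √w with hX
  have hX0 : 0 ≤ X := by positivity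
  have hXsq : X ^ 2 = A * ε ^ 2 / w := by
    rw [hX, div_pow, mul_pow, Real.sq_sqrt hA0.le, Real.sq_sqrt hw0.le]
  let φ : ℤ × ℤ × ℤ → ℝ := fun z => (z.2.1 : ℝ) / z.1
  have hsmall : ∀ z ∈ S, |f (φ z) - f x₀ - g x₀ * (φ z - x₀) + offset f g ℓ| ≤ ε := by
    intro z hz
    have h1 := hS hz
    rw [← h.sub_line_eq hℓ1 h1.2.1 (hon z hz) x₀ hx₀]
    exact h1.2.2.2.2
  have hdist : ∀ z ∈ S, ∀ z' ∈ S, 0 ≤ (φ z - x₀) * (φ z' - φ z) → |φ z' - φ z| ≤ X := by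
    intro z hz z' hz' hside
    have := h.sub_sq_mul_le hside (hsmall z hz) (hsmall z' hz') le_rfl
    rw [← hw, ← hA, ← le_div_iff₀ hw0, ← hXsq] at this
    exact abs_le_of_sq_le_sq this hX0
  have hsep : ∀ z ∈ S, ∀ z' ∈ S, z ≠ z' → (ℓ.1 : ℝ) / Q ^ 2 ≤ |φ z - φ z'| := by
    intro z hz z' hz' hne
    obtain ⟨a1, a2, a3, -, -⟩ := hS hz
    obtain ⟨b1, b2, b3, -, -⟩ := hS hz'
    refine le_abs_div_sub_div a2 b2 a3 b3 ((hon z hz).dvd hℓ (hon z' hz')) ?_ (by omega)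
    intro heq
    refine hne (a1.ext_of_proportional b1 a2 b2 heq ?_)
    have h1 := hon z hz
    have h2 := hon z' hz'
    unfold OnLine at h1 h2
    have hne0 : ℓ.1 ≠ 0 := by omega
    refine mul_left_cancel₀ hne0 ?_
    linear_combination z'.1 * h1 - z.1 * h2 + ℓ.2.1 * heq
  have half : ∀ T : Finset (ℤ × ℤ × ℤ), T ⊆ S →
      ((∀ z ∈ T, x₀ ≤ φ z) ∨ (∀ z ∈ T, φ z ≤ x₀)) →
      (T.card : ℝ) ≤ X / ((ℓ.1 : ℝ) / Q ^ 2) + 1 := by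
    intro T hT hside
    refine card_le_of_separated T φ _ X (by positivity) hX0
      (fun z hz z' hz' => hsep z (hT hz) z' (hT hz')) ?_
    intro z hz z' hz'
    rcases hside with hs | hs
    · rcases le_total (φ z) (φ z') with hle | hle
      · linarith
      · exact (le_abs_self _).trans (hdist z' (hT hz') z (hT hz)
          (mul_nonneg (by linarith [hs z' hz']) (by linarith)))
    · rcases le_total (φ z) (φ z') with hle | hle
      · linarith
      · have := hdist z (hT hz) z' (hT hz')
          (mul_nonneg_of_nonpos_of_nonpos (by linarith [hs z hz]) (by linarith))
        rw [abs_sub_comm] at this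
        exact (le_abs_self _).trans this
  have h1 := half (S.filter fun z => x₀ ≤ φ z) (Finset.filter_subset _ _)
    (Or.inl fun z hz => (Finset.mem_filter.1 hz).2)
  have h2 := half (S.filter fun z => ¬ x₀ ≤ φ z) (Finset.filter_subset _ _)
    (Or.inr fun z hz => (not_le.1 (Finset.mem_filter.1 hz).2).le)
  have hsum := Finset.card_filter_add_card_filter_not (s := S) (fun z => x₀ ≤ φ z)
  have hsum' : (S.card : ℝ) = ((S.filter fun z => x₀ ≤ φ z).card : ℝ)
      + ((S.filter fun z => ¬ x₀ ≤ φ z).card : ℝ) := by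
    exact_mod_cast hsum.symm
  have e : X / ((ℓ.1 : ℝ) / Q ^ 2) = √A * (ε * Q ^ 2 / (ℓ.1 * √w)) := by
    rw [hX]
    have : √w ≠ 0 := (Real.sqrt_pos.2 hw0).ne'
    field_simp
  rw [e] at h1 h2
  rw [hsum']
  linarith

/-- The determinant is the product of the three denominators and twice a signed triangle area.
Subtracting the tangent at the first point leaves heights of at most `M Δ² + 2ε ≤ (M + 2) Δ²` over a
base of length at most `Δ`. -/
theorem abs_det3_le (h : ConvexPair f g m M) {R Q ε Δ : ℝ} (hΔ : 0 ≤ Δ) (hεΔ : ε ≤ Δ ^ 2)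
    {x y z : ℤ × ℤ × ℤ} (hx : x ∈ ratPoints f R Q ε) (hy : y ∈ ratPoints f R Q ε)
    (hz : z ∈ ratPoints f R Q ε)
    (hxy : |(y.2.1 : ℝ) / y.1 - (x.2.1 : ℝ) / x.1| ≤ Δ)
    (hxz : |(z.2.1 : ℝ) / z.1 - (x.2.1 : ℝ) / x.1| ≤ Δ) :
    (|det3 x y z| : ℝ) ≤ 2 * (M + 2) * (Q * Δ) ^ 3 := by
  have hM := h.pos'
  obtain ⟨-, x1, x2, -, x3⟩ := hx
  obtain ⟨-, y1, y2, -, y3⟩ := hy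
  obtain ⟨-, z1, z2, -, z3⟩ := hz
  have x0 : (0 : ℝ) < x.1 := by exact_mod_cast (by omega : 0 < x.1)
  have y0 : (0 : ℝ) < y.1 := by exact_mod_cast (by omega : 0 < y.1)
  have z0 : (0 : ℝ) < z.1 := by exact_mod_cast (by omega : 0 < z.1)
  have hQ : 0 < Q := lt_of_lt_of_le x0 x2
  set u := (x.2.1 : ℝ) / x.1
  set u' := (y.2.1 : ℝ) / y.1
  set u'' := (z.2.1 : ℝ) / z.1
  set t := (x.2.2 : ℝ) / x.1
  set t' := (y.2.2 : ℝ) / y.1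
  set t'' := (z.2.2 : ℝ) / z.1
  have err : ∀ s τ : ℝ, |s - u| ≤ Δ → |f s - τ| ≤ ε →
      |τ - t - g u * (s - u)| ≤ (M + 2) * Δ ^ 2 := by
    intro s τ hs hτ
    have l1 := h.lower u s
    have l2 := h.upper u s
    have l0 : 0 ≤ m * (s - u) ^ 2 := mul_nonneg h.pos.le (sq_nonneg _)
    have l3 : (s - u) ^ 2 ≤ Δ ^ 2 := by rw [← sq_abs]; gcongr
    have l4 : M * (s - u) ^ 2 ≤ M * Δ ^ 2 := by gcongr
    rw [abs_le] at hτ x3 ⊢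
    constructor <;> nlinarith
  have e1 := err u' t' hxy y3
  have e2 := err u'' t'' hxz z3
  have key : (det3 x y z : ℝ) = x.1 * y.1 * z.1 *
      ((u' - u) * (t'' - t - g u * (u'' - u)) - (u'' - u) * (t' - t - g u * (u' - u))) := by
    simp only [det3, u, u', u'', t, t', t'']
    push_cast
    field_simp
    ring
  have hE : |(u' - u) * (t'' - t - g u * (u'' - u)) - (u'' - u) * (t' - t - g u * (u' - u))|
      ≤ 2 * (M + 2) * Δ ^ 3 := by
    refine (abs_sub _ _).trans ?_
    rw [abs_mul, abs_mul]
    have a1 : |u' - u| * |t'' - t - g u * (u'' - u)| ≤ Δ * ((M + 2) * Δ ^ 2) := by gcongr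
    have a2 : |u'' - u| * |t' - t - g u * (u' - u)| ≤ Δ * ((M + 2) * Δ ^ 2) := by gcongr
    nlinarith
  rw [key, abs_mul, abs_of_pos (by positivity)]
  calc (x.1 : ℝ) * y.1 * z.1 * _ ≤ Q * Q * Q * (2 * (M + 2) * Δ ^ 3) := by gcongr
    _ = _ := by ring

end ConvexPair

/-- The points that share their abscissa with another point are few. -/
theorem card_le_of_vertical {f : ℝ → ℝ} {R Q ε : ℝ} (hR : 0 ≤ R) (hQ : 1 ≤ Q) (hε : 0 < ε)
    (S : Finset (ℤ × ℤ × ℤ)) (hS : ↑S ⊆ ratPoints f R Q ε)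
    (hv : ∀ z ∈ S, ∃ z' ∈ S, z' ≠ z ∧ (z'.2.1 : ℝ) / z'.1 = (z.2.1 : ℝ) / z.1) :
    (S.card : ℝ) ≤ 4 * (2 * R + 1) * (Q ^ 3 * ε) := by
  classical
  let ρ : ℤ × ℤ × ℤ → ℚ := fun z => (z.2.1 : ℚ) / z.1
  have hρ : ∀ z, ((ρ z : ℚ) : ℝ) = (z.2.1 : ℝ) / z.1 := fun z => by simp [ρ]
  have hden : ∀ z, ((ρ z).den : ℤ) ∣ z.1 := fun z => by
    have := Rat.den_dvd z.2.1 z.1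
    rwa [Rat.divInt_eq_div] at this
  have fiber : ∀ x ∈ S.image ρ,
      ((S.filter fun z => ρ z = x).card : ℝ) ≤ 4 * ε * Q ^ 2 / x.den := by
    intro x hx
    have hx0 : (0 : ℝ) < x.den := by exact_mod_cast x.den_pos
    have sep : ∀ z ∈ S.filter (fun z => ρ z = x), ∀ z' ∈ S.filter (fun z => ρ z = x), z ≠ z' →
        (x.den : ℝ) / Q ^ 2 ≤ |(z.2.2 : ℝ) / z.1 - (z'.2.2 : ℝ) / z'.1| := by
      intro z hz z' hz' hne
      rw [Finset.mem_filter] at hz hz'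
      obtain ⟨a1, a2, a3, -, -⟩ := hS hz.1
      obtain ⟨b1, b2, b3, -, -⟩ := hS hz'.1
      have d1 := hden z
      have d2 := hden z'
      rw [hz.2] at d1
      rw [hz'.2] at d2
      refine le_abs_div_sub_div (k := (x.den : ℤ)) a2 b2 a3 b3
        (dvd_sub (Dvd.dvd.mul_left d2 _) (Dvd.dvd.mul_left d1 _)) ?_ (by positivity)
      intro heq
      refine hne (a1.ext_of_proportional b1 a2 b2 ?_ heq)
      have e : ρ z = ρ z' := hz.2.trans hz'.2.symm
      have n1 : (z.1 : ℚ) ≠ 0 := by exact_mod_cast (by omega : z.1 ≠ 0)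
      have n2 : (z'.1 : ℚ) ≠ 0 := by exact_mod_cast (by omega : z'.1 ≠ 0)
      simp only [ρ] at e
      rw [div_eq_div_iff n1 n2] at e
      exact_mod_cast e
    have near : ∀ z ∈ S.filter (fun z => ρ z = x), |f x - (z.2.2 : ℝ) / z.1| ≤ ε := by
      intro z hz
      rw [Finset.mem_filter] at hz
      have := (hS hz.1).2.2.2.2
      rwa [← hρ z, hz.2] at this
    -- `hv` supplies a second point over the same abscissa, so the separation of ordinates cannot
    -- exceed the width of the strip. This absorbs the `+ 1` of the counting lemma into the main
    -- term.
    have two : (x.den : ℝ) / Q ^ 2 ≤ 2 * ε := by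
      obtain ⟨z, hz, rfl⟩ := Finset.mem_image.1 hx
      obtain ⟨z', hz', hne, heq⟩ := hv z hz
      rw [← hρ, ← hρ] at heq
      have heq' : ρ z' = ρ z := by exact_mod_cast heq
      have m1 : z ∈ S.filter (fun y => ρ y = ρ z) := Finset.mem_filter.2 ⟨hz, rfl⟩
      have m2 : z' ∈ S.filter (fun y => ρ y = ρ z) := Finset.mem_filter.2 ⟨hz', heq'⟩
      refine (sep z m1 z' m2 hne.symm).trans ?_
      have n1 := abs_le.1 (near z m1)
      have n2 := abs_le.1 (near z' m2)
      rw [abs_le]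
      constructor <;> linarith
    have := card_le_of_separated (S.filter fun z => ρ z = x) (fun z => (z.2.2 : ℝ) / z.1)
      ((x.den : ℝ) / Q ^ 2) (2 * ε) (by positivity) (by positivity) sep (by
        intro z hz z' hz'
        have n1 := abs_le.1 (near z hz)
        have n2 := abs_le.1 (near z' hz')
        linarith)
    have one : 1 ≤ 2 * ε / ((x.den : ℝ) / Q ^ 2) := by
      rwa [le_div_iff₀ (by positivity), one_mul]
    calc _ ≤ 2 * (2 * ε / ((x.den : ℝ) / Q ^ 2)) := by linarith
      _ = _ := by field_simp; ring
  have hcard : (S.card : ℝ) ≤ ∑ x ∈ S.image ρ, 4 * ε * Q ^ 2 / x.den := by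
    rw [Finset.card_eq_sum_card_image ρ S]
    push_cast
    exact Finset.sum_le_sum fiber
  have maps : ∀ x ∈ S.image ρ, x.den ∈ Finset.Icc 1 ⌊Q⌋₊ := by
    intro x hx
    obtain ⟨z, hz, rfl⟩ := Finset.mem_image.1 hx
    obtain ⟨-, a2, a3, -, -⟩ := hS hz
    rw [Finset.mem_Icc]
    refine ⟨(ρ z).den_pos, Nat.le_floor ?_⟩
    have : ((ρ z).den : ℤ) ≤ z.1 := Int.le_of_dvd (by omega) (hden z)
    have : ((ρ z).den : ℝ) ≤ z.1 := by exact_mod_cast this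
    linarith
  refine hcard.trans ?_
  rw [← Finset.sum_fiberwise_of_maps_to maps]
  have inner : ∀ b ∈ Finset.Icc 1 ⌊Q⌋₊, ∑ x ∈ (S.image ρ).filter (fun x => x.den = b),
      4 * ε * Q ^ 2 / (x.den : ℝ) ≤ 4 * (2 * R + 1) * (Q ^ 2 * ε) := by
    intro b hb
    rw [Finset.mem_Icc] at hb
    have hb1 : (1 : ℝ) ≤ b := by exact_mod_cast hb.1
    have hnum : ∀ x ∈ (S.image ρ).filter (fun x => x.den = b), |(x.num : ℝ)| ≤ R * b := by
      intro x hx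
      rw [Finset.mem_filter] at hx
      obtain ⟨z, hz, hzx⟩ := Finset.mem_image.1 hx.1
      have := (hS hz).2.2.2.1
      rw [← hρ, hzx, Rat.cast_def, hx.2, abs_div, abs_of_pos (by linarith : (0 : ℝ) < b),
        div_le_iff₀ (by linarith)] at this
      exact this
    have hc := card_le_of_separated ((S.image ρ).filter (fun x => x.den = b))
      (fun x => (x.num : ℝ)) 1 (2 * (R * b)) one_pos (by positivity) (by
        intro x hx y hy hne
        rw [Finset.mem_filter] at hx hy
        have : x.num ≠ y.num := fun e => hne (Rat.ext e (hx.2.trans hy.2.symm))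
        have : 1 ≤ |x.num - y.num| := Int.one_le_abs (sub_ne_zero.2 this)
        exact_mod_cast this) (by
        intro x hx y hy
        have h1 := abs_le.1 (hnum x hx)
        have h2 := abs_le.1 (hnum y hy)
        linarith)
    calc _ = ∑ x ∈ (S.image ρ).filter (fun x => x.den = b), 4 * ε * Q ^ 2 / (b : ℝ) := by
          refine Finset.sum_congr rfl fun x hx => ?_
          rw [(Finset.mem_filter.1 hx).2]
      _ = ((S.image ρ).filter (fun x => x.den = b)).card * (4 * ε * Q ^ 2 / b) := by
          rw [Finset.sum_const, nsmul_eq_mul]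
      _ ≤ ((2 * R + 1) * b) * (4 * ε * Q ^ 2 / b) := by
          gcongr
          refine hc.trans ?_
          rw [div_one]
          linarith
      _ = _ := by field_simp
  refine (Finset.sum_le_sum inner).trans ?_
  rw [Finset.sum_const, nsmul_eq_mul, Nat.card_Icc, Nat.add_sub_cancel]
  have : (⌊Q⌋₊ : ℝ) ≤ Q := Nat.floor_le (by linarith)
  calc (⌊Q⌋₊ : ℝ) * (4 * (2 * R + 1) * (Q ^ 2 * ε)) ≤ Q * (4 * (2 * R + 1) * (Q ^ 2 * ε)) := by
        gcongr
    _ = _ := by ring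

/-! ### From points near the curve to points near the dual curve -/

theorem exists_primitive_smul (n : ℤ × ℤ × ℤ) (hn : 0 < n.1) :
    ∃ (ℓ : ℤ × ℤ × ℤ) (d : ℤ), Primitive ℓ ∧ 1 ≤ ℓ.1 ∧ 0 < d ∧
      n.1 = d * ℓ.1 ∧ n.2.1 = d * ℓ.2.1 ∧ n.2.2 = d * ℓ.2.2 := by
  set d := Int.gcd n.1 (Int.gcd n.2.1 n.2.2) with hd
  have hd0 : 0 < d := Int.gcd_pos_of_ne_zero_left _ hn.ne'
  have hd0' : (0 : ℤ) < d := by exact_mod_cast hd0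
  have h1 : (d : ℤ) ∣ n.1 := Int.gcd_dvd_left _ _
  have h23 : (d : ℤ) ∣ (Int.gcd n.2.1 n.2.2 : ℤ) := Int.gcd_dvd_right _ _
  obtain ⟨a, ha⟩ := h1
  obtain ⟨b, hb⟩ := h23.trans (Int.gcd_dvd_left _ _)
  obtain ⟨c, hc⟩ := h23.trans (Int.gcd_dvd_right _ _)
  refine ⟨(a, b, c), d, ?_, ?_, hd0', ha, hb, hc⟩
  · have e : d = d * Int.gcd a (Int.gcd b c) := by
      conv_lhs => rw [hd, ha, hb, hc]
      rw [Int.gcd_mul_left, Int.natAbs_natCast, Nat.cast_mul, Int.gcd_mul_left, Int.natAbs_natCast]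
    exact Nat.eq_of_mul_eq_mul_left hd0 (by rw [mul_one]; exact e.symm)
  · have : 0 < d * a := by rw [← ha]; exact hn
    exact (pos_iff_pos_of_mul_pos this).1 hd0'

namespace ConvexPair

variable {f g : ℝ → ℝ} {m M : ℝ}

/-- Slopes become abscissae after dualizing, so they need a bound independent of `Q` and `ε`. With
offset and `ε` at most 1, the tangency point is within `√(2 / m)` of the abscissa of `z`, and the
slope is the value of `g` there. -/
theorem abs_slope_le (h : ConvexPair f g m M) {R Q ε : ℝ} (hε : ε ≤ 1) {ℓ z : ℤ × ℤ × ℤ}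
    (hℓ : 1 ≤ ℓ.1) (hz : z ∈ ratPoints f R Q ε) (hon : OnLine ℓ z) (hv : |offset f g ℓ| ≤ 1) :
    |(ℓ.2.1 : ℝ) / ℓ.1| ≤ |g 0| + 2 * M * (R + √(2 / m)) := by
  have hm := h.pos
  obtain ⟨-, z1, -, z3, z4⟩ := hz
  rw [h.sub_line_eq hℓ z1 hon _ rfl] at z4
  set x₀ := Function.invFun g ((ℓ.2.1 : ℝ) / ℓ.1) with hx₀
  set x := (z.2.1 : ℝ) / z.1
  have l := h.lower x₀ x
  have : (x - x₀) ^ 2 ≤ 2 / m := by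
    rw [le_div_iff₀ hm]
    rw [abs_le] at z4 hv
    linarith
  have := Real.abs_le_sqrt this
  have hb : |x₀| ≤ R + √(2 / m) := by
    calc |x₀| = |x - (x - x₀)| := by congr 1; ring
      _ ≤ |x| + |x - x₀| := abs_sub _ _
      _ ≤ _ := by linarith
  have := h.g_bounded hb
  rwa [hx₀, h.apply_invFun] at this

/-- In a short interval, either the rational points near the curve are few, or each of them shares
its abscissa with another one, or all of them lie on a line that is close to a rational tangent. -/
theorem local_trichotomy (h : ConvexPair f g m M) {R Q ε Δ : ℝ} (hQ : 1 ≤ Q) (hε : 0 < ε)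
    (hεΔ : ε ≤ Δ ^ 2) (hΔ : 0 < Δ) (hQΔ : 1 ≤ Q * Δ) (T : Finset (ℤ × ℤ × ℤ))
    (hT : ↑T ⊆ ratPoints f R Q ε)
    (hdiam : ∀ z ∈ T, ∀ z' ∈ T, |(z'.2.1 : ℝ) / z'.1 - (z.2.1 : ℝ) / z.1| ≤ Δ)
    (hcard : (54 * (M + 2) + 2 + 2 * √(8 * M / m ^ 2 + 4 / m)) * (Q * Δ) ^ 3 < T.card) :
    (∀ z ∈ T, ∃ z' ∈ T, z' ≠ z ∧ (z'.2.1 : ℝ) / z'.1 = (z.2.1 : ℝ) / z.1) ∨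
    ∃ ℓ : ℤ × ℤ × ℤ, Primitive ℓ ∧ 1 ≤ ℓ.1 ∧ (∀ z ∈ T, OnLine ℓ z) ∧
      ℓ.1 * √(max |offset f g ℓ| ε) ≤ 2 * √(8 * M / m ^ 2 + 4 / m) * (ε * Q ^ 2) ∧
      ℓ.1 * √(max |offset f g ℓ| ε) ≤ 1 / (Q * Δ) := by
  classical
  have hm := h.pos
  have hM := h.pos'
  set A := √(8 * M / m ^ 2 + 4 / m) with hA
  have hA0 : 0 < A := Real.sqrt_pos.2 (by positivity)
  have hQ0 : 0 < Q := by linarith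
  have hcube : 1 ≤ (Q * Δ) ^ 3 := one_le_pow₀ hQΔ
  have hdet : ∀ x ∈ T, ∀ y ∈ T, ∀ z ∈ T, det3 x y z = 0 := by
    rcases card_le_of_det3_le T (2 * (M + 2) * (Q * Δ) ^ 3) (fun x hx y hy z hz =>
      h.abs_det3_le hΔ.le hεΔ (hT hx) (hT hy) (hT hz) (hdiam x hx y hy) (hdiam x hx z hz))
      with h0 | h0
    · exact h0
    · exfalso
      nlinarith
  have hcard2 : (2 : ℝ) < T.card := by nlinarith
  have hcard2' : 2 < T.card := by exact_mod_cast hcard2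
  by_cases hsame : ∀ z ∈ T, ∀ z' ∈ T, (z'.2.1 : ℝ) / z'.1 = (z.2.1 : ℝ) / z.1
  · left
    intro z hz
    obtain ⟨z', hz', hne⟩ := Finset.exists_mem_ne (by omega : 1 < T.card) z
    exact ⟨z', hz', hne, hsame z hz z' hz'⟩
  right
  push Not at hsame
  obtain ⟨u, hu, u', hu', hne⟩ := hsame
  obtain ⟨x, hx, y, hy, hxy⟩ : ∃ x ∈ T, ∃ y ∈ T, (x.2.1 : ℝ) / x.1 < (y.2.1 : ℝ) / y.1 := by
    rcases lt_or_gt_of_ne hne with hlt | hlt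
    · exact ⟨u', hu', u, hu, hlt⟩
    · exact ⟨u, hu, u', hu', hlt⟩
  have x1 := (hT hx).2.1
  have y1 := (hT hy).2.1
  have hpos : 0 < x.1 * y.2.1 - y.1 * x.2.1 := by
    have x0 : (0 : ℝ) < x.1 := by exact_mod_cast (by omega : 0 < x.1)
    have y0 : (0 : ℝ) < y.1 := by exact_mod_cast (by omega : 0 < y.1)
    rw [div_lt_div_iff₀ x0 y0] at hxy
    have : x.2.1 * y.1 < y.2.1 * x.1 := by exact_mod_cast hxy
    linarith
  obtain ⟨ℓ, d, hℓ, hℓ1, hd, e1, e2, e3⟩ := exists_primitive_smul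
    (x.1 * y.2.1 - y.1 * x.2.1, x.1 * y.2.2 - y.1 * x.2.2, x.2.1 * y.2.2 - y.2.1 * x.2.2) hpos
  simp only at e1 e2 e3
  have hon : ∀ z ∈ T, OnLine ℓ z := by
    intro z hz
    have := hdet x hx y hy z hz
    unfold OnLine
    refine mul_left_cancel₀ hd.ne' ?_
    simp only [det3] at this
    linear_combination (-z.2.2) * e1 + z.2.1 * e2 - z.1 * e3 + this
  have hcnt := h.card_le_of_onLine hQ hε hℓ hℓ1 T hT hon
  rw [← hA] at hcnt
  have hc : (0 : ℝ) < ℓ.1 := by exact_mod_cast (by omega : 0 < ℓ.1)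
  set w := √(max |offset f g ℓ| ε) with hw
  have hw0 : 0 < w := Real.sqrt_pos.2 (lt_of_lt_of_le hε (le_max_right _ _))
  have hcw : 0 < ℓ.1 * w := mul_pos hc hw0
  have hE : ε * Q ^ 3 * Δ ≤ (Q * Δ) ^ 3 := by
    have : ε * (Q ^ 3 * Δ) ≤ Δ ^ 2 * (Q ^ 3 * Δ) := by gcongr
    nlinarith
  -- Both bounds read the count on a line backwards. Having three points gives the first; having
  -- more than `2 + 2A (QΔ)³ ≥ 2 + 2A ε Q³ Δ` points gives the second.
  refine ⟨ℓ, hℓ, hℓ1, hon, ?_, ?_⟩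
  · have h3 : (3 : ℝ) ≤ T.card := by exact_mod_cast hcard2'
    have : 1 ≤ 2 * A * (ε * Q ^ 2) / (ℓ.1 * w) := by
      rw [mul_div_assoc]; linarith
    rwa [le_div_iff₀ hcw, one_mul] at this
  · have h4 : 2 * A * (ε * Q ^ 3 * Δ) < 2 * A * (ε * Q ^ 2 / (ℓ.1 * w)) := by nlinarith
    have h5 := lt_of_mul_lt_mul_left h4 (by positivity)
    rw [lt_div_iff₀ hcw] at h5
    rw [le_div_iff₀ (by positivity)]
    have h6 : ε * Q ^ 2 * (ℓ.1 * w * (Q * Δ)) < ε * Q ^ 2 * 1 := by nlinarith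
    exact (lt_of_mul_lt_mul_left h6 (by positivity)).le

/-- Rational points near a curve are controlled by rational points near the dual curve. -/
theorem exists_dual_bound (h : ConvexPair f g m M) {R : ℝ} (hR : 0 ≤ R) :
    ∃ K R' : ℝ, 0 < K ∧ 0 ≤ R' ∧ ∀ Q ε Δ : ℝ, 1 ≤ Q → 0 < ε → ε ≤ 1 → Δ = max (√ε) (1 / Q) →
      ∀ S : Finset (ℤ × ℤ × ℤ), ↑S ⊆ ratPoints f R Q ε →
      ∃ L : Finset (ℤ × ℤ × ℤ), (∀ ℓ ∈ L, Primitive ℓ ∧ 1 ≤ ℓ.1 ∧ |(ℓ.2.1 : ℝ) / ℓ.1| ≤ R' ∧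
        ℓ.1 * √(max |offset f g ℓ| ε) ≤ K * (ε * Q ^ 2) ∧
        ℓ.1 * √(max |offset f g ℓ| ε) ≤ 1 / (Q * Δ)) ∧
      (S.card : ℝ) ≤ K * (Q + Q ^ 3 * ε) +
        K * ∑ ℓ ∈ L, ε * Q ^ 2 / (ℓ.1 * √(max |offset f g ℓ| ε)) := by
  classical
  have hm := h.pos
  have hM := h.pos'
  set A := √(8 * M / m ^ 2 + 4 / m) with hA
  have hA0 : 0 < A := Real.sqrt_pos.2 (by positivity)
  set B := 54 * (M + 2) + 2 + 2 * A with hB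
  have hB0 : 0 < B := by positivity
  refine ⟨(2 * R + 2) * B + 4 * (2 * R + 1) + 6 * A, |g 0| + 2 * M * (R + √(2 / m)),
    by positivity, by positivity, ?_⟩
  intro Q ε Δ hQ hε hε1 hΔ S hS
  have hQ0 : 0 < Q := by linarith
  have hΔε : √ε ≤ Δ := hΔ ▸ le_max_left _ _
  have hΔQ : 1 / Q ≤ Δ := hΔ ▸ le_max_right _ _
  have hΔ0 : 0 < Δ := lt_of_lt_of_le (by positivity) hΔQ
  have hεΔ : ε ≤ Δ ^ 2 := by
    rw [← Real.sq_sqrt hε.le]; gcongr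
  have hQΔ : 1 ≤ Q * Δ := by
    rw [div_le_iff₀ hQ0] at hΔQ; linarith
  have hΔ1 : Δ ≤ 1 := by
    rw [hΔ]
    refine max_le (Real.sqrt_le_one.2 hε1) ?_
    rw [div_le_one hQ0]; exact hQ
  have hΔsq : Q ^ 3 * Δ ^ 2 ≤ Q + Q ^ 3 * ε := by
    rcases max_choice (√ε) (1 / Q) with hc | hc
    · rw [hΔ, hc, Real.sq_sqrt hε.le]; linarith
    · rw [hΔ, hc]
      have : Q ^ 3 * (1 / Q) ^ 2 = Q := by field_simp
      rw [this]
      have : 0 ≤ Q ^ 3 * ε := by positivity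
      linarith
  let idx : ℤ × ℤ × ℤ → ℤ := fun z => ⌊((z.2.1 : ℝ) / z.1) / Δ⌋
  let cell : ℤ → Finset (ℤ × ℤ × ℤ) := fun j => S.filter fun z => idx z = j
  have hcell : ∀ j, ∀ z ∈ cell j, ∀ z' ∈ cell j,
      |(z'.2.1 : ℝ) / z'.1 - (z.2.1 : ℝ) / z.1| ≤ Δ := by
    intro j z hz z' hz'
    have e : idx z' = idx z :=
      (Finset.mem_filter.1 hz').2.trans (Finset.mem_filter.1 hz).2.symm
    have := (Int.abs_sub_lt_one_of_floor_eq_floor e).le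
    rwa [← sub_div, abs_div, abs_of_pos hΔ0, div_le_one hΔ0] at this
  let Good : (ℤ × ℤ × ℤ) → (ℤ × ℤ × ℤ) → Prop := fun ℓ z => Primitive ℓ ∧ 1 ≤ ℓ.1 ∧
      OnLine ℓ z ∧ ℓ.1 * √(max |offset f g ℓ| ε) ≤ 2 * A * (ε * Q ^ 2) ∧
      ℓ.1 * √(max |offset f g ℓ| ε) ≤ 1 / (Q * Δ)
  -- Sparse windows: there are `O(1 / Δ)` of them with `O((QΔ)³)` points each, in total `O(Q³ Δ²)`.
  -- The choice of `Δ`, the least value with `ε ≤ Δ²` and `QΔ ≥ 1`, turns this into `Q + Q³ ε`.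
  set S₁ := S.filter fun z => ((cell (idx z)).card : ℝ) ≤ B * (Q * Δ) ^ 3 with hS₁
  set S₂ := S.filter fun z => ∃ z' ∈ S, z' ≠ z ∧ (z'.2.1 : ℝ) / z'.1 = (z.2.1 : ℝ) / z.1 with hS₂
  set S₃ := S.filter fun z => ∃ ℓ, Good ℓ z with hS₃
  have hcover : S ⊆ S₁ ∪ (S₂ ∪ S₃) := by
    intro z hz
    rw [Finset.mem_union, Finset.mem_union, hS₁, hS₂, hS₃, Finset.mem_filter, Finset.mem_filter,
      Finset.mem_filter]
    by_cases hb : ((cell (idx z)).card : ℝ) ≤ B * (Q * Δ) ^ 3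
    · exact Or.inl ⟨hz, hb⟩
    right
    push Not at hb
    have hzc : z ∈ cell (idx z) := Finset.mem_filter.2 ⟨hz, rfl⟩
    rcases h.local_trichotomy hQ hε hεΔ hΔ0 hQΔ (cell (idx z))
      (fun y hy => hS (Finset.mem_filter.1 hy).1) (hcell _) hb with hv | ⟨ℓ, a, b, c, d, e⟩
    · left
      obtain ⟨z', hz', hh⟩ := hv z hzc
      exact ⟨hz, z', (Finset.mem_filter.1 hz').1, hh⟩
    · right
      exact ⟨hz, ℓ, a, b, c z hzc, d, e⟩
  have c1 : (S₁.card : ℝ) ≤ (2 * R + 2) * B * (Q + Q ^ 3 * ε) := by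
    have hidx : ((S₁.image idx).card : ℝ) ≤ (2 * R + 2) / Δ := by
      have bd : ∀ j ∈ S₁.image idx, -(R / Δ) - 1 ≤ (j : ℝ) ∧ (j : ℝ) ≤ R / Δ := by
        intro j hj
        obtain ⟨z, hz, rfl⟩ := Finset.mem_image.1 hj
        have := abs_le.1 (hS (Finset.mem_filter.1 hz).1).2.2.2.1
        have f1 := Int.floor_le (((z.2.1 : ℝ) / z.1) / Δ)
        have f2 := Int.lt_floor_add_one (((z.2.1 : ℝ) / z.1) / Δ)
        have g1 : ((z.2.1 : ℝ) / z.1) / Δ ≤ R / Δ := by gcongr; exact this.2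
        have g2 : -R / Δ ≤ ((z.2.1 : ℝ) / z.1) / Δ := by gcongr; exact this.1
        rw [neg_div] at g2
        exact ⟨by simp only [idx]; linarith, by simp only [idx]; linarith⟩
      have := card_le_of_separated (S₁.image idx) (fun j => (j : ℝ)) 1 (2 * (R / Δ) + 1) one_pos
        (by positivity) (by
          intro x _ y _ hne
          have : 1 ≤ |x - y| := Int.one_le_abs (sub_ne_zero.2 hne)
          exact_mod_cast this) (by
          intro x hx y hy
          linarith [(bd x hx).2, (bd y hy).1])
      have h1 : 1 ≤ 1 / Δ := by rw [le_div_iff₀ hΔ0]; linarith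
      rw [div_one] at this
      calc _ ≤ 2 * (R / Δ) + 1 + 1 := this
        _ ≤ 2 * (R / Δ) + 1 / Δ + 1 / Δ := by linarith
        _ = _ := by ring
    have : (S₁.card : ℝ) ≤ (S₁.image idx).card * (B * (Q * Δ) ^ 3) := by
      rw [Finset.card_eq_sum_card_image idx S₁]
      push_cast
      rw [← nsmul_eq_mul, ← Finset.sum_const]
      refine Finset.sum_le_sum fun j hj => ?_
      obtain ⟨z, hz, rfl⟩ := Finset.mem_image.1 hj
      refine le_trans ?_ (Finset.mem_filter.1 hz).2
      have : (S₁.filter fun y => idx y = idx z) ⊆ cell (idx z) :=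
        Finset.filter_subset_filter _ (Finset.filter_subset _ _)
      exact_mod_cast Finset.card_le_card this
    calc (S₁.card : ℝ) ≤ (S₁.image idx).card * (B * (Q * Δ) ^ 3) := this
      _ ≤ (2 * R + 2) / Δ * (B * (Q * Δ) ^ 3) := by gcongr
      _ = (2 * R + 2) * B * (Q ^ 3 * Δ ^ 2) := by field_simp
      _ ≤ _ := by gcongr
  have c2 : (S₂.card : ℝ) ≤ 4 * (2 * R + 1) * (Q + Q ^ 3 * ε) := by
    refine (card_le_of_vertical hR hQ hε S₂
      (fun z hz => hS (Finset.mem_filter.1 hz).1) ?_).trans ?_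
    · intro z hz
      obtain ⟨hz1, z', hz', hne, he⟩ := Finset.mem_filter.1 hz
      exact ⟨z', Finset.mem_filter.2 ⟨hz', z, hz1, hne.symm, he.symm⟩, hne, he⟩
    · gcongr
      linarith
  have hch : ∀ z ∈ S₃, ∃ ℓ, Good ℓ z := fun z hz => (Finset.mem_filter.1 hz).2
  choose! lam hlam using hch
  have c3 : (S₃.card : ℝ) ≤
      6 * A * ∑ ℓ ∈ S₃.image lam, ε * Q ^ 2 / (ℓ.1 * √(max |offset f g ℓ| ε)) := by
    rw [Finset.card_eq_sum_card_image lam S₃, Finset.mul_sum]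
    push_cast
    refine Finset.sum_le_sum fun ℓ hℓ => ?_
    obtain ⟨z, hz, rfl⟩ := Finset.mem_image.1 hℓ
    obtain ⟨g1, g2, g3, g4, g5⟩ := hlam z hz
    have hon : ∀ y ∈ S₃.filter (fun y => lam y = lam z), OnLine (lam z) y := by
      intro y hy
      obtain ⟨hy1, hy2⟩ := Finset.mem_filter.1 hy
      rw [← hy2]
      exact (hlam y hy1).2.2.1
    have := h.card_le_of_onLine hQ hε g1 g2 (S₃.filter fun y => lam y = lam z)
      (fun y hy => hS (Finset.mem_filter.1 (Finset.mem_filter.1 hy).1).1) hon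
    refine this.trans ?_
    rw [← hA]
    have hc : (0 : ℝ) < (lam z).1 := by exact_mod_cast (by omega : 0 < (lam z).1)
    have hw0 : 0 < √(max |offset f g (lam z)| ε) :=
      Real.sqrt_pos.2 (lt_of_lt_of_le hε (le_max_right _ _))
    -- The first bound in `Good` makes the main term at least 1, so the additive 2 is absorbed: `2 ·
    -- 2A + 2A = 6A`.
    have : 1 ≤ 2 * A * (ε * Q ^ 2 / ((lam z).1 * √(max |offset f g (lam z)| ε))) := by
      rw [← mul_div_assoc, le_div_iff₀ (mul_pos hc hw0), one_mul]
      exact g4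
    linarith
  refine ⟨S₃.image lam, ?_, ?_⟩
  · intro ℓ hℓ
    obtain ⟨z, hz, rfl⟩ := Finset.mem_image.1 hℓ
    obtain ⟨g1, g2, g3, g4, g5⟩ := hlam z hz
    refine ⟨g1, g2, ?_, g4.trans ?_, g5⟩
    · refine h.abs_slope_le hε1 g2 (hS (Finset.mem_filter.1 hz).1) g3 ?_
      have hc : (1 : ℝ) ≤ (lam z).1 := by exact_mod_cast g2
      have h1 : √(max |offset f g (lam z)| ε) ≤ 1 := by
        calc √(max |offset f g (lam z)| ε) ≤ (lam z).1 * √(max |offset f g (lam z)| ε) :=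
              le_mul_of_one_le_left (Real.sqrt_nonneg _) hc
          _ ≤ 1 / (Q * Δ) := g5
          _ ≤ 1 := by rw [div_le_one (by positivity)]; exact hQΔ
      exact (le_max_left _ _).trans (Real.sqrt_le_one.1 h1)
    · gcongr
      have : 0 ≤ (2 * R + 2) * B + 4 * (2 * R + 1) := by positivity
      linarith
  · have hcc : (S.card : ℝ) ≤ S₁.card + (S₂.card + S₃.card) := by
      have := (Finset.card_le_card hcover).trans
        ((Finset.card_union_le _ _).trans (add_le_add le_rfl (Finset.card_union_le _ _)))
      exact_mod_cast this
    set W := ∑ ℓ ∈ S₃.image lam, ε * Q ^ 2 / (ℓ.1 * √(max |offset f g ℓ| ε)) with hW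
    have hW0 : 0 ≤ W := by
      refine Finset.sum_nonneg fun ℓ hℓ => ?_
      obtain ⟨z, hz, rfl⟩ := Finset.mem_image.1 hℓ
      have hc : (0 : ℝ) ≤ (lam z).1 := by
        exact_mod_cast (by have := (hlam z hz).2.1; omega : 0 ≤ (lam z).1)
      positivity
    have hN : 0 ≤ Q + Q ^ 3 * ε := by positivity
    have k1 : 0 ≤ 6 * A * (Q + Q ^ 3 * ε) := by positivity
    have k2 : 0 ≤ ((2 * R + 2) * B + 4 * (2 * R + 1)) * W := by positivity
    calc (S.card : ℝ) ≤ _ := hcc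
      _ ≤ (2 * R + 2) * B * (Q + Q ^ 3 * ε) + (4 * (2 * R + 1) * (Q + Q ^ 3 * ε) + 6 * A * W) := by
        gcongr
      _ ≤ _ := by linarith

end ConvexPair

/-! ### Iterating the duality: Huxley's bound -/

theorem card_le_mul_of_card_fiber_le {ι : Type*} (S : Finset ι) (φ : ι → ℤ) {A B : ℝ} (hB : 0 ≤ B)
    (hA : ((S.image φ).card : ℝ) ≤ A)
    (hfib : ∀ j ∈ S.image φ, ((S.filter fun x => φ x = j).card : ℝ) ≤ B) :
    (S.card : ℝ) ≤ A * B := by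
  rw [Finset.card_eq_sum_card_image φ S]
  push_cast
  calc _ ≤ ∑ _j ∈ S.image φ, B := Finset.sum_le_sum hfib
    _ = (S.image φ).card * B := by rw [Finset.sum_const, nsmul_eq_mul]
    _ ≤ A * B := by gcongr

theorem card_int_le (S : Finset ℤ) {X : ℝ} (hX : 0 ≤ X)
    (h : ∀ x ∈ S, ∀ y ∈ S, (x : ℝ) - y ≤ X) : (S.card : ℝ) ≤ X + 1 := by
  have := card_le_of_separated S (fun j => (j : ℝ)) 1 X one_pos hX (by
    intro x _ y _ hne
    have : 1 ≤ |x - y| := Int.one_le_abs (sub_ne_zero.2 hne)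
    exact_mod_cast this) h
  rwa [div_one] at this

theorem card_ratPoints_le_trivial {f : ℝ → ℝ} {R Q ε : ℝ} (hR : 0 ≤ R) (hQ : 1 ≤ Q) (hε : 0 < ε)
    (S : Finset (ℤ × ℤ × ℤ)) (hS : ↑S ⊆ ratPoints f R Q ε) :
    (S.card : ℝ) ≤ Q * ((2 * (R * Q) + 1) * (2 * (ε * Q) + 1)) := by
  classical
  have hqpos : ∀ z ∈ S, (0 : ℝ) < z.1 := fun z hz => by
    have := (hS hz).2.1
    exact_mod_cast (by omega : 0 < z.1)
  refine card_le_mul_of_card_fiber_le S (fun z => z.1) (by positivity) ?_ ?_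
  · have := card_int_le (S.image fun z => z.1) (X := Q - 1) (by linarith) (by
      intro x hx y hy
      obtain ⟨z, hz, rfl⟩ := Finset.mem_image.1 hx
      obtain ⟨z', hz', rfl⟩ := Finset.mem_image.1 hy
      have h1 := (hS hz).2.2.1
      have h2 : (1 : ℝ) ≤ z'.1 := by exact_mod_cast (hS hz').2.1
      linarith)
    linarith
  intro q _
  refine card_le_mul_of_card_fiber_le _ (fun z => z.2.1) (by positivity) ?_ ?_
  · refine card_int_le _ (by positivity) ?_
    have hp : ∀ x : ℤ, x ∈ (S.filter fun z => z.1 = q).image (fun z => z.2.1) →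
        |(x : ℝ)| ≤ R * Q := by
      intro x hx
      obtain ⟨z, hz, rfl⟩ := Finset.mem_image.1 hx
      have hz := (Finset.mem_filter.1 hz).1
      have h1 := (hS hz).2.2.2.1
      rw [abs_div, abs_of_pos (hqpos z hz), div_le_iff₀ (hqpos z hz)] at h1
      refine h1.trans ?_
      gcongr
      exact (hS hz).2.2.1
    intro x hx y hy
    have h1 := abs_le.1 (hp x hx)
    have h2 := abs_le.1 (hp y hy)
    linarith
  intro p _
  have hinj : Set.InjOn (fun z : ℤ × ℤ × ℤ => z.2.2)
      (((S.filter fun z => z.1 = q).filter fun z => z.2.1 = p) : Finset _) := by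
    intro z hz z' hz' h
    simp only [Finset.coe_filter, Finset.mem_filter, Set.mem_ofPred_eq] at hz hz'
    exact Prod.ext (hz.1.2.trans hz'.1.2.symm) (Prod.ext (hz.2.trans hz'.2.symm) h)
  rw [← Finset.card_image_of_injOn hinj]
  refine card_int_le _ (by positivity) ?_
  have hr : ∀ x : ℤ, x ∈ ((S.filter fun z => z.1 = q).filter fun z => z.2.1 = p).image (fun z => z.2.2) →
      |f ((p : ℝ) / q) * q - x| ≤ ε * Q := by
    intro x hx
    obtain ⟨z, hz, rfl⟩ := Finset.mem_image.1 hx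
    simp only [Finset.mem_filter] at hz
    obtain ⟨⟨hz, rfl⟩, rfl⟩ := hz
    have h0 := hqpos z hz
    have h1 := (hS hz).2.2.2.2
    have e : f ((z.2.1 : ℝ) / z.1) * z.1 - z.2.2
        = (f ((z.2.1 : ℝ) / z.1) - (z.2.2 : ℝ) / z.1) * z.1 := by field_simp
    rw [e, abs_mul, abs_of_pos h0]
    gcongr
    exact (hS hz).2.2.1
  intro x hx y hy
  have h1 := abs_le.1 (hr x hx)
  have h2 := abs_le.1 (hr y hy)
  linarith

/-- The bound `O(Q ^ e)` for the number of rational points within `O(Q ^ (-2 - σ))` of a uniformly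
convex curve, for all such curves. -/
def CountBound (σ e : ℝ) : Prop :=
  ∀ (f g : ℝ → ℝ) (m M : ℝ), ConvexPair f g m M → ∀ R K₀ : ℝ, 0 ≤ R → 0 < K₀ →
    ∃ K : ℝ, 0 < K ∧ ∀ Q ε : ℝ, 1 ≤ Q → 0 < ε → ε ≤ 1 → ε ≤ K₀ * Q ^ (-2 - σ) →
      ∀ S : Finset (ℤ × ℤ × ℤ), ↑S ⊆ ratPoints f R Q ε → (S.card : ℝ) ≤ K * Q ^ e

/-- Start of the iteration: `ε Q` stays bounded, so each of the `O(Q²)` pairs `(q, p)` admits `O(1)`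
values of `r`. -/
theorem countBound_two {σ : ℝ} (hσ : 0 ≤ σ) : CountBound σ 2 := by
  intro f g m M _ R K₀ hR hK₀
  refine ⟨(2 * R + 1) * (2 * K₀ + 1), by positivity, ?_⟩
  intro Q ε hQ hε _ hεK S hS
  have hQ0 : 0 < Q := by linarith
  refine (card_ratPoints_le_trivial hR hQ hε S hS).trans ?_
  have h1 : ε * Q ≤ K₀ := by
    have : Q ^ (-2 - σ) ≤ Q ^ (-1 : ℝ) := Real.rpow_le_rpow_of_exponent_le hQ (by linarith)
    rw [Real.rpow_neg_one] at this
    calc ε * Q ≤ K₀ * Q ^ (-2 - σ) * Q := by gcongr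
      _ ≤ K₀ * Q⁻¹ * Q := by gcongr
      _ = K₀ := by field_simp
  have h2 : 2 * (R * Q) + 1 ≤ (2 * R + 1) * Q := by linarith
  calc Q * ((2 * (R * Q) + 1) * (2 * (ε * Q) + 1)) ≤ Q * (((2 * R + 1) * Q) * (2 * K₀ + 1)) := by
        gcongr
    _ = (2 * R + 1) * (2 * K₀ + 1) * Q ^ (2 : ℝ) := by
        rw [Real.rpow_two]; ring

theorem geom_sum_le_div {r : ℝ} (hr : 1 < r) (n : ℕ) :
    ∑ i ∈ Finset.range n, r ^ i ≤ r ^ n / (r - 1) := by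
  rw [geom_sum_eq hr.ne']
  gcongr
  linarith

/-- Summation of the contribution of the dual points over dyadic ranges of their denominators. -/
theorem sum_dual_le {f g : ℝ → ℝ} {R' K₀ σ K₁ e : ℝ} (hσ : 0 ≤ σ) (he : 1 < e) (hK₁ : 0 < K₁)
    (hd : ∀ C V : ℝ, 1 ≤ C → 0 < V → V ≤ 1 → V ≤ K₀ * C ^ (-2 - σ) →
      ∀ S : Finset (ℤ × ℤ × ℤ), ↑S ⊆ ratPoints (legendre f g) R' C V → (S.card : ℝ) ≤ K₁ * C ^ e)
    {Q ε X Y : ℝ} (hQ : 1 ≤ Q) (hε : 0 < ε) (hX : 0 < X) (hY : 0 < Y) (hY1 : Y ≤ 1)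
    (hXY : 4 * Y ^ 2 * (2 * X) ^ σ ≤ K₀)
    (L : Finset (ℤ × ℤ × ℤ))
    (hL : ∀ ℓ ∈ L, Primitive ℓ ∧ 1 ≤ ℓ.1 ∧ |(ℓ.2.1 : ℝ) / ℓ.1| ≤ R' ∧ (ℓ.1 : ℝ) ≤ X ∧
        ℓ.1 * √(max |ConvexPair.offset f g ℓ| ε) ≤ Y) :
    ∑ ℓ ∈ L, ε * Q ^ 2 / (ℓ.1 * √(max |ConvexPair.offset f g ℓ| ε)) ≤
      K₁ * 2 ^ e * (2 ^ (e - 1) / (2 ^ (e - 1) - 1)) * (√ε * Q ^ 2 * X ^ (e - 1)) := by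
  classical
  have hr : (1 : ℝ) < 2 ^ (e - 1) := Real.one_lt_rpow (by norm_num) (by linarith)
  set r : ℝ := 2 ^ (e - 1) with hrdef
  have hr1 : 0 < r - 1 := by linarith
  rcases L.eq_empty_or_nonempty with rfl | ⟨ℓ₀, hℓ₀⟩
  · simp only [Finset.sum_empty]
    positivity
  have hX1 : 1 ≤ X := le_trans (by exact_mod_cast (hL ℓ₀ hℓ₀).2.1) (hL ℓ₀ hℓ₀).2.2.2.1
  let lev : ℤ × ℤ × ℤ → ℕ := fun ℓ => Nat.log 2 ℓ.1.toNat
  have hlev : ∀ ℓ ∈ L, (2 : ℝ) ^ lev ℓ ≤ ℓ.1 ∧ (ℓ.1 : ℝ) ≤ 2 ^ (lev ℓ + 1) := by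
    intro ℓ hℓ
    have h1 := (hL ℓ hℓ).2.1
    have h2 : (ℓ.1.toNat : ℤ) = ℓ.1 := Int.toNat_of_nonneg (by omega)
    have h3 : ((ℓ.1.toNat : ℕ) : ℝ) = ℓ.1 := by exact_mod_cast h2
    have h4 : 2 ^ lev ℓ ≤ ℓ.1.toNat := Nat.pow_log_le_self 2 (by omega)
    have h5 : ℓ.1.toNat < 2 ^ (lev ℓ + 1) := Nat.lt_pow_succ_log_self (by norm_num) _
    rw [← h3]
    exact ⟨by exact_mod_cast h4, by exact_mod_cast h5.le⟩
  set n := Nat.log 2 ⌊X⌋₊ with hn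
  have hnX : (2 : ℝ) ^ n ≤ X := by
    have h1 : 2 ^ n ≤ ⌊X⌋₊ := Nat.pow_log_le_self 2 (Nat.floor_pos.2 hX1).ne'
    have h2 : ((2 ^ n : ℕ) : ℝ) ≤ ⌊X⌋₊ := by exact_mod_cast h1
    push_cast at h2
    exact h2.trans (Nat.floor_le hX.le)
  have hmaps : ∀ ℓ ∈ L, lev ℓ ∈ Finset.range (n + 1) := by
    intro ℓ hℓ
    rw [Finset.mem_range]
    refine Nat.lt_succ_of_le (Nat.log_mono_right (Nat.le_floor ?_))
    have h2 : (ℓ.1.toNat : ℤ) = ℓ.1 := Int.toNat_of_nonneg (by have := (hL ℓ hℓ).2.1; omega)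
    have h3 : ((ℓ.1.toNat : ℕ) : ℝ) = ℓ.1 := by exact_mod_cast h2
    rw [h3]
    exact (hL ℓ hℓ).2.2.2.1
  rw [← Finset.sum_fiberwise_of_maps_to hmaps]
  -- Lines with `2 ^ i ≤ c ≤ 2 ^ (i + 1)` are rational points within `(Y / 2 ^ i)²` of the dual
  -- curve, and `hXY` makes this thin enough for `hd` with `C = 2 ^ (i + 1)`. Replacing the maximum
  -- by `ε` bounds each summand by `√ε Q² / 2 ^ i`.
  have inner : ∀ i ∈ Finset.range (n + 1), ∑ ℓ ∈ L.filter (fun ℓ => lev ℓ = i),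
      ε * Q ^ 2 / (ℓ.1 * √(max |ConvexPair.offset f g ℓ| ε)) ≤
      K₁ * 2 ^ e * (√ε * Q ^ 2) * r ^ i := by
    intro i hi
    have hi' : (2 : ℝ) ^ i ≤ X := le_trans (pow_le_pow_right₀ (by norm_num)
      (Nat.lt_succ_iff.1 (Finset.mem_range.1 hi))) hnX
    have h2i : (0 : ℝ) < 2 ^ i := by positivity
    have hcount : ((L.filter (fun ℓ => lev ℓ = i)).card : ℝ) ≤ K₁ * ((2 : ℝ) ^ (i + 1)) ^ e := by
      refine hd (2 ^ (i + 1)) ((Y / 2 ^ i) ^ 2) (one_le_pow₀ (by norm_num)) (by positivity) ?_ ?_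
        _ ?_
      · refine pow_le_one₀ (by positivity) ?_
        rw [div_le_one h2i]
        exact hY1.trans (one_le_pow₀ (by norm_num))
      · have hC : (0 : ℝ) < 2 ^ (i + 1) := by positivity
        rw [Real.rpow_sub hC, Real.rpow_neg hC.le, Real.rpow_two, mul_div_assoc', le_div_iff₀
          (by positivity)]
        have hle : ((2 : ℝ) ^ (i + 1)) ^ σ ≤ (2 * X) ^ σ := by
          refine Real.rpow_le_rpow hC.le ?_ hσ
          rw [pow_succ]; linarith
        calc (Y / 2 ^ i) ^ 2 * ((2 : ℝ) ^ (i + 1)) ^ σ ≤ (Y / 2 ^ i) ^ 2 * (2 * X) ^ σ := by gcongr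
          _ = 4 * Y ^ 2 * (2 * X) ^ σ * ((2 ^ (i + 1)) ^ 2)⁻¹ := by
            rw [pow_succ]; field_simp; ring
          _ ≤ K₀ * ((2 ^ (i + 1)) ^ 2)⁻¹ := by gcongr
      · intro ℓ hℓ
        have hℓ' : ℓ ∈ L ∧ lev ℓ = i := by simpa using hℓ
        obtain ⟨hℓL, rfl⟩ := hℓ'
        obtain ⟨a1, a2, a3, a4, a5⟩ := hL ℓ hℓL
        refine ⟨a1, a2, (hlev ℓ hℓL).2, a3, ?_⟩
        rw [abs_sub_comm]
        change |ConvexPair.offset f g ℓ| ≤ _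
        refine (le_max_left _ ε).trans ?_
        have hw : √(max |ConvexPair.offset f g ℓ| ε) ≤ Y / 2 ^ lev ℓ := by
          rw [le_div_iff₀ h2i, mul_comm]
          refine le_trans ?_ a5
          gcongr
          exact (hlev ℓ hℓL).1
        calc max |ConvexPair.offset f g ℓ| ε = √(max |ConvexPair.offset f g ℓ| ε) ^ 2 :=
              (Real.sq_sqrt (le_trans hε.le (le_max_right _ _))).symm
          _ ≤ _ := by gcongr
    have hterm : ∀ ℓ ∈ L.filter (fun ℓ => lev ℓ = i),
        ε * Q ^ 2 / (ℓ.1 * √(max |ConvexPair.offset f g ℓ| ε)) ≤ √ε * Q ^ 2 / 2 ^ i := by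
      intro ℓ hℓ
      obtain ⟨hℓL, rfl⟩ := Finset.mem_filter.1 hℓ
      have hs : 0 < √ε := Real.sqrt_pos.2 hε
      have h1 : √ε ≤ √(max |ConvexPair.offset f g ℓ| ε) := Real.sqrt_le_sqrt (le_max_right _ _)
      calc ε * Q ^ 2 / (ℓ.1 * √(max |ConvexPair.offset f g ℓ| ε))
          ≤ ε * Q ^ 2 / (2 ^ lev ℓ * √ε) := by
            have h2 := (hlev ℓ hℓL).1
            have h3 : (0 : ℝ) ≤ ℓ.1 := h2i.le.trans h2
            gcongr
        _ = √ε * Q ^ 2 / 2 ^ lev ℓ := by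
            nth_rewrite 1 [← Real.mul_self_sqrt hε.le]
            field_simp
    calc _ ≤ ∑ _ℓ ∈ L.filter (fun ℓ => lev ℓ = i), √ε * Q ^ 2 / 2 ^ i := Finset.sum_le_sum hterm
      _ = (L.filter (fun ℓ => lev ℓ = i)).card * (√ε * Q ^ 2 / 2 ^ i) := by
        rw [Finset.sum_const, nsmul_eq_mul]
      _ ≤ K₁ * ((2 : ℝ) ^ (i + 1)) ^ e * (√ε * Q ^ 2 / 2 ^ i) := by gcongr
      _ = K₁ * 2 ^ e * (√ε * Q ^ 2) * r ^ i := by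
        have : ((2 : ℝ) ^ (i + 1)) ^ e = 2 ^ e * (r ^ i * 2 ^ i) := by
          rw [pow_succ, Real.mul_rpow (by positivity) (by positivity), mul_comm, hrdef,
            ← mul_pow, ← Real.rpow_add_one (by norm_num), sub_add_cancel, Real.rpow_pow_comm
            (by norm_num)]
        rw [this]
        field_simp
  refine (Finset.sum_le_sum inner).trans ?_
  rw [← Finset.mul_sum]
  have hgeom := geom_sum_le_div hr (n + 1)
  have hrn : r ^ n ≤ X ^ (e - 1) := by
    rw [hrdef, Real.rpow_pow_comm (by norm_num)]
    exact Real.rpow_le_rpow (by positivity) hnX (by linarith)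
  calc K₁ * 2 ^ e * (√ε * Q ^ 2) * ∑ i ∈ Finset.range (n + 1), r ^ i
      ≤ K₁ * 2 ^ e * (√ε * Q ^ 2) * (r ^ (n + 1) / (r - 1)) := by gcongr
    _ = K₁ * 2 ^ e * (√ε * Q ^ 2) * (r ^ n * (r / (r - 1))) := by rw [pow_succ]; ring
    _ ≤ K₁ * 2 ^ e * (√ε * Q ^ 2) * (X ^ (e - 1) * (r / (r - 1))) := by gcongr
    _ = _ := by ring

theorem CountBound.mono {σ e e' : ℝ} (h : CountBound σ e) (hee : e ≤ e') : CountBound σ e' := by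
  intro f g m M hf R K₀ hR hK₀
  obtain ⟨K, hK, hb⟩ := h f g m M hf R K₀ hR hK₀
  refine ⟨K, hK, fun Q ε hQ hε hε1 hεK S hS => (hb Q ε hQ hε hε1 hεK S hS).trans ?_⟩
  gcongr

theorem one_div_mul_max_le_one {Q ε Δ : ℝ} (hQ : 1 ≤ Q) (hΔ : Δ = max (√ε) (1 / Q)) :
    1 / (Q * Δ) ≤ 1 := by
  have hQ0 : 0 < Q := by linarith
  have h1 : 1 / Q ≤ Δ := hΔ ▸ le_max_right _ _
  rw [div_le_iff₀ hQ0] at h1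
  rw [div_le_one (by linarith)]
  linarith

/-- Passing to the dual curve improves the exponent. -/
theorem CountBound.improve {σ e e₀ : ℝ} (hσ : 0 < σ) (he : 1 < e) (he₀ : 1 ≤ e₀)
    (h : CountBound σ e) : CountBound σ (max e₀ ((1 - σ / 2) * e)) := by
  intro f g m M hf R K₀ hR hK₀
  obtain ⟨K, R', hK, hR', hdual⟩ := hf.exists_dual_bound hR
  obtain ⟨K₁, hK₁, hd⟩ := h _ _ _ _ hf.dual R'
    (4 * (K * K₀) ^ 2 * (2 * (K * √K₀)) ^ σ) hR' (by positivity)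
  have hr : (1 : ℝ) < 2 ^ (e - 1) := Real.one_lt_rpow (by norm_num) (by linarith)
  set G := K₁ * 2 ^ e * (2 ^ (e - 1) / (2 ^ (e - 1) - 1)) with hG
  have hG0 : 0 < G := by
    have : (0 : ℝ) < 2 ^ (e - 1) - 1 := by linarith
    positivity
  refine ⟨K * (1 + K₀) + K * (G * (K ^ (e - 1) * √K₀ ^ e)), by positivity, ?_⟩
  intro Q ε hQ hε hε1 hεK S hS
  have hQ0 : 0 < Q := by linarith
  obtain ⟨L, hL, hcard⟩ := hdual Q ε _ hQ hε hε1 rfl S hS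
  set u := √ε * Q ^ 2 with hu
  have hs : 0 < √ε := Real.sqrt_pos.2 hε
  have hu0 : 0 < u := by positivity
  have hεQ : ε * Q ^ 2 ≤ K₀ * Q ^ (-σ) := by
    calc ε * Q ^ 2 ≤ K₀ * Q ^ (-2 - σ) * Q ^ (2 : ℝ) := by rw [Real.rpow_two]; gcongr
      _ = K₀ * Q ^ (-σ) := by rw [mul_assoc, ← Real.rpow_add hQ0]; congr 2; ring
  have hu1 : u ≤ √K₀ * Q ^ (1 - σ / 2) := by
    refine le_of_sq_le_sq ?_ (by positivity)
    calc u ^ 2 = ε * Q ^ 2 * Q ^ 2 := by rw [hu, mul_pow, Real.sq_sqrt hε.le]; ring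
      _ ≤ K₀ * Q ^ (-σ) * Q ^ (2 : ℝ) := by rw [Real.rpow_two]; gcongr
      _ = K₀ * Q ^ (2 - σ) := by rw [mul_assoc, ← Real.rpow_add hQ0]; congr 2; ring
      _ = _ := by
        rw [mul_pow, Real.sq_sqrt hK₀.le, ← Real.rpow_mul_natCast hQ0.le]
        congr 2; push_cast; ring
  have huQ : u ≤ √K₀ * Q := by
    refine hu1.trans ?_
    gcongr
    calc Q ^ (1 - σ / 2) ≤ Q ^ (1 : ℝ) := Real.rpow_le_rpow_of_exponent_le hQ (by linarith)
      _ = Q := Real.rpow_one Q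
  have hsum : ∑ ℓ ∈ L, ε * Q ^ 2 / (ℓ.1 * √(max |ConvexPair.offset f g ℓ| ε)) ≤
      G * (√ε * Q ^ 2 * (K * u) ^ (e - 1)) := by
    -- `X` comes from `c √ε ≤ K ε Q²`. The resulting sum is of order `u ^ e`, and `u = O(Q ^ (1 - σ
    -- / 2))` gives the improved exponent. The hypothesis on `Y` holds because `Y² = O(Q ^ (-2σ))`
    -- outweighs `X ^ σ = O(Q ^ σ)`.
    refine sum_dual_le hσ.le he hK₁ hd hQ hε (X := K * u)
      (Y := min 1 (K * (ε * Q ^ 2))) (by positivity) (by positivity) (min_le_left _ _) ?_ L ?_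
    · have hq1 : (Q : ℝ) ^ (-σ) ≤ 1 := Real.rpow_le_one_of_one_le_of_nonpos hQ (by linarith)
      calc 4 * min 1 (K * (ε * Q ^ 2)) ^ 2 * (2 * (K * u)) ^ σ
          ≤ 4 * (K * (K₀ * Q ^ (-σ))) ^ 2 * (2 * (K * (√K₀ * Q))) ^ σ := by
            have : min 1 (K * (ε * Q ^ 2)) ≤ K * (K₀ * Q ^ (-σ)) :=
              (min_le_right _ _).trans (by gcongr)
            gcongr
        _ = 4 * (K * K₀) ^ 2 * (2 * (K * √K₀)) ^ σ * (Q ^ (-σ) * (Q ^ (-σ) * Q ^ σ)) := by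
            have : 2 * (K * (√K₀ * Q)) = 2 * (K * √K₀) * Q := by ring
            rw [this, Real.mul_rpow (by positivity) hQ0.le]
            ring
        _ ≤ 4 * (K * K₀) ^ 2 * (2 * (K * √K₀)) ^ σ * 1 := by
            rw [← Real.rpow_add hQ0, neg_add_cancel, Real.rpow_zero, mul_one]
            gcongr
        _ = _ := mul_one _
    · intro ℓ hℓ
      obtain ⟨a1, a2, a3, a4, a5⟩ := hL ℓ hℓ
      refine ⟨a1, a2, a3, ?_, le_min (a5.trans (one_div_mul_max_le_one hQ rfl)) a4⟩
      have hc : (0 : ℝ) ≤ ℓ.1 := by exact_mod_cast (by omega : 0 ≤ ℓ.1)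
      have h1 : ℓ.1 * √ε ≤ K * (ε * Q ^ 2) := by
        refine le_trans ?_ a4
        gcongr
        exact le_max_right _ _
      refine le_of_mul_le_mul_right (h1.trans (le_of_eq ?_)) hs
      rw [hu]
      nth_rewrite 1 [← Real.mul_self_sqrt hε.le]
      ring
  have hQe : Q ≤ Q ^ max e₀ ((1 - σ / 2) * e) := by
    calc Q = Q ^ (1 : ℝ) := (Real.rpow_one Q).symm
      _ ≤ _ := Real.rpow_le_rpow_of_exponent_le hQ (he₀.trans (le_max_left _ _))
  have hfirst : Q + Q ^ 3 * ε ≤ (1 + K₀) * Q := by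
    have hq1 : (Q : ℝ) ^ (-σ) ≤ 1 := Real.rpow_le_one_of_one_le_of_nonpos hQ (by linarith)
    have : ε * Q ^ 2 ≤ K₀ := hεQ.trans (by nlinarith)
    nlinarith
  have hsecond : √ε * Q ^ 2 * (K * u) ^ (e - 1) ≤
      K ^ (e - 1) * √K₀ ^ e * Q ^ max e₀ ((1 - σ / 2) * e) := by
    have e1 : u * u ^ (e - 1) = u ^ e := by
      rw [← Real.rpow_one_add' hu0.le (by linarith)]; congr 1; ring
    calc √ε * Q ^ 2 * (K * u) ^ (e - 1) = K ^ (e - 1) * (u * u ^ (e - 1)) := by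
          rw [← hu, Real.mul_rpow hK.le hu0.le]; ring
      _ = K ^ (e - 1) * u ^ e := by rw [e1]
      _ ≤ K ^ (e - 1) * (√K₀ * Q ^ (1 - σ / 2)) ^ e := by gcongr
      _ = K ^ (e - 1) * √K₀ ^ e * Q ^ ((1 - σ / 2) * e) := by
          rw [Real.mul_rpow (by positivity) (by positivity), ← Real.rpow_mul hQ0.le, mul_assoc]
      _ ≤ _ := by
          gcongr
          exact le_max_right _ _
  calc (S.card : ℝ) ≤ _ := hcard
    _ ≤ K * ((1 + K₀) * Q) + K * (G * (√ε * Q ^ 2 * (K * u) ^ (e - 1))) := by gcongr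
    _ ≤ K * ((1 + K₀) * Q ^ max e₀ ((1 - σ / 2) * e)) +
        K * (G * (K ^ (e - 1) * √K₀ ^ e * Q ^ max e₀ ((1 - σ / 2) * e))) := by gcongr
    _ = _ := by ring

/-- Starting from exponent 2, the factor `1 - σ / 2` is applied until `e₀` takes over. The iteration
works because `CountBound` quantifies over all curves: each step for `f` uses the previous bound for
its dual. -/
theorem countBound_of_one_lt {σ e₀ : ℝ} (hσ : 0 < σ) (hσ2 : σ < 2) (he₀ : 1 < e₀) :
    CountBound σ e₀ := by
  have step : ∀ k : ℕ, CountBound σ (max e₀ ((1 - σ / 2) ^ k * 2)) := by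
    intro k
    induction k with
    | zero => exact (countBound_two hσ.le).mono (by simp)
    | succ k ih =>
      refine (ih.improve hσ (lt_of_lt_of_le he₀ (le_max_left _ _)) he₀.le).mono ?_
      refine max_le (le_max_left _ _) ?_
      rw [mul_max_of_nonneg _ _ (by linarith)]
      refine max_le_max ?_ (le_of_eq ?_)
      · nlinarith
      · rw [pow_succ]; ring
  have hlim : Tendsto (fun k : ℕ => (1 - σ / 2) ^ k * 2) atTop (𝓝 (0 * 2)) :=
    (tendsto_pow_atTop_nhds_zero_of_lt_one (by linarith) (by linarith)).mul_const 2
  rw [zero_mul] at hlim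
  obtain ⟨k, hk⟩ := (hlim.eventually_lt_const (by linarith : (0 : ℝ) < e₀)).exists
  exact (step k).mono (max_le le_rfl hk.le)

/-- **Huxley's bound** for the number of rational points near a planar curve. -/
theorem ConvexPair.card_ratPoints_le {f g : ℝ → ℝ} {m M : ℝ} (h : ConvexPair f g m M) {R η : ℝ}
    (hR : 0 ≤ R) (hη : 0 < η) :
    ∃ K : ℝ, 0 < K ∧ ∀ Q ε : ℝ, 1 ≤ Q → 0 < ε →
      ∀ S : Finset (ℤ × ℤ × ℤ), ↑S ⊆ ratPoints f R Q ε →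
        (S.card : ℝ) ≤ K * Q ^ η * (Q ^ 3 * ε + Q) := by
  obtain ⟨σ, hσ, hσ1, hση⟩ : ∃ σ : ℝ, 0 < σ ∧ σ ≤ 1 ∧ 2 * σ ≤ η :=
    ⟨min 1 (η / 2), by positivity, min_le_left _ _, by have := min_le_right 1 (η / 2); linarith⟩
  obtain ⟨K, R', hK, hR', hdual⟩ := h.exists_dual_bound hR
  obtain ⟨K₁, hK₁, hd⟩ := countBound_of_one_lt hσ (by linarith) (by linarith : 1 < 1 + σ)
    _ _ _ _ h.dual R' (4 * 2 ^ σ) hR' (by positivity)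
  have hr : (1 : ℝ) < 2 ^ (1 + σ - 1) := Real.one_lt_rpow (by norm_num) (by linarith)
  set G := K₁ * 2 ^ (1 + σ) * (2 ^ (1 + σ - 1) / (2 ^ (1 + σ - 1) - 1)) with hG
  have hG0 : 0 < G := by
    have : (0 : ℝ) < 2 ^ (1 + σ - 1) - 1 := by linarith
    positivity
  -- In this range the lines are controlled by `c √(max |offset| ε) ≤ 1 / (Q √ε)`, which gives `Y`,
  -- and then `X = 1 / (Q ε)`. The thinness needed by the dual bound follows from `X ^ σ ≤ Q ^ σ ≤ ε
  -- Q²`.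
  have mid : ∀ Q ε : ℝ, 1 ≤ Q → Q ^ (-2 + σ) ≤ ε → ε ≤ 1 →
      ∀ S : Finset (ℤ × ℤ × ℤ), ↑S ⊆ ratPoints f R Q ε →
        (S.card : ℝ) ≤ (K * 2 + K * G) * Q ^ σ * (Q ^ 3 * ε) := by
    intro Q ε hQ hεQ hε1 S hS
    have hQ0 : 0 < Q := by linarith
    have hε : 0 < ε := lt_of_lt_of_le (by positivity) hεQ
    have hs : 0 < √ε := Real.sqrt_pos.2 hε
    have hQσ : 1 ≤ Q ^ σ := Real.one_le_rpow hQ hσ.le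
    have hbig : Q ^ σ ≤ ε * Q ^ 2 := by
      calc Q ^ σ = Q ^ (-2 + σ) * Q ^ (2 : ℝ) := by rw [← Real.rpow_add hQ0]; congr 1; ring
        _ ≤ ε * Q ^ 2 := by rw [Real.rpow_two]; gcongr
    have hsQ : 1 ≤ Q * √ε := by
      refine le_of_sq_le_sq ?_ (by positivity)
      rw [mul_pow, Real.sq_sqrt hε.le]
      linarith
    obtain ⟨L, hL, hcard⟩ := hdual Q ε _ hQ hε hε1 rfl S hS
    have hX : 1 / (Q * ε) ≤ Q := by
      rw [div_le_iff₀ (by positivity)]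
      linarith
    have hsum : ∑ ℓ ∈ L, ε * Q ^ 2 / (ℓ.1 * √(max |ConvexPair.offset f g ℓ| ε)) ≤
        G * (√ε * Q ^ 2 * (1 / (Q * ε)) ^ (1 + σ - 1)) := by
      refine sum_dual_le hσ.le (by linarith) hK₁ hd hQ hε (X := 1 / (Q * ε))
        (Y := 1 / (Q * √ε)) (by positivity) (by positivity) ?_ ?_ L ?_
      · rw [div_le_one (by positivity)]; exact hsQ
      · have e1 : (1 / (Q * √ε)) ^ 2 = 1 / (ε * Q ^ 2) := by
          rw [div_pow, mul_pow, Real.sq_sqrt hε.le]; ring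
        rw [e1, mul_one_div, div_mul_eq_mul_div, div_le_iff₀ (by positivity),
          Real.mul_rpow (by norm_num) (by positivity)]
        calc 4 * ((2 : ℝ) ^ σ * (1 / (Q * ε)) ^ σ) ≤ 4 * ((2 : ℝ) ^ σ * Q ^ σ) := by gcongr
          _ ≤ 4 * ((2 : ℝ) ^ σ * (ε * Q ^ 2)) := by gcongr
          _ = _ := by ring
      · intro ℓ hℓ
        obtain ⟨a1, a2, a3, a4, a5⟩ := hL ℓ hℓ
        have hc : (0 : ℝ) ≤ ℓ.1 := by exact_mod_cast (by omega : 0 ≤ ℓ.1)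
        have b5 : ℓ.1 * √(max |ConvexPair.offset f g ℓ| ε) ≤ 1 / (Q * √ε) := by
          refine a5.trans ?_
          gcongr
          exact le_max_left _ _
        refine ⟨a1, a2, a3, ?_, b5⟩
        have h1 : ℓ.1 * √ε ≤ 1 / (Q * √ε) := by
          refine le_trans ?_ b5
          gcongr
          exact le_max_right _ _
        refine le_of_mul_le_mul_right (h1.trans (le_of_eq ?_)) hs
        nth_rewrite 2 [← Real.mul_self_sqrt hε.le]
        field_simp
    have hsecond : √ε * Q ^ 2 * (1 / (Q * ε)) ^ (1 + σ - 1) ≤ Q ^ σ * (Q ^ 3 * ε) := by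
      rw [add_sub_cancel_left]
      have h1 : √ε * Q ^ 2 ≤ Q ^ 3 * ε := by
        nth_rewrite 2 [← Real.mul_self_sqrt hε.le]
        have : √ε * Q ^ 2 * 1 ≤ √ε * Q ^ 2 * (Q * √ε) := by gcongr
        nlinarith
      calc √ε * Q ^ 2 * (1 / (Q * ε)) ^ σ ≤ (Q ^ 3 * ε) * Q ^ σ := by gcongr
        _ = _ := by ring
    have hfirst : Q + Q ^ 3 * ε ≤ 2 * (Q ^ σ * (Q ^ 3 * ε)) := by
      have h1 : Q ≤ Q ^ 3 * ε := by nlinarith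
      have h2 : Q ^ 3 * ε ≤ Q ^ σ * (Q ^ 3 * ε) := le_mul_of_one_le_left (by positivity) hQσ
      linarith
    calc (S.card : ℝ) ≤ _ := hcard
      _ ≤ K * (2 * (Q ^ σ * (Q ^ 3 * ε))) + K * (G * (Q ^ σ * (Q ^ 3 * ε))) := by
        gcongr
        exact hsum.trans (by gcongr)
      _ = _ := by ring
  obtain ⟨D, hD⟩ : ∃ D, D = K * 2 + K * G := ⟨_, rfl⟩
  have hD0 : 0 < D := by rw [hD]; positivity
  rw [← hD] at mid
  refine ⟨D + 3 * (2 * R + 1), by positivity, ?_⟩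
  intro Q ε hQ hε S hS
  have hQ0 : 0 < Q := by linarith
  have hQη : 1 ≤ Q ^ η := Real.one_le_rpow hQ hη.le
  have hσ' : Q ^ σ ≤ Q ^ η := Real.rpow_le_rpow_of_exponent_le hQ (by linarith)
  rcases le_total 1 ε with h1 | h1
  · calc (S.card : ℝ) ≤ Q * ((2 * (R * Q) + 1) * (2 * (ε * Q) + 1)) :=
          card_ratPoints_le_trivial hR hQ hε S hS
      _ ≤ Q * ((2 * R + 1) * Q * (3 * (ε * Q))) := by
          gcongr
          · linarith
          · nlinarith
      _ = 3 * (2 * R + 1) * 1 * (Q ^ 3 * ε) := by ring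
      _ ≤ (D + 3 * (2 * R + 1)) * Q ^ η * (Q ^ 3 * ε + Q) := by
          gcongr
          · linarith
          · linarith
  rcases le_total (Q ^ (-2 + σ)) ε with h2 | h2
  · calc (S.card : ℝ) ≤ (D) * Q ^ σ * (Q ^ 3 * ε) := mid Q ε hQ h2 h1 S hS
      _ ≤ (D + 3 * (2 * R + 1)) * Q ^ η * (Q ^ 3 * ε + Q) := by
          gcongr
          · linarith
          · linarith
  -- A thinner strip is widened to the edge of the main range. This costs `Q ^ (1 + 2σ)`, hence the
  -- requirement `2σ ≤ η`.
  · have := mid Q (Q ^ (-2 + σ)) hQ le_rfl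
      (Real.rpow_le_one_of_one_le_of_nonpos hQ (by linarith)) S
      (fun z hz => by
        obtain ⟨a1, a2, a3, a4, a5⟩ := hS hz
        exact ⟨a1, a2, a3, a4, a5.trans h2⟩)
    calc (S.card : ℝ) ≤ _ := this
      _ = (D) * (Q ^ (2 * σ) * Q) := by
          rw [mul_assoc, ← Real.rpow_natCast Q 3, ← Real.rpow_add hQ0, ← Real.rpow_add hQ0,
            ← Real.rpow_add_one hQ0.ne']
          congr 2; push_cast; ring
      _ ≤ (D + 3 * (2 * R + 1)) * (Q ^ η * (Q ^ 3 * ε + Q)) := by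
          gcongr
          · linarith
          · linarith [(by positivity : 0 ≤ Q ^ 3 * ε)]
      _ = _ := by ring

/-! ### The Jarník–Besicovitch lower bound by avoidance of balls -/

/-- Every interval contains a positive proportion of `Q²` fractions with denominators of order
`Q`, by Dirichlet's approximation theorem. -/
theorem eventually_exists_many_rat {α β : ℝ} (hαβ : α < β) :
    ∀ᶠ Q : ℕ in atTop, ∃ F : Finset ℚ,
      (∀ z ∈ F, α ≤ z ∧ (z : ℝ) ≤ β ∧ z.den ≤ Q ∧ Q < 16 * z.den) ∧
      (β - α) * (Q : ℝ) ^ 2 / 128 ≤ F.card := by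
  classical
  have hℓ : 0 < β - α := sub_pos.2 hαβ
  have hces : ∀ᶠ Q : ℕ in atTop,
      (Q : ℝ)⁻¹ * ∑ i ∈ Finset.range Q, (1 : ℝ) / ((i : ℝ) + 1) < (β - α) / 16 :=
    (tendsto_one_div_add_atTop_nhds_zero_nat (𝕜 := ℝ)).cesaro.eventually_lt_const (by positivity)
  have hlarge : ∀ᶠ Q : ℕ in atTop, 4 / (β - α) ≤ (Q : ℝ) :=
    tendsto_natCast_atTop_atTop.eventually_ge_atTop _
  filter_upwards [hces, hlarge, eventually_ge_atTop 1] with Q hQc hQl hQ1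
  have hQ0 : (0 : ℝ) < Q := by exact_mod_cast hQ1
  have hQℓ : 2 / (Q : ℝ) ≤ (β - α) / 2 := by
    rw [div_le_iff₀ hℓ] at hQl
    rw [div_le_div_iff₀ hQ0 two_pos]
    linarith
  let P : Finset (Σ _ : ℕ, ℤ) :=
    (Finset.range (Q / 16)).sigma fun i => Finset.Icc ⌈α * (i + 1)⌉ ⌊β * (i + 1)⌋
  let G : Finset ℚ :=
    ((Finset.range Q).sigma fun i => Finset.Icc ⌈α * (i + 1)⌉ ⌊β * (i + 1)⌋).image
      fun t => (t.2 : ℚ) / ((t.1 : ℚ) + 1)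
  let F : Finset ℚ := G.filter fun z => α ≤ z ∧ (z : ℝ) ≤ β ∧ z.den ≤ Q ∧ Q < 16 * z.den
  refine ⟨F, fun z hz => (Finset.mem_filter.1 hz).2, ?_⟩
  -- The balls of `P` belong to denominators at most `Q / 16` (index `i` means denominator `i + 1`)
  -- and cover at most a quarter of the length, once the Cesàro mean of `1 / (i + 1)` is small. The
  -- balls of `F` have length `32 / Q²` and must cover another quarter, so there are many.
  have hcover : Set.Icc (α + 1 / Q) (β - 1 / Q) ⊆
      (⋃ t ∈ P, Metric.closedBall ((t.2 : ℝ) / ((t.1 : ℝ) + 1)) (1 / (Q * ((t.1 : ℝ) + 1)))) ∪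
      ⋃ z ∈ F, Metric.closedBall (z : ℝ) (16 / (Q : ℝ) ^ 2) := by
    intro x hx
    obtain ⟨z, hz, hden⟩ := Real.exists_rat_abs_sub_le_and_den_le x hQ1
    have hd0 : (0 : ℝ) < z.den := by exact_mod_cast z.den_pos
    have hd1 : (1 : ℝ) ≤ z.den := by exact_mod_cast z.den_pos
    have hz1 : |x - z| ≤ 1 / (Q * z.den) := hz.trans (by gcongr; linarith)
    have hz2 : |x - z| ≤ 1 / Q := hz1.trans (by
      gcongr
      exact le_mul_of_one_le_right hQ0.le hd1)
    rw [abs_le] at hz2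
    have hα : α ≤ z := by linarith [hx.1]
    have hβ : (z : ℝ) ≤ β := by linarith [hx.2]
    have hcast : (z : ℝ) = z.num / z.den := Rat.cast_def z
    have hpred : (((z.den - 1 : ℕ) : ℝ)) + 1 = z.den := by
      rw [Nat.cast_sub z.den_pos]; simp
    have hnum : z.num ∈ Finset.Icc ⌈α * (((z.den - 1 : ℕ) : ℝ) + 1)⌉
        ⌊β * (((z.den - 1 : ℕ) : ℝ) + 1)⌋ := by
      rw [Finset.mem_Icc, hpred, Int.ceil_le, Int.le_floor]
      rw [hcast, le_div_iff₀ hd0] at hα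
      rw [hcast, div_le_iff₀ hd0] at hβ
      exact ⟨hα, hβ⟩
    by_cases hsmall : 16 * z.den ≤ Q
    · left
      refine Set.mem_biUnion (x := (⟨z.den - 1, z.num⟩ : Σ _ : ℕ, ℤ)) ?_ ?_
      · refine Finset.mem_coe.2 (Finset.mem_sigma.2 ⟨Finset.mem_range.2 ?_, hnum⟩)
        have := z.den_pos
        show z.den - 1 < Q / 16
        omega
      · rw [Metric.mem_closedBall, Real.dist_eq]
        simp only [hpred]
        rw [← hcast]
        exact hz1
    · right
      push Not at hsmall
      refine Set.mem_biUnion (x := z) ?_ ?_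
      · refine Finset.mem_coe.2 (Finset.mem_filter.2 ⟨Finset.mem_image.2
          ⟨⟨z.den - 1, z.num⟩, Finset.mem_sigma.2 ⟨Finset.mem_range.2 ?_, hnum⟩, ?_⟩,
          hα, hβ, hden, hsmall⟩)
        · have := z.den_pos
          show z.den - 1 < Q
          omega
        · have : (((z.den - 1 : ℕ) : ℚ)) + 1 = z.den := by
            rw [Nat.cast_sub z.den_pos]; simp
          simp only [this]
          exact Rat.num_div_den z
      · rw [Metric.mem_closedBall, Real.dist_eq]
        refine hz1.trans ?_
        have : (Q : ℝ) ≤ 16 * z.den := by exact_mod_cast hsmall.le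
        rw [div_le_div_iff₀ (by positivity) (by positivity)]
        nlinarith
  have hfin : MeasureTheory.volume ((⋃ t ∈ P, Metric.closedBall ((t.2 : ℝ) / ((t.1 : ℝ) + 1))
      (1 / (Q * ((t.1 : ℝ) + 1)))) ∪ ⋃ z ∈ F, Metric.closedBall (z : ℝ) (16 / (Q : ℝ) ^ 2)) ≠ ⊤ := by
    refine (Bornology.IsBounded.measure_lt_top ?_).ne
    refine Bornology.IsBounded.union ?_ ?_
    · exact (Bornology.isBounded_biUnion_finset P).2 fun t _ => Metric.isBounded_closedBall
    · exact (Bornology.isBounded_biUnion_finset F).2 fun t _ => Metric.isBounded_closedBall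
  have hvol := MeasureTheory.measureReal_mono hcover hfin
  rw [Real.volume_real_Icc_of_le (by
    have : 2 / (Q : ℝ) = 1 / Q + 1 / Q := by ring
    linarith)] at hvol
  have hP : MeasureTheory.volume.real (⋃ t ∈ P, Metric.closedBall ((t.2 : ℝ) / ((t.1 : ℝ) + 1))
      (1 / (Q * ((t.1 : ℝ) + 1)))) ≤ (β - α) / 8 + (β - α) / 8 := by
    refine (MeasureTheory.measureReal_biUnion_finset_le _ _).trans ?_
    rw [Finset.sum_sigma]
    have hin : ∀ i ∈ Finset.range (Q / 16), ∑ p ∈ Finset.Icc ⌈α * (i + 1)⌉ ⌊β * (i + 1)⌋,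
        MeasureTheory.volume.real (Metric.closedBall ((p : ℝ) / ((i : ℝ) + 1))
          (1 / (Q * ((i : ℝ) + 1)))) ≤ 2 * (β - α) / Q + 2 * ((Q : ℝ)⁻¹ * (1 / ((i : ℝ) + 1))) := by
      intro i _
      have hi : (0 : ℝ) < (i : ℝ) + 1 := by positivity
      have hc : ((Finset.Icc ⌈α * ((i : ℝ) + 1)⌉ ⌊β * ((i : ℝ) + 1)⌋).card : ℝ)
          ≤ (β - α) * (i + 1) + 1 := by
        refine card_int_le _ (by positivity) ?_
        intro x hx y hy
        rw [Finset.mem_Icc] at hx hy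
        have h1 := Int.le_floor.1 hx.2
        have h2 := Int.ceil_le.1 hy.1
        linarith
      rw [Finset.sum_congr rfl fun p _ => Real.volume_real_closedBall (by positivity),
        Finset.sum_const, nsmul_eq_mul]
      calc _ ≤ ((β - α) * (i + 1) + 1) * (2 * (1 / (Q * ((i : ℝ) + 1)))) := by gcongr
        _ = _ := by field_simp
    refine (Finset.sum_le_sum hin).trans ?_
    rw [Finset.sum_add_distrib, Finset.sum_const, nsmul_eq_mul, Finset.card_range,
      ← Finset.mul_sum, ← Finset.mul_sum]
    have h1 : ((Q / 16 : ℕ) : ℝ) ≤ Q / 16 := Nat.cast_div_le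
    have h2 : ∑ i ∈ Finset.range (Q / 16), (1 : ℝ) / ((i : ℝ) + 1) ≤
        ∑ i ∈ Finset.range Q, (1 : ℝ) / ((i : ℝ) + 1) :=
      Finset.sum_le_sum_of_subset_of_nonneg
        (Finset.range_subset_range.2 (Nat.div_le_self _ _)) fun i _ _ => by positivity
    have h3 : (Q : ℝ)⁻¹ * ∑ i ∈ Finset.range (Q / 16), (1 : ℝ) / ((i : ℝ) + 1) ≤
        (Q : ℝ)⁻¹ * ∑ i ∈ Finset.range Q, (1 : ℝ) / ((i : ℝ) + 1) := by gcongr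
    have h4 : ((Q / 16 : ℕ) : ℝ) * (2 * (β - α) / Q) ≤ (β - α) / 8 := by
      calc ((Q / 16 : ℕ) : ℝ) * (2 * (β - α) / Q) ≤ (Q / 16 : ℝ) * (2 * (β - α) / Q) := by gcongr
        _ = _ := by field_simp; ring
    linarith
  have hF : MeasureTheory.volume.real (⋃ z ∈ F, Metric.closedBall (z : ℝ) (16 / (Q : ℝ) ^ 2)) ≤
      F.card * (32 / (Q : ℝ) ^ 2) := by
    refine (MeasureTheory.measureReal_biUnion_finset_le _ _).trans ?_
    rw [Finset.sum_congr rfl fun p _ => Real.volume_real_closedBall (by positivity),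
      Finset.sum_const, nsmul_eq_mul]
    gcongr
    exact le_of_eq (by ring)
  have hu := MeasureTheory.measureReal_union_le (μ := MeasureTheory.volume)
    (⋃ t ∈ P, Metric.closedBall ((t.2 : ℝ) / ((t.1 : ℝ) + 1)) (1 / (Q * ((t.1 : ℝ) + 1))))
    (⋃ z ∈ F, Metric.closedBall (z : ℝ) (16 / (Q : ℝ) ^ 2))
  have h2Q : 2 / (Q : ℝ) = 1 / Q + 1 / Q := by ring
  have hfinal : (β - α) / 4 ≤ F.card * (32 / (Q : ℝ) ^ 2) := by linarith
  rw [mul_div_assoc', le_div_iff₀ (by positivity)] at hfinal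
  linarith

/-- The total `s`-weight of those balls `B(x i, d i)` that meet the interval `[z - ρ, z + ρ]`. -/
noncomputable def hitMass (x d : ℕ → ℝ) (s z ρ : ℝ) : ℝ :=
  ∑' i, Set.indicator {i | |x i - z| ≤ d i + ρ} (fun i => d i ^ s) i

section Avoidance

variable {x d : ℕ → ℝ} {s τ : ℝ}

theorem rpow_le_hitMass (hd : ∀ i, 0 < d i) (hsum : Summable fun i => d i ^ s) {z ρ : ℝ} {i : ℕ}
    (hi : |x i - z| ≤ d i + ρ) : d i ^ s ≤ hitMass x d s z ρ := by
  have h := (hsum.indicator {i | |x i - z| ≤ d i + ρ}).le_tsum i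
    (fun j _ => Set.indicator_nonneg (fun j _ => (Real.rpow_pos_of_pos (hd j) s).le) j)
  rwa [Set.indicator_of_mem (by exact hi)] at h

/-- From an interval that meets few of the balls one can pass to a much smaller one, centred at a
rational number that approximates all its points well, and that still meets few of the balls. -/
theorem exists_child (hd : ∀ i, 0 < d i) (hsum : Summable fun i => d i ^ s) (hs : 0 < s)
    (hs1 : s < 1) (hτ : 1 < τ) (hsτ : s * (1 + τ) < 2) {z ρ : ℝ} (hρ : 0 < ρ)
    (hinv : hitMass x d s z ρ ≤ (ρ / 1024) ^ s) (N : ℕ) :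
    ∃ (z' : ℚ) (ρ' : ℝ), 0 < ρ' ∧ ρ' ≤ ρ / 2 ∧ |(z' : ℝ) - z| ≤ ρ / 2 ∧ N ≤ z'.den ∧
      ρ' < (z'.den : ℝ) ^ (-1 - τ) ∧ hitMass x d s z' ρ' ≤ (ρ' / 1024) ^ s := by
  classical
  have hlim : Tendsto (fun Q : ℕ => (Q : ℝ) ^ (2 - s * (1 + τ))) atTop atTop :=
    (tendsto_rpow_atTop (by linarith)).comp tendsto_natCast_atTop_atTop
  have e1 := hlim.eventually_gt_atTop (2 * (ρ / 1024) ^ s / (ρ / 256 * (1 / 2048) ^ s))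
  have e2 : ∀ᶠ Q : ℕ in atTop, 1 / ρ ≤ (Q : ℝ) :=
    tendsto_natCast_atTop_atTop.eventually_ge_atTop _
  obtain ⟨Q, ⟨F, hF, hFcard⟩, hQ1, hQ2, hQ3⟩ :=
    ((eventually_exists_many_rat (show z - ρ / 2 < z + ρ / 2 by linarith)).and
      (e1.and (e2.and (eventually_ge_atTop (16 * N + 1))))).exists
  have hQpos : 1 ≤ Q := by omega
  have hQ0 : (0 : ℝ) < Q := by exact_mod_cast hQpos
  have hQone : (1 : ℝ) ≤ Q := by exact_mod_cast hQpos
  set ρ' : ℝ := (Q : ℝ) ^ (-1 - τ) / 2 with hρ'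
  have hρ'0 : 0 < ρ' := by positivity
  have hρ'Q : ρ' * Q ^ 2 ≤ 1 / 2 := by
    calc ρ' * (Q : ℝ) ^ 2 = (Q : ℝ) ^ (-1 - τ) * (Q : ℝ) ^ (2 : ℝ) / 2 := by
          rw [hρ', Real.rpow_two]; ring
      _ = (Q : ℝ) ^ (1 - τ) / 2 := by rw [← Real.rpow_add hQ0]; congr 2; ring
      _ ≤ 1 / 2 := by
        gcongr
        exact Real.rpow_le_one_of_one_le_of_nonpos hQone (by linarith)
  have hρ'ρ : ρ' ≤ ρ / 2 := by
    have h1 : ρ' * Q ≤ 1 / 2 := by nlinarith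
    rw [div_le_iff₀ hρ] at hQ2
    nlinarith
  have hFcard' : ρ * (Q : ℝ) ^ 2 / 128 ≤ F.card := by
    refine le_trans (le_of_eq ?_) hFcard
    ring
  set W : ℝ := (ρ' / 1024) ^ s with hW
  have hW0 : 0 < W := by positivity
  set A : Set ℕ := {i | |x i - z| ≤ d i + ρ} with hA
  have hdA : ∀ i ∈ A, d i ≤ ρ / 1024 := by
    intro i hi
    have := (rpow_le_hitMass hd hsum hi).trans hinv
    exact (Real.rpow_le_rpow_iff (hd i).le (by positivity) hs).1 this
  have hsub : ∀ z' ∈ F, ∀ i, |x i - z'| ≤ d i + ρ' → i ∈ A := by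
    intro z' hz' i hi
    have h1 := hF z' hz'
    change |x i - z| ≤ d i + ρ
    have h2 : |(z' : ℝ) - z| ≤ ρ / 2 := by
      rw [abs_le]; constructor <;> linarith [h1.1, h1.2.1]
    have h3 : |x i - z| ≤ |x i - z'| + |z' - z| := abs_sub_le _ _ _
    linarith
  -- Weights are cut off at the target value `W`, so that one large ball meeting many candidate
  -- intervals does not dominate the average.
  let w : ℚ → ℕ → ℝ := fun z' =>
    Set.indicator {i | |x i - (z' : ℝ)| ≤ d i + ρ'} fun i => min (d i ^ s) W
  have hwnn : ∀ z' i, 0 ≤ w z' i := fun z' i => Set.indicator_nonneg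
    (fun j _ => le_min (Real.rpow_pos_of_pos (hd j) s).le hW0.le) i
  have hwle : ∀ z' i, w z' i ≤ d i ^ s := fun z' i => by
    refine (Set.indicator_le_self' (fun j _ => le_min (Real.rpow_pos_of_pos (hd j) s).le hW0.le)
      i).trans (min_le_left _ _)
  have hwsum : ∀ z', Summable (w z') := fun z' =>
    Summable.of_nonneg_of_le (hwnn z') (hwle z') hsum
  -- Double counting. The centres are `1 / Q²`-separated and `2ρ' Q² ≤ 1`, so ball `i` meets at most
  -- `2 + 2 d i Q²` candidates. If all candidates failed, `ρ Q² W / 128` would be at most `2 (ρ /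
  -- 1024) ^ s + ρ Q² W / 512`. But `W Q²` is a multiple of `Q ^ (2 - s (1 + τ))`, and `Q` was taken
  -- so large that the first term is below `ρ Q² W / 256`.
  have key : ∃ z' ∈ F, ∑' i, w z' i < W := by
    by_contra hcon
    push Not at hcon
    have h1 : F.card * W ≤ ∑ z' ∈ F, ∑' i, w z' i := by
      rw [← nsmul_eq_mul, ← Finset.sum_const]
      exact Finset.sum_le_sum hcon
    rw [← Summable.tsum_finsetSum fun z' _ => hwsum z'] at h1
    set c : ℝ := 2 + 2 * Q ^ 2 * W * (ρ / 1024) ^ (1 - s) with hc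
    have hterm : ∀ i, ∑ z' ∈ F, w z' i ≤ c * A.indicator (fun i => d i ^ s) i := by
      intro i
      by_cases hi : i ∈ A
      · rw [Set.indicator_of_mem hi]
        have hcount : ((F.filter fun z' : ℚ => |x i - (z' : ℝ)| ≤ d i + ρ').card : ℝ) ≤
            2 + 2 * d i * Q ^ 2 := by
          have := card_le_of_separated (F.filter fun z' : ℚ => |x i - (z' : ℝ)| ≤ d i + ρ')
            (fun z' : ℚ => (z' : ℝ)) (1 / (Q : ℝ) ^ 2) (2 * (d i + ρ')) (by positivity)
            (by have := hd i; positivity) (by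
              intro y hy y' hy' hne
              have a1 := (hF y (Finset.mem_filter.1 hy).1).2.2.1
              have a2 := (hF y' (Finset.mem_filter.1 hy').1).2.2.1
              have := le_abs_div_sub_div (a := y.num) (b := y.den) (c := y'.num) (d := y'.den)
                (k := 1) (Q := Q) (by exact_mod_cast y.den_pos) (by exact_mod_cast y'.den_pos)
                (by exact_mod_cast a1) (by exact_mod_cast a2) (one_dvd _)
                (fun h => hne ((Rat.eq_iff_mul_eq_mul).2 h)) zero_le_one
              rw [Rat.cast_def y, Rat.cast_def y']
              simpa using this) (by
              intro y hy y' hy'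
              have a1 := abs_le.1 (Finset.mem_filter.1 hy).2
              have a2 := abs_le.1 (Finset.mem_filter.1 hy').2
              linarith)
          refine this.trans ?_
          rw [div_div_eq_mul_div, div_one]
          linarith
        have hsw : ∑ z' ∈ F, w z' i =
            (F.filter fun z' : ℚ => |x i - (z' : ℝ)| ≤ d i + ρ').card * min (d i ^ s) W := by
          rw [← nsmul_eq_mul, ← Finset.sum_const, Finset.sum_filter]
          refine Finset.sum_congr rfl fun z' _ => ?_
          simp only [w, Set.indicator, Set.mem_ofPred_eq]
        have hmin0 : 0 ≤ min (d i ^ s) W := le_min (Real.rpow_pos_of_pos (hd i) s).le hW0.le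
        have hdi : d i ≤ (ρ / 1024) ^ (1 - s) * d i ^ s := by
          calc d i = d i ^ (1 - s) * d i ^ s := by
                rw [← Real.rpow_add (hd i), sub_add_cancel, Real.rpow_one]
            _ ≤ _ := by
                gcongr
                · exact (Real.rpow_pos_of_pos (hd i) s).le
                · exact (hd i).le
                · exact hdA i hi
        rw [hsw]
        have hdi0 := (hd i).le
        have hb : (2 * d i * (Q : ℝ) ^ 2) * min (d i ^ s) W ≤
            2 * ((ρ / 1024) ^ (1 - s) * d i ^ s) * Q ^ 2 * W := by
          gcongr
          exact min_le_right _ _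
        calc _ ≤ (2 + 2 * d i * (Q : ℝ) ^ 2) * min (d i ^ s) W := by gcongr
          _ = 2 * min (d i ^ s) W + (2 * d i * (Q : ℝ) ^ 2) * min (d i ^ s) W := by ring
          _ ≤ 2 * d i ^ s + 2 * ((ρ / 1024) ^ (1 - s) * d i ^ s) * Q ^ 2 * W := by
              gcongr
              exact min_le_left _ _
          _ = _ := by rw [hc]; ring
      · rw [Set.indicator_of_notMem hi, mul_zero]
        refine (Finset.sum_eq_zero fun z' hz' => ?_).le
        change Set.indicator {i | |x i - (z' : ℝ)| ≤ d i + ρ'} (fun i => min (d i ^ s) W) i = 0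
        rw [Set.indicator_of_notMem]
        exact fun h => hi (hsub z' hz' i h)
    have h2 : ∑' i, ∑ z' ∈ F, w z' i ≤ c * hitMass x d s z ρ := by
      rw [hitMass, ← tsum_mul_left]
      exact Summable.tsum_le_tsum hterm (summable_sum fun z' _ => hwsum z')
        ((hsum.indicator A).mul_left c)
    have hc0 : 0 < c := by positivity
    have h3 : F.card * W ≤ c * (ρ / 1024) ^ s := h1.trans (h2.trans (by gcongr))
    have e3 : c * (ρ / 1024) ^ s = 2 * (ρ / 1024) ^ s + 2 * Q ^ 2 * W * (ρ / 1024) := by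
      have : (ρ / 1024) ^ (1 - s) * (ρ / 1024) ^ s = ρ / 1024 := by
        rw [← Real.rpow_add (by positivity), sub_add_cancel, Real.rpow_one]
      rw [hc]
      linear_combination 2 * (Q : ℝ) ^ 2 * W * this
    have hWQ : W * Q ^ 2 = (1 / 2048) ^ s * (Q : ℝ) ^ (2 - s * (1 + τ)) := by
      have : ρ' / 1024 = 1 / 2048 * (Q : ℝ) ^ (-1 - τ) := by rw [hρ']; ring
      rw [hW, this, Real.mul_rpow (by norm_num) (by positivity), ← Real.rpow_mul hQ0.le, mul_assoc,
        ← Real.rpow_two, ← Real.rpow_add hQ0]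
      congr 2
      ring
    rw [div_lt_iff₀ (by positivity)] at hQ1
    have h4 : ρ * (Q : ℝ) ^ 2 / 128 * W ≤ F.card * W := by gcongr
    have h5 : 2 * (ρ / 1024) ^ s < ρ / 256 * (W * Q ^ 2) := by rw [hWQ]; linarith
    have h6 : 0 < ρ * (W * Q ^ 2) := by positivity
    nlinarith
  obtain ⟨z', hz', hlt⟩ := key
  have h1 := hF z' hz'
  have hden0 : (0 : ℝ) < z'.den := by exact_mod_cast z'.den_pos
  refine ⟨z', ρ', hρ'0, hρ'ρ, ?_, by omega, ?_, ?_⟩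
  · rw [abs_le]; constructor <;> linarith [h1.1, h1.2.1]
  · have hle : (Q : ℝ) ^ (-1 - τ) ≤ (z'.den : ℝ) ^ (-1 - τ) :=
      Real.rpow_le_rpow_of_nonpos hden0 (by exact_mod_cast h1.2.2.1) (by linarith)
    have : (0 : ℝ) < (Q : ℝ) ^ (-1 - τ) := by positivity
    rw [hρ']
    linarith
  -- A truncated total below `W` means that no term was truncated, so it is the true mass.
  · have heq : ∀ i, Set.indicator {i | |x i - (z' : ℝ)| ≤ d i + ρ'} (fun i => d i ^ s) i
        = w z' i := by
      intro i
      by_cases hi : |x i - (z' : ℝ)| ≤ d i + ρ'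
      · have hlt' : w z' i < W := lt_of_le_of_lt ((hwsum z').le_tsum i fun j _ => hwnn z' j) hlt
        simp only [w] at hlt' ⊢
        rw [Set.indicator_of_mem (by exact hi)] at hlt' ⊢
        rw [Set.indicator_of_mem (by exact hi)]
        rcases min_lt_iff.1 hlt' with h | h
        · exact (min_eq_left h.le).symm
        · exact absurd h (lt_irrefl _)
      · simp only [w]
        rw [Set.indicator_of_notMem (by exact hi), Set.indicator_of_notMem (by exact hi)]
    rw [hitMass, tsum_congr heq]
    exact hlt.le

/-- A family of balls of small total `s`-weight misses some very well approximable point. -/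
theorem exists_wellApproximable_avoiding (hd : ∀ i, 0 < d i) (hsum : Summable fun i => d i ^ s)
    (hs : 0 < s) (hs1 : s < 1) (hτ : 1 < τ) (hsτ : s * (1 + τ) < 2) {z ρ : ℝ} (hρ : 0 < ρ)
    (hsmall : ∑' i, d i ^ s ≤ (ρ / 1024) ^ s) :
    ∃ y ∈ Set.Icc (z - ρ) (z + ρ),
      (∀ N : ℕ, ∃ r : ℚ, N ≤ r.den ∧ |y - r| < (r.den : ℝ) ^ (-1 - τ)) ∧
      ∀ i, d i < |x i - y| := by
  classical
  have hinit : hitMass x d s z ρ ≤ (ρ / 1024) ^ s :=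
    (Summable.tsum_le_tsum (fun i => Set.indicator_le_self' (fun j _ =>
      (Real.rpow_pos_of_pos (hd j) s).le) i) (hsum.indicator _) hsum).trans hsmall
  let T := {p : ℝ × ℝ // 0 < p.2 ∧ hitMass x d s p.1 p.2 ≤ (p.2 / 1024) ^ s}
  have hstep : ∀ (N : ℕ) (p : T), ∃ p' : T, p'.1.2 ≤ p.1.2 / 2 ∧ |p'.1.1 - p.1.1| ≤ p.1.2 / 2 ∧
      ∃ r : ℚ, p'.1.1 = r ∧ N ≤ r.den ∧ p'.1.2 < (r.den : ℝ) ^ (-1 - τ) := by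
    intro N p
    obtain ⟨r, ρ', h1, h2, h3, h4, h5, h6⟩ :=
      exists_child hd hsum hs hs1 hτ hsτ p.2.1 p.2.2 N
    exact ⟨⟨(r, ρ'), h1, h6⟩, h2, h3, r, rfl, h4, h5⟩
  choose nxt hn1 hn2 hn3 using hstep
  let u : ℕ → T := fun n => Nat.rec ⟨(z, ρ), hρ, hinit⟩ (fun k p => nxt k p) n
  have hu : ∀ k, u (k + 1) = nxt k (u k) := fun k => rfl
  let J : ℕ → Set ℝ := fun k => Set.Icc ((u k).1.1 - (u k).1.2) ((u k).1.1 + (u k).1.2)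
  have hJ : (⋂ k, J k).Nonempty := by
    refine IsCompact.nonempty_iInter_of_sequence_nonempty_isCompact_isClosed J ?_ ?_
      isCompact_Icc (fun k => isClosed_Icc)
    · intro k
      have a1 := hn1 k (u k)
      have a2 := abs_le.1 (hn2 k (u k))
      rw [← hu] at a1 a2
      exact Set.Icc_subset_Icc (by linarith) (by linarith)
    · intro k
      have := (u k).2.1
      exact ⟨(u k).1.1, by constructor <;> linarith⟩
  obtain ⟨y, hy⟩ := hJ
  rw [Set.mem_iInter] at hy
  have hyk : ∀ k, |y - (u k).1.1| ≤ (u k).1.2 := by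
    intro k
    have := hy k
    rw [abs_le]
    constructor <;> linarith [this.1, this.2]
  have hρk : ∀ k, (u k).1.2 ≤ ρ * (1 / 2) ^ k := by
    intro k
    induction k with
    | zero => simp [u]
    | succ k ih =>
      have a1 := hn1 k (u k)
      rw [← hu] at a1
      rw [pow_succ]
      linarith
  refine ⟨y, hy 0, ?_, ?_⟩
  · intro N
    obtain ⟨r, hr1, hr2, hr3⟩ := hn3 N (u N)
    rw [← hu] at hr1 hr3
    refine ⟨r, hr2, ?_⟩
    rw [← hr1]
    exact lt_of_le_of_lt (hyk (N + 1)) hr3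
  · intro i
    by_contra hcon
    push Not at hcon
    -- A ball containing `y` meets every interval of the sequence, so its weight is bounded by each
    -- of their masses, which tend to zero.
    have hall : ∀ k, d i ≤ ρ / 1024 * (1 / 2) ^ k := by
      intro k
      have hmeet : |x i - (u k).1.1| ≤ d i + (u k).1.2 := by
        have := abs_sub_le (x i) y (u k).1.1
        linarith [hyk k]
      have h1 := (rpow_le_hitMass hd hsum hmeet).trans (u k).2.2
      have h2 := (Real.rpow_le_rpow_iff (hd i).le (by have := (u k).2.1; positivity) hs).1 h1
      have := hρk k
      linarith
    have hlim : Tendsto (fun k : ℕ => ρ / 1024 * (1 / 2 : ℝ) ^ k) atTop (𝓝 (ρ / 1024 * 0)) :=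
      (tendsto_pow_atTop_nhds_zero_of_lt_one (by norm_num) (by norm_num)).const_mul _
    have := ge_of_tendsto' hlim hall
    rw [mul_zero] at this
    exact absurd (hd i) (not_lt.2 this)

end Avoidance

/-- Vanishing measure gives covers of arbitrarily small `s`-weight; mesh 1 keeps the diameters
finite. The avoidance argument needs strictly positive radii, so each diameter is enlarged by `δ n ^
(1 / s)`, which by subadditivity of `t ^ s` adds at most `δ n` to the weight. -/
theorem exists_cover_of_hausdorffMeasure_eq_zero {E : Set ℝ} {s c : ℝ} (hs : 0 < s) (hs1 : s < 1)
    (hE : MeasureTheory.Measure.hausdorffMeasure s E = 0) (hc : 0 < c) :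
    ∃ x d : ℕ → ℝ, (∀ i, 0 < d i) ∧ (Summable fun i => d i ^ s) ∧ ∑' i, d i ^ s ≤ c ∧
      ∀ y ∈ E, ∃ i, |x i - y| ≤ d i := by
  classical
  rw [MeasureTheory.Measure.hausdorffMeasure_apply] at hE
  have h1 := le_antisymm ((le_iSup₂ (f := fun (r : ENNReal) (_ : 0 < r) =>
    ⨅ (t : ℕ → Set ℝ) (_ : E ⊆ ⋃ n, t n) (_ : ∀ n, Metric.ediam (t n) ≤ r),
      ∑' n, ⨆ (_ : (t n).Nonempty), Metric.ediam (t n) ^ s) 1 one_pos).trans hE.le) bot_le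
  have h2 : (⨅ (t : ℕ → Set ℝ) (_ : E ⊆ ⋃ n, t n) (_ : ∀ n, Metric.ediam (t n) ≤ 1),
      ∑' n, ⨆ (_ : (t n).Nonempty), Metric.ediam (t n) ^ s) < ENNReal.ofReal (c / 2) := by
    rw [h1]
    exact ENNReal.ofReal_pos.2 (by linarith)
  simp only [iInf_lt_iff] at h2
  obtain ⟨t, hcov, hdiam, hlt⟩ := h2
  have hterm : ∀ n, Metric.ediam (t n) ^ s = ⨆ (_ : (t n).Nonempty), Metric.ediam (t n) ^ s := by
    intro n
    rcases (t n).eq_empty_or_nonempty with h | h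
    · simp [h, ENNReal.zero_rpow_of_pos hs]
    · simp [h]
  rw [← tsum_congr hterm] at hlt
  have hfin : ∀ n, Metric.ediam (t n) ≠ ⊤ := fun n => ((hdiam n).trans_lt ENNReal.one_lt_top).ne
  set b : ℕ → ℝ := fun n => (Metric.ediam (t n)).toReal with hb
  have hbE : ∀ n, Metric.ediam (t n) ^ s = ENNReal.ofReal (b n ^ s) := by
    intro n
    rw [← ENNReal.ofReal_rpow_of_nonneg ENNReal.toReal_nonneg hs.le,
      ENNReal.ofReal_toReal (hfin n)]
  have hb0 : ∀ n, 0 ≤ b n := fun n => ENNReal.toReal_nonneg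
  have hbs : Summable fun n => b n ^ s := by
    have : ∑' n, ENNReal.ofReal (b n ^ s) ≠ ⊤ := by
      rw [← tsum_congr hbE]; exact hlt.ne_top
    have h3 := ENNReal.summable_toReal this
    refine h3.congr fun n => ?_
    rw [ENNReal.toReal_ofReal (Real.rpow_nonneg (hb0 n) s)]
  have hbsum : ∑' n, b n ^ s ≤ c / 2 := by
    rw [tsum_congr hbE, ← ENNReal.ofReal_tsum_of_nonneg (fun n => Real.rpow_nonneg (hb0 n) s) hbs]
      at hlt
    exact ((ENNReal.ofReal_lt_ofReal_iff (by linarith)).1 hlt).le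
  set δ : ℕ → ℝ := fun n => c / 4 * (1 / 2) ^ n with hδ
  have hδ0 : ∀ n, 0 < δ n := fun n => by positivity
  have hδs : HasSum δ (c / 2) := by
    have := (hasSum_geometric_two).mul_left (c / 4)
    rwa [show c / 4 * 2 = c / 2 by ring] at this
  set d : ℕ → ℝ := fun n => b n + δ n ^ (1 / s) with hd
  have hd0 : ∀ n, 0 < d n := fun n => add_pos_of_nonneg_of_pos (hb0 n)
    (Real.rpow_pos_of_pos (hδ0 n) _)
  have hdle : ∀ n, d n ^ s ≤ b n ^ s + δ n := by
    intro n
    refine (Real.rpow_add_le_add_rpow (hb0 n) (Real.rpow_nonneg (hδ0 n).le _) hs.le hs1.le).trans ?_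
    rw [← Real.rpow_mul (hδ0 n).le, one_div_mul_cancel hs.ne', Real.rpow_one]
  have hds : Summable fun n => d n ^ s :=
    Summable.of_nonneg_of_le (fun n => (Real.rpow_pos_of_pos (hd0 n) s).le) hdle
      (hbs.add hδs.summable)
  refine ⟨fun n => if h : (t n).Nonempty then h.some else 0, d, hd0, hds, ?_, ?_⟩
  · calc ∑' n, d n ^ s ≤ ∑' n, (b n ^ s + δ n) :=
          Summable.tsum_le_tsum hdle hds (hbs.add hδs.summable)
      _ = ∑' n, b n ^ s + c / 2 := by rw [Summable.tsum_add hbs hδs.summable, hδs.tsum_eq]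
      _ ≤ c := by linarith
  · intro y hy
    obtain ⟨n, hn⟩ := Set.mem_iUnion.1 (hcov hy)
    refine ⟨n, ?_⟩
    have hne : (t n).Nonempty := ⟨y, hn⟩
    simp only [hne, dif_pos]
    have h4 := Metric.edist_le_ediam_of_mem hne.some_mem hn
    have h5 := ENNReal.toReal_mono (hfin n) h4
    rw [← dist_edist, Real.dist_eq] at h5
    exact h5.trans (le_add_of_nonneg_right (Real.rpow_nonneg (hδ0 n).le _))

/-- The lower bound in the **Jarník–Besicovitch theorem**, localized to an interval. -/
theorem le_dimH_wellApproximable {u v τ : ℝ} (huv : u < v) (hτ : 1 < τ) :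
    ENNReal.ofReal (2 / (1 + τ)) ≤
      dimH {y ∈ Set.Icc u v | ∀ N : ℕ, ∃ r : ℚ, N ≤ r.den ∧ |y - r| < (r.den : ℝ) ^ (-1 - τ)} := by
  refine le_of_forall_lt fun a ha => ?_
  obtain ⟨s, hs1, hs2⟩ := ENNReal.lt_iff_exists_nnreal_btwn.1 ha
  refine lt_of_lt_of_le hs1 ?_
  by_contra hcon
  push Not at hcon
  have hs0 : (0 : ℝ) < s := by
    have : (0 : ENNReal) < s := lt_of_le_of_lt bot_le hs1
    exact_mod_cast this
  have hsτ : (s : ℝ) < 2 / (1 + τ) := by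
    rw [← ENNReal.ofReal_coe_nnreal] at hs2
    exact (ENNReal.ofReal_lt_ofReal_iff (by positivity)).1 hs2
  rw [lt_div_iff₀ (by linarith)] at hsτ
  have hslt : (s : ℝ) < 1 := by nlinarith
  have hzero := hausdorffMeasure_of_dimH_lt hcon
  obtain ⟨x, d, hd, hsum, hle, hcov⟩ := exists_cover_of_hausdorffMeasure_eq_zero hs0 hslt hzero
    (c := ((v - u) / 2 / 1024) ^ (s : ℝ)) (Real.rpow_pos_of_pos (by linarith) _)
  obtain ⟨y, hy, hy1, hy2⟩ := exists_wellApproximable_avoiding (x := x) hd hsum hs0 hslt hτ hsτ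
    (z := (u + v) / 2) (ρ := (v - u) / 2) (by linarith) hle
  obtain ⟨i, hi⟩ := hcov y ⟨⟨by linarith [hy.1], by linarith [hy.2]⟩, hy1⟩
  exact absurd hi (not_le.2 (hy2 i))

/-! ### The upper bound for uniformly convex curves -/

/-- The Hausdorff–Cantelli lemma. -/
theorem dimH_le_of_limsup_cover {ι : Type*} [Countable ι] {E : Set ℝ} {s : NNReal} (hs : 0 < s)
    (T : ℕ → Finset ι) (U : ℕ → ι → Set ℝ) (D : ℕ → ι → ℝ) (a : ℕ → ℝ)
    (hD : ∀ k, ∀ i ∈ T k, 0 ≤ D k i)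
    (hdiam : ∀ k, ∀ i ∈ T k, ∀ x ∈ U k i, ∀ y ∈ U k i, |x - y| ≤ D k i)
    (hsum : ∀ k, ∑ i ∈ T k, D k i ^ (s : ℝ) ≤ a k) (ha : Summable a)
    (hE : ∀ y ∈ E, ∀ N : ℕ, ∃ k ≥ N, ∃ i ∈ T k, y ∈ U k i) : dimH E ≤ s := by
  have hs' : (0 : ℝ) < s := hs
  have ha0 : ∀ k, 0 ≤ a k := fun k =>
    (Finset.sum_nonneg fun i hi => Real.rpow_nonneg (hD k i hi) _).trans (hsum k)
  have hed : ∀ k, ∀ i ∈ T k, Metric.ediam (U k i) ≤ ENNReal.ofReal (D k i) := by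
    intro k i hi
    refine Metric.ediam_le fun x hx y hy => ?_
    rw [edist_dist, Real.dist_eq]
    exact ENNReal.ofReal_le_ofReal (hdiam k i hi x hx y hy)
  -- The mesh condition on the covers comes for free: no diameter exceeds the `1 / s`-th power of a
  -- tail of the convergent series.
  have hDle : ∀ k, ∀ i ∈ T k, D k i ≤ a k ^ (1 / (s : ℝ)) := by
    intro k i hi
    have h1 : D k i ^ (s : ℝ) ≤ a k := (Finset.single_le_sum
      (fun j hj => Real.rpow_nonneg (hD k j hj) _) hi).trans (hsum k)
    calc D k i = (D k i ^ (s : ℝ)) ^ (1 / (s : ℝ)) := by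
          rw [← Real.rpow_mul (hD k i hi), mul_one_div_cancel hs'.ne', Real.rpow_one]
      _ ≤ _ := by
        have := Real.rpow_nonneg (hD k i hi) (s : ℝ)
        gcongr
  have hr0 : Tendsto (fun n => ∑' k, ENNReal.ofReal (a (k + n))) atTop (𝓝 0) :=
    ENNReal.tendsto_sum_nat_add (fun k => ENNReal.ofReal (a k)) ha.tsum_ofReal_ne_top
  have hr : Tendsto (fun n => (∑' k, ENNReal.ofReal (a (k + n))) ^ (1 / (s : ℝ))) atTop (𝓝 0) := by
    have := (ENNReal.continuous_rpow_const (y := 1 / (s : ℝ))).tendsto 0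
    rw [ENNReal.zero_rpow_of_pos (by positivity)] at this
    exact this.comp hr0
  have hbound := MeasureTheory.Measure.hausdorffMeasure_le_liminf_tsum (s : ℝ) E
    (fun n => (∑' k, ENNReal.ofReal (a (k + n))) ^ (1 / (s : ℝ))) hr
    (ι := fun n : ℕ => Σ k : ℕ, {i // i ∈ T (k + n)})
    (fun n p => U (p.1 + n) p.2.1) ?_ ?_
  · have hle : ∀ n : ℕ, ∑' p : Σ k : ℕ, {i // i ∈ T (k + n)},
        Metric.ediam (U (p.1 + n) p.2.1) ^ (s : ℝ) ≤ ∑' k, ENNReal.ofReal (a (k + n)) := by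
      intro n
      rw [ENNReal.tsum_sigma']
      refine ENNReal.tsum_le_tsum fun k => ?_
      rw [tsum_fintype, Finset.sum_coe_sort (T (k + n))
        (fun i => Metric.ediam (U (k + n) i) ^ (s : ℝ))]
      calc ∑ i ∈ T (k + n), Metric.ediam (U (k + n) i) ^ (s : ℝ)
          ≤ ∑ i ∈ T (k + n), ENNReal.ofReal (D (k + n) i ^ (s : ℝ)) := by
            refine Finset.sum_le_sum fun i hi => ?_
            rw [← ENNReal.ofReal_rpow_of_nonneg (hD _ i hi) hs'.le]
            gcongr
            exact hed _ i hi
        _ = ENNReal.ofReal (∑ i ∈ T (k + n), D (k + n) i ^ (s : ℝ)) :=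
            (ENNReal.ofReal_sum_of_nonneg fun i hi => Real.rpow_nonneg (hD _ i hi) _).symm
        _ ≤ _ := ENNReal.ofReal_le_ofReal (hsum _)
    have hzero : MeasureTheory.Measure.hausdorffMeasure (s : ℝ) E ≤ 0 := by
      refine hbound.trans ?_
      refine (liminf_le_liminf (Eventually.of_forall hle)).trans ?_
      rw [hr0.liminf_eq]
    exact dimH_le_of_hausdorffMeasure_ne_top (ne_top_of_le_ne_top ENNReal.zero_ne_top hzero)
  · refine Eventually.of_forall fun n p => ?_
    refine (hed _ _ p.2.2).trans ?_
    refine (ENNReal.ofReal_le_ofReal (hDle _ _ p.2.2)).trans ?_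
    rw [← ENNReal.ofReal_rpow_of_nonneg (ha0 _) (by positivity)]
    gcongr
    exact ENNReal.le_tsum (f := fun k => ENNReal.ofReal (a (k + n))) p.1
  · refine Eventually.of_forall fun n y hy => ?_
    obtain ⟨k, hk, i, hi, hyi⟩ := hE y hy n
    obtain ⟨j, rfl⟩ := Nat.exists_eq_add_of_le' hk
    exact Set.mem_iUnion.2 ⟨⟨j, ⟨i, hi⟩⟩, hyi⟩

/-- Take the largest admissible `i`. Below the cap, `b > 2 ^ (-i - 1)` and the product bound gives
`a`. At the cap, `a² ≤ a b` gives `a ≤ 2 ^ (-k τ / 2)`, which is already of the required size. The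
cap keeps the number of values of `i` linear in `k`. -/
theorem exists_dyadic_split {k : ℕ} {τ a b : ℝ} (ha : 0 ≤ a) (hab : a ≤ b)
    (hb : b ≤ 1) (h : a * b < ((2 : ℝ) ^ k) ^ (-τ)) :
    ∃ i ≤ ⌊(k : ℝ) * τ / 2⌋₊, b ≤ (1 / 2 : ℝ) ^ i ∧
      a ≤ 2 * ((2 : ℝ) ^ k) ^ (-τ) * 2 ^ i := by
  classical
  set n := ⌊(k : ℝ) * τ / 2⌋₊ with hn
  set Ψ := ((2 : ℝ) ^ k) ^ (-τ) with hΨ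
  have hΨ0 : 0 < Ψ := by positivity
  set i := Nat.findGreatest (fun i => b ≤ (1 / 2 : ℝ) ^ i) n with hi
  have h0 : b ≤ (1 / 2 : ℝ) ^ i :=
    Nat.findGreatest_spec (P := fun i => b ≤ (1 / 2 : ℝ) ^ i) (Nat.zero_le n) (by simpa using hb)
  have hin : i ≤ n := Nat.findGreatest_le n
  refine ⟨i, hin, h0, ?_⟩
  rcases hin.eq_or_lt with he | hlt
  · have hpow : (2 : ℝ) ^ ((k : ℝ) * τ / 2) ≤ 2 * 2 ^ i := by
      have h1 : (k : ℝ) * τ / 2 ≤ (i : ℝ) + 1 := by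
        rw [he, hn]; exact (Nat.lt_floor_add_one _).le
      calc (2 : ℝ) ^ ((k : ℝ) * τ / 2) ≤ 2 ^ ((i : ℝ) + 1) :=
            Real.rpow_le_rpow_of_exponent_le (by norm_num) h1
        _ = 2 * 2 ^ i := by rw [Real.rpow_add_one (by norm_num), Real.rpow_natCast]; ring
    have hsq : Ψ * ((2 : ℝ) ^ ((k : ℝ) * τ / 2)) ^ 2 = 1 := by
      rw [hΨ, ← Real.rpow_natCast 2 k, ← Real.rpow_mul (by norm_num), ← Real.rpow_mul_natCast
        (by norm_num), ← Real.rpow_add (by norm_num)]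
      rw [show (k : ℝ) * -τ + (k : ℝ) * τ / 2 * ((2 : ℕ) : ℝ) = 0 by push_cast; ring,
        Real.rpow_zero]
    have ha2 : a ^ 2 ≤ (Ψ * (2 : ℝ) ^ ((k : ℝ) * τ / 2)) ^ 2 := by
      have : (Ψ * (2 : ℝ) ^ ((k : ℝ) * τ / 2)) ^ 2 = Ψ := by
        rw [mul_pow, sq Ψ, mul_assoc, hsq, mul_one]
      rw [this]
      nlinarith
    have := le_of_sq_le_sq ha2 (by positivity)
    calc a ≤ Ψ * (2 : ℝ) ^ ((k : ℝ) * τ / 2) := this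
      _ ≤ Ψ * (2 * 2 ^ i) := by gcongr
      _ = _ := by ring
  · have h1 : ¬ b ≤ (1 / 2 : ℝ) ^ (i + 1) :=
      Nat.findGreatest_is_greatest (Nat.lt_succ_self i) hlt
    push Not at h1
    have h2 : a * (1 / 2 : ℝ) ^ (i + 1) ≤ Ψ := by
      have : a * (1 / 2 : ℝ) ^ (i + 1) ≤ a * b := by gcongr
      linarith
    have h3 : (1 / 2 : ℝ) ^ (i + 1) * (2 * 2 ^ i) = 1 := by
      rw [← pow_succ', ← mul_pow]; norm_num
    calc a = a * (1 / 2 : ℝ) ^ (i + 1) * (2 * 2 ^ i) := by rw [mul_assoc, h3, mul_one]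
      _ ≤ Ψ * (2 * 2 ^ i) := by gcongr
      _ = _ := by ring

theorem distInt_nonneg (x : ℝ) : 0 ≤ distInt x := abs_nonneg _

theorem distInt_le_half (x : ℝ) : distInt x ≤ 1 / 2 := abs_sub_round x

theorem finite_ratPoints {f : ℝ → ℝ} {R Q ε : ℝ} (hR : 0 ≤ R) (hQ : 1 ≤ Q)
    (hε : 0 < ε) : (ratPoints f R Q ε).Finite := by
  by_contra hinf
  set B := Q * ((2 * (R * Q) + 1) * (2 * (ε * Q) + 1)) with hB
  obtain ⟨S, hS, hcard⟩ := Set.Infinite.exists_subset_card_eq hinf (⌊B⌋₊ + 1)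
  have h1 := card_ratPoints_le_trivial hR hQ hε S hS
  rw [hcard] at h1
  push_cast at h1
  linarith [Nat.lt_floor_add_one B]

namespace ConvexPair

variable {f g : ℝ → ℝ} {m M : ℝ}

theorem abs_sub_le (h : ConvexPair f g m M) {R x y : ℝ} (hx : |x| ≤ R) (hxy : |y - x| ≤ 1) :
    |f y - f x| ≤ (|g 0| + 2 * M * R + M) * |y - x| := by
  have h1 := h.lower x y
  have h2 := h.upper x y
  have h3 := h.g_bounded hx
  have hM := h.pos'
  have h4 : 0 ≤ m * (y - x) ^ 2 := mul_nonneg h.pos.le (sq_nonneg _)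
  have h5 : |f y - f x - g x * (y - x)| ≤ M * |y - x| := by
    rw [abs_of_nonneg (h4.trans h1)]
    refine h2.trans ?_
    rw [← sq_abs, sq]
    have := abs_nonneg (y - x)
    have : |y - x| * |y - x| ≤ 1 * |y - x| := by gcongr
    nlinarith
  calc |f y - f x| = |g x * (y - x) + (f y - f x - g x * (y - x))| := by congr 1; ring
    _ ≤ |g x| * |y - x| + M * |y - x| := (abs_add_le _ _).trans (by rw [abs_mul]; gcongr)
    _ ≤ (|g 0| + 2 * M * R) * |y - x| + M * |y - x| := by gcongr
    _ = _ := by ring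

/-- This turns a bound on ordinates into one on abscissae when the small factor of the product is
`‖q f(x)‖`. Convexity spares `E` from having to be an interval. -/
theorem mul_abs_sub_le (h : ConvexPair f g m M) {κ : ℝ} {E : Set ℝ}
    (hsign : (∀ x ∈ E, κ ≤ g x) ∨ ∀ x ∈ E, g x ≤ -κ) {x y : ℝ} (hx : x ∈ E) (hy : y ∈ E) :
    κ * |x - y| ≤ |f x - f y| := by
  wlog hxy : x ≤ y generalizing x y
  · rw [abs_sub_comm x y, abs_sub_comm (f x)]
    exact this hy hx (le_of_not_ge hxy)
  have hm := h.pos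
  rw [abs_sub_comm x y, abs_of_nonneg (sub_nonneg.2 hxy)]
  rcases hsign with hs | hs
  · have h1 := h.lower x y
    have h0 : 0 ≤ y - x := sub_nonneg.2 hxy
    have h2 : κ * (y - x) ≤ g x * (y - x) := by
      gcongr
      exact hs x hx
    rw [abs_sub_comm]
    refine le_trans ?_ (le_abs_self _)
    nlinarith [mul_nonneg hm.le (sq_nonneg (y - x))]
  · have h1 := h.lower y x
    have h0 : 0 ≤ y - x := sub_nonneg.2 hxy
    have h2 : g y * (y - x) ≤ -κ * (y - x) := by
      gcongr
      exact hs y hy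
    refine le_trans ?_ (le_abs_self _)
    nlinarith [mul_nonneg hm.le (sq_nonneg (x - y))]

/-- The rational point that a good denominator produces. -/
theorem exists_ratPoint (h : ConvexPair f g m M) {R x : ℝ} (hx : |x| ≤ R) {k q i : ℕ} {b : ℝ}
    (hq : 2 ^ k ≤ q) (hq' : q ≤ 2 * 2 ^ k) (hb1 : distInt (q * x) ≤ b)
    (hb2 : distInt (q * f x) ≤ b) (hb : b ≤ (1 / 2 : ℝ) ^ i) :
    ∃ z ∈ ratPoints f (R + 1) (2 * 2 ^ k)
        ((|g 0| + 2 * M * R + M + 1) * ((1 / 2 : ℝ) ^ i / 2 ^ k)),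
      |x - (z.2.1 : ℝ) / z.1| ≤ distInt (q * x) / 2 ^ k ∧
      |f x - (z.2.2 : ℝ) / z.1| ≤ distInt (q * f x) / 2 ^ k := by
  have h2k : (0 : ℝ) < 2 ^ k := by positivity
  have hqr : (2 : ℝ) ^ k ≤ q := by exact_mod_cast hq
  have hq0 : (0 : ℝ) < q := h2k.trans_le hqr
  have hq1 : (1 : ℝ) ≤ q := le_trans (one_le_pow₀ (by norm_num)) hqr
  have hqN : 0 < q := by exact_mod_cast hq0
  have hM := h.pos'
  obtain ⟨z, d, hz, hz1, hd, e1, e2, e3⟩ :=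
    exists_primitive_smul ((q : ℤ), round ((q : ℝ) * x), round ((q : ℝ) * f x))
      (by simpa using hqN)
  simp only at e1 e2 e3
  have hz0 : (0 : ℝ) < z.1 := by exact_mod_cast (by omega : 0 < z.1)
  have hd0 : (0 : ℝ) < d := by exact_mod_cast hd
  have r1 : (q : ℝ) = d * z.1 := by exact_mod_cast e1
  have r2 : (z.2.1 : ℝ) / z.1 = (round ((q : ℝ) * x) : ℝ) / q := by
    rw [e2, r1]; push_cast; field_simp
  have r3 : (z.2.2 : ℝ) / z.1 = (round ((q : ℝ) * f x) : ℝ) / q := by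
    rw [e3, r1]; push_cast; field_simp
  have dist : ∀ y : ℝ, |y - (round ((q : ℝ) * y) : ℝ) / q| = distInt (q * y) / q := by
    intro y
    rw [distInt, eq_div_iff hq0.ne', ← abs_of_pos hq0, ← abs_mul, abs_of_pos hq0]
    congr 1
    field_simp
  have s1 : |x - (z.2.1 : ℝ) / z.1| ≤ distInt (q * x) / 2 ^ k := by
    rw [r2, dist]
    have := distInt_nonneg (q * x)
    gcongr
  have s2 : |f x - (z.2.2 : ℝ) / z.1| ≤ distInt (q * f x) / 2 ^ k := by
    rw [r3, dist]
    have := distInt_nonneg (q * f x)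
    gcongr
  have hone : |(z.2.1 : ℝ) / z.1 - x| ≤ 1 := by
    rw [abs_sub_comm, r2, dist, div_le_one hq0]
    linarith [distInt_le_half (q * x)]
  have hbk : ∀ t, t ≤ b → t / 2 ^ k ≤ (1 / 2 : ℝ) ^ i / 2 ^ k := by
    intro t ht
    gcongr
    exact ht.trans hb
  refine ⟨z, ⟨hz, hz1, ?_, ?_, ?_⟩, s1, s2⟩
  · have hdge : (1 : ℝ) ≤ d := by exact_mod_cast (by omega : 1 ≤ d)
    have : (q : ℝ) ≤ 2 * 2 ^ k := by exact_mod_cast hq'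
    nlinarith
  · calc |(z.2.1 : ℝ) / z.1| = |x + ((z.2.1 : ℝ) / z.1 - x)| := by congr 1; ring
      _ ≤ |x| + |(z.2.1 : ℝ) / z.1 - x| := abs_add_le _ _
      _ ≤ R + 1 := by gcongr
  · have hL := h.abs_sub_le hx hone
    have hR : 0 ≤ R := (abs_nonneg x).trans hx
    rw [abs_sub_comm ((z.2.1 : ℝ) / z.1)] at hL
    calc |f ((z.2.1 : ℝ) / z.1) - (z.2.2 : ℝ) / z.1|
        ≤ |f ((z.2.1 : ℝ) / z.1) - f x| + |f x - (z.2.2 : ℝ) / z.1| := _root_.abs_sub_le _ _ _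
      _ ≤ (|g 0| + 2 * M * R + M) * ((1 / 2 : ℝ) ^ i / 2 ^ k) + (1 / 2 : ℝ) ^ i / 2 ^ k := by
        refine add_le_add (hL.trans ?_) (s2.trans (hbk _ hb2))
        gcongr
        exact s1.trans (hbk _ hb1)
      _ = _ := by ring

-- Hausdorff–Cantelli over dyadic `P = 2 ^ k`, with one family of sets for each size `t = 2 ^ i` of
-- the larger factor. Huxley's bound with `η = κ' / 4`, a fraction of the slack `κ' = s (1 + τ) -
-- 2`, still leaves a geometric series in `k`.
set_option maxHeartbeats 1000000 in
theorem dimH_le_of_lt (h : ConvexPair f g m M) {R κ τ : ℝ} {s : NNReal} (hR : 0 ≤ R) (hκ : 0 < κ)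
    (hτ : 1 < τ) (hs : 2 < s * (1 + τ)) (hs1 : s ≤ 1) {E : Set ℝ} (hER : ∀ x ∈ E, |x| ≤ R)
    (hsign : (∀ x ∈ E, κ ≤ g x) ∨ ∀ x ∈ E, g x ≤ -κ)
    (hE : ∀ x ∈ E, ∀ N : ℕ, ∃ q ≥ N, distInt (q * x) * distInt (q * f x) < (q : ℝ) ^ (-τ)) :
    dimH E ≤ s := by
  classical
  have hM := h.pos'
  have hs1' : (s : ℝ) ≤ 1 := by exact_mod_cast hs1
  have hs0 : (0 : ℝ) < s := by
    by_contra hc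
    have : (s : ℝ) ≤ 0 := not_lt.1 hc
    nlinarith
  set κ' := s * (1 + τ) - 2 with hκ'
  have hκ'0 : 0 < κ' := by rw [hκ']; linarith
  set Λ := |g 0| + 2 * M * R + M + 1 with hΛ
  have hΛ0 : 0 < Λ := by positivity
  obtain ⟨K, hK, hcount⟩ := h.card_ratPoints_le (R := R + 1) (η := κ' / 4) (by positivity)
    (by positivity)
  let ε : ℕ → ℕ → ℝ := fun k i => Λ * ((1 / 2 : ℝ) ^ i / 2 ^ k)
  have hε : ∀ k i, 0 < ε k i := fun k i => by positivity
  have hP1 : ∀ k : ℕ, (1 : ℝ) ≤ 2 ^ k := fun k => one_le_pow₀ (by norm_num)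
  have hQ : ∀ k : ℕ, (1 : ℝ) ≤ 2 * 2 ^ k := fun k => by linarith [hP1 k]
  let Z : ℕ → ℕ → Finset (ℤ × ℤ × ℤ) := fun k i =>
    (finite_ratPoints (f := f) (by positivity : 0 ≤ R + 1) (hQ k) (hε k i)).toFinset
  let I : ℕ → ℕ := fun k => ⌊(k : ℝ) * τ / 2⌋₊
  let δ : ℕ → ℕ → ℝ := fun k i => 2 * ((2 : ℝ) ^ k) ^ (-τ) * 2 ^ i / 2 ^ k
  have hδ0 : ∀ k i, 0 < δ k i := fun k i => by positivity
  let T : ℕ → Finset ((Σ _ : ℕ, ℤ × ℤ × ℤ) × Bool) := fun k =>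
    ((Finset.range (I k + 1)).sigma (Z k)) ×ˢ Finset.univ
  -- The Boolean records which factor is the smaller one: `true` for the abscissa, `false` for the
  -- ordinate.
  let U : ℕ → (Σ _ : ℕ, ℤ × ℤ × ℤ) × Bool → Set ℝ := fun k p =>
    {x ∈ E | cond p.2 (|x - (p.1.2.2.1 : ℝ) / p.1.2.1| ≤ δ k p.1.1)
      (|f x - (p.1.2.2.2 : ℝ) / p.1.2.1| ≤ δ k p.1.1)}
  set C := 2 * (1 + 1 / κ) with hC
  have hC0 : 0 < C := by positivity
  let D : ℕ → (Σ _ : ℕ, ℤ × ℤ × ℤ) × Bool → ℝ := fun k p => C * δ k p.1.1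
  set A := K * (2 : ℝ) ^ (κ' / 4) * (8 * Λ + 2) * (2 * (C * 2) ^ (s : ℝ)) with hA
  have hA0 : 0 < A := by positivity
  set r : ℝ := 2 ^ (-(κ' / 4)) with hr
  have hr0 : 0 < r := by positivity
  have hr1 : r < 1 := Real.rpow_lt_one_of_one_lt_of_neg (by norm_num) (by linarith)
  have hterm : ∀ k i : ℕ, i ≤ I k →
      (Z k i).card * (2 * (C * δ k i) ^ (s : ℝ)) ≤ 2 * A * r ^ k := by
    intro k i hi
    set P : ℝ := 2 ^ k with hP
    have hP0 : 0 < P := by positivity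
    have hPone : 1 ≤ P := hP1 k
    set t : ℝ := 2 ^ i with ht
    have ht0 : 0 < t := by positivity
    have ht1 : 1 ≤ t := one_le_pow₀ (by norm_num)
    have htP : t ≤ P ^ (τ / 2) := by
      rw [ht, hP, ← Real.rpow_natCast 2 i, ← Real.rpow_natCast 2 k, ← Real.rpow_mul (by norm_num)]
      refine Real.rpow_le_rpow_of_exponent_le (by norm_num) ?_
      have h1 : (i : ℝ) ≤ (I k : ℝ) := by exact_mod_cast hi
      have h2 : (I k : ℝ) ≤ (k : ℝ) * τ / 2 := Nat.floor_le (by positivity)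
      linarith
    have hcard : ((Z k i).card : ℝ) ≤
        K * 2 ^ (κ' / 4) * (8 * Λ + 2) * (P ^ (κ' / 4) * (P ^ 2 / t + P)) := by
      have h1 := hcount (2 * P) (ε k i) (hQ k) (hε k i) (Z k i) (by
        intro z hz
        simpa [Z] using hz)
      have h2 : ε k i = Λ / (t * P) := by
        simp only [ε]
        rw [one_div, inv_pow, ← ht, ← hP]
        field_simp
      rw [h2, Real.mul_rpow (by norm_num) hP0.le] at h1
      have h3 : (2 * P) ^ 3 * (Λ / (t * P)) + 2 * P = 8 * Λ * (P ^ 2 / t) + 2 * P := by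
        field_simp; ring
      rw [h3] at h1
      have h4 : 8 * Λ * (P ^ 2 / t) + 2 * P ≤ (8 * Λ + 2) * (P ^ 2 / t + P) := by
        have a1 : 0 ≤ P ^ 2 / t := by positivity
        have a2 : 0 ≤ Λ * P := by positivity
        nlinarith
      calc _ ≤ _ := h1
        _ ≤ K * (2 ^ (κ' / 4) * P ^ (κ' / 4)) * ((8 * Λ + 2) * (P ^ 2 / t + P)) := by gcongr
        _ = _ := by ring
    have hdel : (C * δ k i) ^ (s : ℝ) = (C * 2) ^ (s : ℝ) * (P ^ (-(τ * s) - s) * t ^ (s : ℝ)) := by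
      have h1 : C * δ k i = C * 2 * (P ^ (-τ - 1) * t) := by
        simp only [δ]
        rw [← hP, ← ht, Real.rpow_sub_one hP0.ne']
        field_simp
      rw [h1, Real.mul_rpow (by positivity) (by positivity), Real.mul_rpow (by positivity) ht0.le,
        ← Real.rpow_mul hP0.le]
      congr 3
      ring
    -- The first summand uses `t ^ s ≤ t`, which needs `s ≤ 1`; the second uses the cap `t ≤ P ^ (τ
    -- / 2)`. Multiplied by `P ^ (-(τ s) - s)` they become `P ^ (-κ')` and `P ^ (-(κ' + s) / 2)`.
    have hmain : (P ^ 2 / t + P) * t ^ (s : ℝ) ≤ P ^ (2 : ℝ) + P ^ (1 + τ * s / 2) := by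
      have h1 : t ^ (s : ℝ) ≤ t := by
        calc t ^ (s : ℝ) ≤ t ^ (1 : ℝ) := Real.rpow_le_rpow_of_exponent_le ht1 hs1'
          _ = t := Real.rpow_one t
      have h2 : t ^ (s : ℝ) ≤ P ^ (τ * s / 2) := by
        calc t ^ (s : ℝ) ≤ (P ^ (τ / 2)) ^ (s : ℝ) := by gcongr
          _ = _ := by rw [← Real.rpow_mul hP0.le]; congr 1; ring
      rw [add_mul, Real.rpow_add hP0, Real.rpow_one, Real.rpow_two]
      refine add_le_add ?_ (by gcongr)
      calc P ^ 2 / t * t ^ (s : ℝ) ≤ P ^ 2 / t * t := by gcongr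
        _ = P ^ 2 := by field_simp
    have hexp : P ^ (κ' / 4) * (P ^ (-(τ * s) - s) * (P ^ (2 : ℝ) + P ^ (1 + τ * s / 2))) ≤
        2 * r ^ k := by
      have hrk : r ^ k = P ^ (-(κ' / 4)) := by
        rw [hr, hP, ← Real.rpow_natCast, ← Real.rpow_natCast, ← Real.rpow_mul (by norm_num),
          ← Real.rpow_mul (by norm_num), mul_comm]
      rw [mul_add, mul_add, ← Real.rpow_add hP0, ← Real.rpow_add hP0, ← Real.rpow_add hP0,
        ← Real.rpow_add hP0, hrk, two_mul]
      refine add_le_add (Real.rpow_le_rpow_of_exponent_le hPone ?_)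
        (Real.rpow_le_rpow_of_exponent_le hPone ?_)
      · rw [hκ']; nlinarith
      · rw [hκ']; nlinarith
    calc (Z k i).card * (2 * (C * δ k i) ^ (s : ℝ))
        ≤ K * 2 ^ (κ' / 4) * (8 * Λ + 2) * (P ^ (κ' / 4) * (P ^ 2 / t + P)) *
          (2 * ((C * 2) ^ (s : ℝ) * (P ^ (-(τ * s) - s) * t ^ (s : ℝ)))) := by
          rw [hdel]; gcongr
      _ = A * (P ^ (κ' / 4) * (P ^ (-(τ * s) - s) * ((P ^ 2 / t + P) * t ^ (s : ℝ)))) := by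
          rw [hA]; ring
      _ ≤ A * (P ^ (κ' / 4) * (P ^ (-(τ * s) - s) * (P ^ (2 : ℝ) + P ^ (1 + τ * s / 2)))) := by
          gcongr
      _ ≤ A * (2 * r ^ k) := by gcongr
      _ = _ := by ring
  refine dimH_le_of_limsup_cover (by exact_mod_cast hs0) T U D
    (fun k => ((k : ℝ) * τ / 2 + 1) * (2 * A * r ^ k)) ?_ ?_ ?_ ?_ ?_
  · intro k p _
    have := hδ0 k p.1.1
    positivity
  · rintro k ⟨⟨i, z⟩, b⟩ _ x hx y hy
    obtain ⟨hxE, hx⟩ := hx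
    obtain ⟨hyE, hy⟩ := hy
    have hd := hδ0 k i
    have hκi : 0 < 1 / κ := by positivity
    cases b
    · have hx' : |f x - (z.2.2 : ℝ) / z.1| ≤ δ k i := hx
      have hy' : |f y - (z.2.2 : ℝ) / z.1| ≤ δ k i := hy
      have h1 := h.mul_abs_sub_le hsign hxE hyE
      have h2 : |f x - f y| ≤ 2 * δ k i := by
        rw [abs_le] at hx' hy' ⊢
        constructor <;> linarith
      have h3 : |x - y| ≤ 2 * δ k i / κ := by
        rw [le_div_iff₀ hκ]; linarith
      refine h3.trans ?_
      simp only [D]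
      rw [hC]
      have : 2 * δ k i / κ = 2 * (1 / κ) * δ k i := by ring
      rw [this]
      gcongr
      linarith
    · have hx' : |x - (z.2.1 : ℝ) / z.1| ≤ δ k i := hx
      have hy' : |y - (z.2.1 : ℝ) / z.1| ≤ δ k i := hy
      have h2 : |x - y| ≤ 2 * δ k i := by
        rw [abs_le] at hx' hy' ⊢
        constructor <;> linarith
      refine h2.trans ?_
      simp only [D]
      rw [hC]
      gcongr
      linarith
  · intro k
    have hsum : ∑ p ∈ T k, D k p ^ (s : ℝ) =
        ∑ i ∈ Finset.range (I k + 1), (Z k i).card * (2 * (C * δ k i) ^ (s : ℝ)) := by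
      simp only [T]
      rw [Finset.sum_product, Finset.sum_sigma]
      refine Finset.sum_congr rfl fun i _ => ?_
      simp [D]
    rw [hsum]
    calc _ ≤ ∑ _i ∈ Finset.range (I k + 1), 2 * A * r ^ k :=
          Finset.sum_le_sum fun i hi => hterm k i (Nat.lt_succ_iff.1 (Finset.mem_range.1 hi))
      _ = ((I k : ℝ) + 1) * (2 * A * r ^ k) := by
          rw [Finset.sum_const, nsmul_eq_mul, Finset.card_range]; push_cast; ring
      _ ≤ _ := by
          gcongr
          exact Nat.floor_le (by positivity)
  · have h1 : Summable fun k : ℕ => (k : ℝ) ^ 1 * r ^ k :=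
      summable_pow_mul_geometric_of_norm_lt_one 1 (by rwa [Real.norm_eq_abs, abs_of_pos hr0])
    have h2 : Summable fun k : ℕ => r ^ k := summable_geometric_of_lt_one hr0.le hr1
    refine ((h1.mul_left (τ / 2 * (2 * A))).add (h2.mul_left (2 * A))).congr fun k => ?_
    ring
  · intro x hx N
    obtain ⟨q, hqN, hq⟩ := hE x hx (2 ^ N)
    have hq0 : q ≠ 0 := by
      have : 0 < 2 ^ N := by positivity
      omega
    set k := Nat.log 2 q with hk
    have hk1 : 2 ^ k ≤ q := Nat.pow_log_le_self 2 hq0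
    have hk2 : q ≤ 2 * 2 ^ k := by
      have := Nat.lt_pow_succ_log_self (b := 2) (by norm_num) q
      rw [← hk, pow_succ] at this
      omega
    have hkN : N ≤ k := by
      rw [hk, ← Nat.log_pow (b := 2) (by norm_num) N]
      exact Nat.log_mono_right hqN
    refine ⟨k, hkN, ?_⟩
    set u := distInt (q * x) with hu
    set v := distInt (q * f x) with hv
    have hu0 : 0 ≤ u := distInt_nonneg _
    have hv0 : 0 ≤ v := distInt_nonneg _
    have hu1 : u ≤ 1 / 2 := distInt_le_half _
    have hv1 : v ≤ 1 / 2 := distInt_le_half _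
    have hqΨ : (q : ℝ) ^ (-τ) ≤ ((2 : ℝ) ^ k) ^ (-τ) :=
      Real.rpow_le_rpow_of_nonpos (by positivity) (by exact_mod_cast hk1) (by linarith)
    have hmm : min u v * max u v < ((2 : ℝ) ^ k) ^ (-τ) := by
      rw [min_mul_max]; linarith
    obtain ⟨i, hi, hi1, hi2⟩ := exists_dyadic_split (le_min hu0 hv0) min_le_max
      (max_le (by linarith) (by linarith)) hmm
    obtain ⟨z, hz, hz1, hz2⟩ := h.exists_ratPoint (hER x hx) hk1 hk2 (le_max_left u v)
      (le_max_right u v) hi1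
    have hzZ : z ∈ Z k i := (Set.Finite.mem_toFinset _).2 hz
    have hmem : ∀ b : Bool, ((⟨i, z⟩ : Σ _ : ℕ, ℤ × ℤ × ℤ), b) ∈ T k := fun b =>
      Finset.mem_product.2 ⟨Finset.mem_sigma.2 ⟨Finset.mem_range.2 (Nat.lt_succ_of_le hi), hzZ⟩,
        Finset.mem_univ _⟩
    rcases le_total u v with huv | huv
    · refine ⟨(⟨i, z⟩, true), hmem _, hx, ?_⟩
      rw [min_eq_left huv] at hi2
      change |x - (z.2.1 : ℝ) / z.1| ≤ δ k i
      exact hz1.trans (div_le_div_of_nonneg_right hi2 (by positivity))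
    · refine ⟨(⟨i, z⟩, false), hmem _, hx, ?_⟩
      rw [min_eq_right huv] at hi2
      change |f x - (z.2.2 : ℝ) / z.1| ≤ δ k i
      exact hz2.trans (div_le_div_of_nonneg_right hi2 (by positivity))

end ConvexPair

theorem distInt_neg (x : ℝ) : distInt (-x) = distInt x := by
  refine (distInt_isLeast (-x)).unique ?_
  have h := distInt_isLeast x
  have : (Set.range fun m : ℤ => |-x - (m : ℝ)|) = Set.range fun m : ℤ => |x - (m : ℝ)| := by
    ext y
    constructor <;> rintro ⟨m, rfl⟩ <;> refine ⟨-m, ?_⟩ <;>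
      · simp only
        rw [← abs_neg]
        congr 1
        push_cast
        ring
  rwa [this]

/-- The slope `g` vanishes at one point at most, and countably many sets with `|g| ≥ 1 / (n + 1)`
and constant sign exhaust the rest; Hausdorff dimension is countably stable. -/
theorem ConvexPair.dimH_le {f g : ℝ → ℝ} {m M : ℝ} (h : ConvexPair f g m M) {R τ : ℝ} {s : NNReal}
    (hR : 0 ≤ R) (hτ : 1 < τ) (hs : 2 < s * (1 + τ)) (hs1 : s ≤ 1) {E : Set ℝ}
    (hER : ∀ x ∈ E, |x| ≤ R)
    (hE : ∀ x ∈ E, ∀ N : ℕ, ∃ q ≥ N, distInt (q * x) * distInt (q * f x) < (q : ℝ) ^ (-τ)) :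
    dimH E ≤ s := by
  have hcover : E ⊆ ({x | g x = 0} ∪ ⋃ n : ℕ, {x ∈ E | 1 / ((n : ℝ) + 1) ≤ g x}) ∪
      ⋃ n : ℕ, {x ∈ E | g x ≤ -(1 / ((n : ℝ) + 1))} := by
    intro x hx
    rcases lt_trichotomy (g x) 0 with h0 | h0 | h0
    · obtain ⟨n, hn⟩ := exists_nat_one_div_lt (neg_pos.2 h0)
      exact Or.inr (Set.mem_iUnion.2 ⟨n, hx, by linarith⟩)
    · exact Or.inl (Or.inl h0)
    · obtain ⟨n, hn⟩ := exists_nat_one_div_lt h0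
      exact Or.inl (Or.inr (Set.mem_iUnion.2 ⟨n, hx, hn.le⟩))
  have hpos : ∀ n : ℕ, (0 : ℝ) < 1 / ((n : ℝ) + 1) := fun n => by positivity
  refine (dimH_mono hcover).trans ?_
  rw [dimH_union, dimH_union, dimH_iUnion, dimH_iUnion]
  refine max_le (max_le ?_ (iSup_le fun n => ?_)) (iSup_le fun n => ?_)
  · rw [dimH_subsingleton]
    · exact zero_le
    · intro x hx y hy
      exact h.injective ((show g x = 0 from hx).trans (show g y = 0 from hy).symm)
  · exact h.dimH_le_of_lt hR (hpos n) hτ hs hs1 (fun x hx => hER x hx.1)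
      (Or.inl fun x hx => hx.2) fun x hx => hE x hx.1
  · exact h.dimH_le_of_lt hR (hpos n) hτ hs hs1 (fun x hx => hER x hx.1)
      (Or.inr fun x hx => hx.2) fun x hx => hE x hx.1

/-! ### Localization to pieces with nonvanishing second derivative -/

theorem tangent_le_of_monotone_deriv {f g : ℝ → ℝ} (hf : ∀ x, HasDerivAt f (g x) x)
    (hg : Monotone g) (x y : ℝ) : 0 ≤ f y - f x - g x * (y - x) := by
  have hc : Continuous f := continuous_iff_continuousAt.2 fun x => (hf x).continuousAt
  rcases lt_trichotomy x y with hxy | rfl | hxy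
  · obtain ⟨c, hc, he⟩ := exists_hasDerivAt_eq_slope f g hxy hc.continuousOn fun z _ => hf z
    rw [eq_div_iff (sub_pos.2 hxy).ne'] at he
    have := hg hc.1.le
    nlinarith
  · simp
  · obtain ⟨c, hc, he⟩ := exists_hasDerivAt_eq_slope f g hxy hc.continuousOn fun z _ => hf z
    rw [eq_div_iff (sub_pos.2 hxy).ne'] at he
    have := hg hc.2.le
    nlinarith

/-- The two Taylor bounds are the tangent inequality for the convex functions `f - m x² / 2` and `M
x² / 2 - f`; surjectivity of `g` follows from its linear growth. -/
theorem ConvexPair.of_hasDerivAt {f g h : ℝ → ℝ} {m M : ℝ} (hm : 0 < m)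
    (hf : ∀ x, HasDerivAt f (g x) x) (hg : ∀ x, HasDerivAt g (h x) x)
    (hmh : ∀ x, m ≤ h x) (hhM : ∀ x, h x ≤ M) : ConvexPair f g (m / 2) (M / 2) := by
  have hsq : ∀ c x : ℝ, HasDerivAt (fun x : ℝ => c / 2 * x ^ 2) (c * x) x := fun c x => by
    refine ((hasDerivAt_pow 2 x).const_mul (c / 2)).congr_deriv ?_
    push_cast
    ring
  have hlin : ∀ c x : ℝ, HasDerivAt (fun x : ℝ => c * x) c x := fun c x => by
    simpa using (hasDerivAt_id x).const_mul c
  have hmono1 : Monotone fun x => g x - m * x :=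
    monotone_of_hasDerivAt_nonneg (fun x => (hg x).sub (hlin m x)) fun x => sub_nonneg.2 (hmh x)
  have hmono2 : Monotone fun x => M * x - g x :=
    monotone_of_hasDerivAt_nonneg (fun x => (hlin M x).sub (hg x)) fun x => sub_nonneg.2 (hhM x)
  refine ⟨by positivity, fun x y => ?_, fun x y => ?_, ?_⟩
  · have := tangent_le_of_monotone_deriv (fun x => (hf x).sub (hsq m x)) hmono1 x y
    simp only [Pi.sub_apply] at this
    nlinarith
  · have := tangent_le_of_monotone_deriv (fun x => (hsq M x).sub (hf x)) hmono2 x y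
    simp only [Pi.sub_apply] at this
    nlinarith
  · have hc : Continuous g := continuous_iff_continuousAt.2 fun x => (hg x).continuousAt
    refine hc.surjective ?_ ?_
    · refine tendsto_atTop_mono' atTop ?_
        (tendsto_atTop_add_const_right atTop (g 0) (tendsto_id.const_mul_atTop hm))
      filter_upwards [eventually_ge_atTop 0] with x hx
      have := hmono1 hx
      simp only [id] at this ⊢
      linarith
    · refine tendsto_atBot_mono' atBot ?_
        (tendsto_atBot_add_const_right atBot (g 0) (tendsto_id.const_mul_atBot hm))
      filter_upwards [eventually_le_atBot 0] with x hx
      have := hmono1 hx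
      simp only [id] at this ⊢
      linarith

/-- The second derivative is extended by its endpoint values and integrated twice. A global function
is wanted so that the Legendre transform is defined at every slope. -/
theorem exists_convexPair_eqOn {f g h : ℝ → ℝ} {u v m : ℝ} (huv : u ≤ v) (hm : 0 < m)
    (hf : ∀ x ∈ Set.Icc u v, HasDerivAt f (g x) x) (hg : ∀ x ∈ Set.Icc u v, HasDerivAt g (h x) x)
    (hh : ContinuousOn h (Set.Icc u v)) (hmh : ∀ x ∈ Set.Icc u v, m ≤ h x) :
    ∃ F G m' M', ConvexPair F G m' M' ∧ Set.EqOn F f (Set.Icc u v) := by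
  obtain ⟨M, hM⟩ := isCompact_Icc.bddAbove_image hh
  set H : ℝ → ℝ := fun x => h (Set.projIcc u v huv x) with hH
  have hHc : Continuous H := hh.comp_continuous
    (continuous_subtype_val.comp continuous_projIcc) fun x => (Set.projIcc u v huv x).2
  have hHeq : ∀ x ∈ Set.Icc u v, H x = h x := fun x hx => by
    simp only [hH, Set.projIcc_of_mem huv hx]
  have hsub : ∀ x ∈ Set.Icc u v, Set.uIcc u x ⊆ Set.Icc u v := fun x hx => by
    rw [Set.uIcc_of_le hx.1]
    exact Set.Icc_subset_Icc_right hx.2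
  set G : ℝ → ℝ := fun x => g u + ∫ t in u..x, H t with hG
  have hGd : ∀ x, HasDerivAt G (H x) x := fun x =>
    (hHc.integral_hasStrictDerivAt u x).hasDerivAt.const_add (g u)
  have hGc : Continuous G := continuous_iff_continuousAt.2 fun x => (hGd x).continuousAt
  have hGeq : ∀ x ∈ Set.Icc u v, G x = g x := by
    intro x hx
    have h1 : ∫ t in u..x, H t = g x - g u := by
      refine intervalIntegral.integral_eq_sub_of_hasDerivAt (fun t ht => ?_)
        (hHc.intervalIntegrable _ _)
      rw [hHeq t (hsub x hx ht)]
      exact hg t (hsub x hx ht)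
    simp only [hG, h1]
    ring
  set F : ℝ → ℝ := fun x => f u + ∫ t in u..x, G t with hF
  have hFd : ∀ x, HasDerivAt F (G x) x := fun x =>
    (hGc.integral_hasStrictDerivAt u x).hasDerivAt.const_add (f u)
  refine ⟨F, G, m / 2, M / 2, ConvexPair.of_hasDerivAt hm hFd hGd
    (fun x => hmh _ (Set.projIcc u v huv x).2)
    (fun x => hM ⟨_, (Set.projIcc u v huv x).2, rfl⟩), fun x hx => ?_⟩
  have h1 : ∫ t in u..x, G t = f x - f u := by
    refine intervalIntegral.integral_eq_sub_of_hasDerivAt (fun t ht => ?_)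
      (hGc.intervalIntegrable _ _)
    rw [hGeq t (hsub x hx ht)]
    exact hf t (hsub x hx ht)
  simp only [hF, h1]
  ring

theorem dimH_le_of_deriv2_pos {f g h : ℝ → ℝ} {u v m τ : ℝ} (huv : u ≤ v) (hm : 0 < m)
    (hf : ∀ x ∈ Set.Icc u v, HasDerivAt f (g x) x) (hg : ∀ x ∈ Set.Icc u v, HasDerivAt g (h x) x)
    (hh : ContinuousOn h (Set.Icc u v)) (hmh : ∀ x ∈ Set.Icc u v, m ≤ h x) {s : NNReal}
    (hτ : 1 < τ) (hs : 2 < s * (1 + τ)) (hs1 : s ≤ 1) {E : Set ℝ} (hEI : E ⊆ Set.Icc u v)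
    (hE : ∀ x ∈ E, ∀ N : ℕ, ∃ q ≥ N, distInt (q * x) * distInt (q * f x) < (q : ℝ) ^ (-τ)) :
    dimH E ≤ s := by
  obtain ⟨F, G, m', M', hFG, heq⟩ := exists_convexPair_eqOn huv hm hf hg hh hmh
  refine hFG.dimH_le (R := max |u| |v|) (by positivity) hτ hs hs1 (fun x hx => ?_) fun x hx => ?_
  · exact abs_le_max_abs_abs (hEI hx).1 (hEI hx).2
  · rw [heq (hEI hx)]
    exact hE x hx

/-- Since `distInt` is even, `f` may be replaced by `-f`, which makes the second derivative positive
at `x₀`; by continuity it stays above half its value nearby. -/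
theorem exists_nhds_dimH_le {f g h : ℝ → ℝ} {J : Set ℝ} (hJ : IsOpen J)
    (hf : ∀ x ∈ J, HasDerivAt f (g x) x) (hg : ∀ x ∈ J, HasDerivAt g (h x) x)
    (hh : ContinuousOn h J) {x₀ : ℝ} (hx₀ : x₀ ∈ J) (h0 : h x₀ ≠ 0) {τ : ℝ} {s : NNReal}
    (hτ : 1 < τ) (hs : 2 < s * (1 + τ)) (hs1 : s ≤ 1) {E : Set ℝ}
    (hE : ∀ x ∈ E, ∀ N : ℕ, ∃ q ≥ N, distInt (q * x) * distInt (q * f x) < (q : ℝ) ^ (-τ)) :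
    ∃ V ∈ 𝓝 x₀, dimH (E ∩ V) ≤ s := by
  wlog hpos : 0 < h x₀ generalizing f g h
  · refine this (f := fun x => -f x) (g := fun x => -g x) (h := fun x => -h x)
      (fun x hx => (hf x hx).neg) (fun x hx => (hg x hx).neg) hh.neg (neg_ne_zero.2 h0) ?_ ?_
    · simpa only [mul_neg, distInt_neg] using hE
    · exact neg_pos.2 (lt_of_le_of_ne (not_lt.1 hpos) h0)
  have hev : ∀ᶠ x in 𝓝 x₀, x ∈ J ∧ h x₀ / 2 < h x :=
    (hJ.eventually_mem hx₀).and ((hh.continuousAt (hJ.mem_nhds hx₀)).eventually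
      (lt_mem_nhds (half_lt_self hpos)))
  obtain ⟨ε, hε, hball⟩ := Metric.eventually_nhds_iff_ball.1 hev
  have hsub : ∀ x ∈ Set.Icc (x₀ - ε / 2) (x₀ + ε / 2), x ∈ J ∧ h x₀ / 2 < h x := by
    intro x hx
    refine hball x ?_
    rw [Metric.mem_ball, Real.dist_eq, abs_lt]
    constructor <;> linarith [hx.1, hx.2]
  refine ⟨Set.Icc (x₀ - ε / 2) (x₀ + ε / 2), Icc_mem_nhds (by linarith) (by linarith), ?_⟩
  exact dimH_le_of_deriv2_pos (by linarith) (half_pos hpos) (fun x hx => hf x (hsub x hx).1)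
    (fun x hx => hg x (hsub x hx).1) (hh.mono fun x hx => (hsub x hx).1)
    (fun x hx => (hsub x hx).2.le) hτ hs hs1 Set.inter_subset_right fun x hx => hE x hx.1

/-! ### Comparison of `ψ` with powers, and the two bounds on the curve -/

theorem HasOrder.eventually_lt {ψ : ℝ → ℝ} (hψ : IsApproximatingFunction ψ) {l τ : ℝ}
    (hl : HasOrder ψ l) (hτ : τ < l) : ∀ᶠ x in atTop, ψ x < x ^ (-τ) := by
  filter_upwards [hl.eventually (lt_mem_nhds hτ), eventually_gt_atTop 1] with x hx hx1
  have hlog := Real.log_pos hx1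
  rw [lt_div_iff₀ hlog] at hx
  have hx0 : 0 < x := by linarith
  rw [← Real.log_lt_log_iff (hψ.pos x hx0) (by positivity), Real.log_rpow hx0]
  linarith

theorem HasOrder.eventually_gt {ψ : ℝ → ℝ} (hψ : IsApproximatingFunction ψ) {l τ : ℝ}
    (hl : HasOrder ψ l) (hτ : l < τ) : ∀ᶠ x in atTop, x ^ (-τ) < ψ x := by
  filter_upwards [hl.eventually (gt_mem_nhds hτ), eventually_gt_atTop 1] with x hx hx1
  have hlog := Real.log_pos hx1
  rw [div_lt_iff₀ hlog] at hx
  have hx0 : 0 < x := by linarith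
  rw [← Real.log_lt_log_iff (by positivity) (hψ.pos x hx0), Real.log_rpow hx0]
  linarith

theorem Set.OrdConnected.dimH_diff_interior {I : Set ℝ} (hI : I.OrdConnected) :
    dimH (I \ interior I) = 0 := by
  have hsub : I \ interior I ⊆ {x | IsLeast I x} ∪ {x | IsGreatest I x} := by
    rintro x ⟨hx, hxi⟩
    by_contra hc
    have h1 : ¬ IsLeast I x := fun h => hc (Or.inl h)
    have h2 : ¬ IsGreatest I x := fun h => hc (Or.inr h)
    obtain ⟨a, ha, hax⟩ : ∃ a ∈ I, a < x := by
      by_contra hn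
      push Not at hn
      exact h1 ⟨hx, hn⟩
    obtain ⟨b, hb, hxb⟩ : ∃ b ∈ I, x < b := by
      by_contra hn
      push Not at hn
      exact h2 ⟨hx, hn⟩
    exact hxi (mem_interior.2 ⟨Set.Ioo a b, Set.Ioo_subset_Icc_self.trans (hI.out ha hb),
      isOpen_Ioo, hax, hxb⟩)
  refine le_antisymm ((dimH_mono hsub).trans ?_) zero_le
  rw [dimH_union, dimH_subsingleton, dimH_subsingleton, max_self]
  · exact fun x hx y hy => hx.unique hy
  · exact fun x hx y hy => hx.unique hy

theorem mem_multApproximable_graph {ψ : ℝ → ℝ} {f : ℝ → ℝ} {x : ℝ} :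
    (!₂[x, f x] : EuclideanSpace ℝ (Fin 2)) ∈ multApproximable 2 ψ ↔
      {q : ℕ | 0 < q ∧ distInt (q * x) * distInt (q * f x) < ψ q}.Infinite := by
  simp [multApproximable, Fin.prod_univ_two]

/-- The parametrization is `C¹` and cannot raise dimension, so only abscissae matter. Away from the
endpoints and the zeros of `f''` the bound is local, and a set of dimension above `s` has a point
all of whose relative neighbourhoods have dimension above `s`. -/
theorem dimH_graph_le {ψ f : ℝ → ℝ} (hψ : IsApproximatingFunction ψ) {l : ℝ} (hl : HasOrder ψ l)
    (hl1 : 1 < l) {I : Set ℝ} (hI : I.OrdConnected) (hf : ContDiffOn ℝ 3 f I)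
    (hdim : dimH {x : ℝ | x ∈ I ∧ iteratedDerivWithin 2 f I x = 0}
      ≤ ENNReal.ofReal (2 / (1 + l))) :
    dimH (graphCurve f I ∩ multApproximable 2 ψ) ≤ ENNReal.ofReal (2 / (1 + l)) := by
  set X := {x ∈ I | (!₂[x, f x] : EuclideanSpace ℝ (Fin 2)) ∈ multApproximable 2 ψ} with hX
  have himage : graphCurve f I ∩ multApproximable 2 ψ ⊆
      (fun x : ℝ => (!₂[x, f x] : EuclideanSpace ℝ (Fin 2))) '' X := by
    rintro _ ⟨⟨x, hx, rfl⟩, hm⟩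
    exact ⟨x, ⟨hx, hm⟩, rfl⟩
  have hsmooth : ContDiffOn ℝ 1 (fun x : ℝ => (!₂[x, f x] : EuclideanSpace ℝ (Fin 2))) I := by
    rw [contDiffOn_euclidean]
    intro i
    fin_cases i
    · exact contDiffOn_id
    · exact hf.of_le (by norm_num)
  refine (dimH_mono himage).trans ?_
  refine (hsmooth.dimH_image_le hI.convex fun x hx => hx.1).trans ?_
  set J := interior I with hJ
  have hfJ : ContDiffOn ℝ 3 f J := hf.mono interior_subset
  have hJo : IsOpen J := isOpen_interior
  have hf' : ContDiffOn ℝ 2 (deriv f) J := hfJ.deriv_of_isOpen hJo (by norm_num)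
  have hf'' : ContDiffOn ℝ 1 (deriv (deriv f)) J := hf'.deriv_of_isOpen hJo (by norm_num)
  have hd1 : ∀ x ∈ J, HasDerivAt f (deriv f x) x := fun x hx =>
    ((hfJ.differentiableOn (by norm_num)).differentiableAt (hJo.mem_nhds hx)).hasDerivAt
  have hd2 : ∀ x ∈ J, HasDerivAt (deriv f) (deriv (deriv f) x) x := fun x hx =>
    ((hf'.differentiableOn (by norm_num)).differentiableAt (hJo.mem_nhds hx)).hasDerivAt
  have hiter : ∀ x ∈ J, iteratedDerivWithin 2 f I x = deriv (deriv f) x := by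
    intro x hx
    have h1 : iteratedDerivWithin 2 f I x = iteratedDeriv 2 f x := by
      rw [iteratedDerivWithin, iteratedDeriv, ← iteratedFDerivWithin_univ,
        iteratedFDerivWithin_congr_set (eventuallyEq_univ.2 (mem_interior_iff_mem_nhds.1 hx))]
    rw [h1, iteratedDeriv_succ, iteratedDeriv_one]
  have hcover : X ⊆ ({x : ℝ | x ∈ I ∧ iteratedDerivWithin 2 f I x = 0} ∪ I \ J) ∪
      {x ∈ X | x ∈ J ∧ deriv (deriv f) x ≠ 0} := by
    intro x hx
    by_cases hxJ : x ∈ J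
    · by_cases h0 : deriv (deriv f) x = 0
      · exact Or.inl (Or.inl ⟨hx.1, (hiter x hxJ).trans h0⟩)
      · exact Or.inr ⟨hx, hxJ, h0⟩
    · exact Or.inl (Or.inr ⟨hx.1, hxJ⟩)
  refine (dimH_mono hcover).trans ?_
  rw [dimH_union, dimH_union, hI.dimH_diff_interior]
  refine max_le (max_le hdim zero_le) ?_
  by_contra hlt
  push Not at hlt
  obtain ⟨s₀, hs₀, hs₀lt⟩ := ENNReal.lt_iff_exists_nnreal_btwn.1 hlt
  have hlpos : 0 < 2 / (1 + l) := by positivity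
  have hlone : 2 / (1 + l) < 1 := by rw [div_lt_one (by linarith)]; linarith
  -- The covering argument requires `s ≤ 1`; since `2 / (1 + l) < 1`, truncation keeps `s` above the
  -- claimed dimension. That leaves room for `τ < l` with `s (1 + τ) > 2`.
  set s : NNReal := min s₀ 1 with hs
  have hs1 : s ≤ 1 := min_le_right _ _
  have hsl : 2 / (1 + l) < s := by
    rw [hs, NNReal.coe_min, lt_min_iff]
    refine ⟨?_, by simpa using hlone⟩
    rw [← ENNReal.ofReal_coe_nnreal] at hs₀
    exact (ENNReal.ofReal_lt_ofReal_iff_of_nonneg hlpos.le).1 hs₀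
  have hs0 : (0 : ℝ) < s := hlpos.trans hsl
  have hslt : (s : ENNReal) < dimH {x ∈ X | x ∈ J ∧ deriv (deriv f) x ≠ 0} :=
    lt_of_le_of_lt (by exact_mod_cast min_le_left s₀ 1) hs₀lt
  obtain ⟨τ, hτ1, hτl⟩ := exists_between (max_lt hl1 (show 2 / (s : ℝ) - 1 < l by
    rw [div_lt_iff₀ (by linarith)] at hsl
    rw [sub_lt_iff_lt_add, div_lt_iff₀ hs0]
    linarith))
  have hτ : 1 < τ := (le_max_left _ _).trans_lt hτ1
  have hsτ : 2 < s * (1 + τ) := by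
    have h1 := (le_max_right _ _).trans_lt hτ1
    rw [sub_lt_iff_lt_add, div_lt_iff₀ hs0] at h1
    linarith
  obtain ⟨x, hx, hloc⟩ := exists_mem_nhdsWithin_lt_dimH_of_lt_dimH hslt
  obtain ⟨N₀, hN₀⟩ := eventually_atTop.1
    (tendsto_natCast_atTop_atTop.eventually (hl.eventually_lt hψ hτl))
  obtain ⟨V, hV, hVdim⟩ := exists_nhds_dimH_le hJo hd1 hd2 hf''.continuousOn hx.2.1 hx.2.2 hτ hsτ hs1
    (E := {x ∈ X | x ∈ J ∧ deriv (deriv f) x ≠ 0}) (by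
      intro y hy N
      obtain ⟨q, hq, hqN⟩ := (mem_multApproximable_graph.1 hy.1.2).exists_gt (max N N₀)
      exact ⟨q, ((le_max_left _ _).trans_lt hqN).le,
        hq.2.trans (hN₀ q ((le_max_right _ _).trans_lt hqN).le)⟩)
  refine absurd (hloc _ (inter_mem self_mem_nhdsWithin (mem_nhdsWithin_of_mem_nhds hV))) ?_
  exact not_lt.2 hVdim

/-- Neither curvature nor smoothness of `f` enters: the factor `‖q f(y)‖` is merely bounded by 1,
and the denominators of good approximations to `y` alone serve as `q`. -/
theorem le_dimH_graph {ψ f : ℝ → ℝ} (hψ : IsApproximatingFunction ψ) {l : ℝ} (hl : HasOrder ψ l)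
    (hl1 : 1 < l) {I : Set ℝ} (hI : I.OrdConnected) (hI' : I.Nontrivial) :
    ENNReal.ofReal (2 / (1 + l)) ≤ dimH (graphCurve f I ∩ multApproximable 2 ψ) := by
  obtain ⟨u, hu, v, hv, huv⟩ := hI'.exists_lt
  have hstep : ∀ τ > l, ENNReal.ofReal (2 / (1 + τ)) ≤
      dimH (graphCurve f I ∩ multApproximable 2 ψ) := by
    intro τ hτ
    refine (le_dimH_wellApproximable huv (hl1.trans hτ)).trans ?_
    have hL : LipschitzWith ‖(EuclideanSpace.proj 0 : EuclideanSpace ℝ (Fin 2) →L[ℝ] ℝ)‖₊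
        (EuclideanSpace.proj 0 : EuclideanSpace ℝ (Fin 2) →L[ℝ] ℝ) :=
      ContinuousLinearMap.lipschitz _
    refine (dimH_mono ?_).trans (hL.dimH_image_le _)
    obtain ⟨N₀, hN₀⟩ := eventually_atTop.1
      (tendsto_natCast_atTop_atTop.eventually (hl.eventually_gt hψ hτ))
    rintro y ⟨hy, hyr⟩
    refine ⟨!₂[y, f y], ⟨⟨y, hI.out hu hv hy, rfl⟩, ?_⟩, by simp⟩
    rw [mem_multApproximable_graph]
    refine Set.infinite_of_not_bddAbove fun ⟨B, hB⟩ => ?_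
    obtain ⟨r, hr, hyr⟩ := hyr (max (B + 1) N₀)
    have hden : (0 : ℝ) < r.den := by exact_mod_cast r.pos
    refine absurd (hB (a := r.den) ⟨r.pos, ?_⟩)
      (not_le.2 (Nat.lt_of_succ_le ((le_max_left _ _).trans hr)))
    have h1 : distInt (r.den * y) ≤ (r.den : ℝ) ^ (-τ) := by
      have h2 : distInt (r.den * y) ≤ |r.den * y - (r.num : ℝ)| := round_le _ _
      have h3 : (r.den : ℝ) * y - r.num = r.den * (y - r) := by
        have : (r : ℝ) = r.num / r.den := by exact_mod_cast (Rat.num_div_den r).symm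
        rw [this]
        field_simp
      rw [h3, abs_mul, abs_of_pos hden] at h2
      have h4 : (r.den : ℝ) * (r.den : ℝ) ^ (-1 - τ) = (r.den : ℝ) ^ (-τ) := by
        rw [show -1 - τ = -τ - 1 by ring, Real.rpow_sub_one hden.ne']
        field_simp
      rw [← h4]
      exact h2.trans (by gcongr)
    have h5 : distInt (r.den * f y) ≤ 1 := (distInt_le_half _).trans (by norm_num)
    calc distInt (r.den * y) * distInt (r.den * f y) ≤ (r.den : ℝ) ^ (-τ) * 1 := by
          gcongr
          exact distInt_nonneg _
      _ = (r.den : ℝ) ^ (-τ) := mul_one _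
      _ < ψ r.den := hN₀ _ ((le_max_right _ _).trans hr)
  have hcont : Tendsto (fun τ : ℝ => ENNReal.ofReal (2 / (1 + τ))) (𝓝[>] l)
      (𝓝 (ENNReal.ofReal (2 / (1 + l)))) := by
    refine (ENNReal.continuous_ofReal.tendsto _).comp (tendsto_nhdsWithin_of_tendsto_nhds ?_)
    exact (continuousAt_const.div (continuousAt_const.add continuousAt_id)
      (show 1 + l ≠ 0 from (by linarith : 0 < 1 + l).ne'))
  exact le_of_tendsto hcont (eventually_nhdsWithin_of_forall hstep)

theorem mainTheorem8 (I : Set ℝ) (hI : I.OrdConnected) (hI' : I.Nontrivial)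
    (f : ℝ → ℝ) (hf : ContDiffOn ℝ 3 f I)
    (ψ : ℝ → ℝ) (hψ : IsApproximatingFunction ψ)
    (l : ℝ) (hl : HasOrder ψ l) (hl1 : 1 < l)
    (hdim : dimH {x : ℝ | x ∈ I ∧ iteratedDerivWithin 2 f I x = 0}
      ≤ ENNReal.ofReal (2 / (1 + l))) :
    dimH (graphCurve f I ∩ multApproximable 2 ψ) = ENNReal.ofReal (2 / (1 + l)) :=
  le_antisymm (dimH_graph_le hψ hl hl1 hI hf hdim) (le_dimH_graph hψ hl hl1 hI hI')
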